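/- Let $\Omega\subset\mathbb{R}^3$ be a bounded open set whose boundary is $C^2$: near every $x_0\in\partial\Omega$, up to a rotation and relabeling of coordinates, $\partial\Omega$ is the graph $x_3=\eta(x_1,x_2)$ of a $C^2$ function and $\Omega$ is the region $x_3>\eta(x_1,x_2)$. Let $n(x)$ be the outward unit normal, $dS_x$ the surface measure, $\gamma_\pm=\{(x,v)\in\partial\Omega\times\mathbb{R}^3:\pm n(x)\cdot v>0\}$, $d\gamma=|n(x)\cdot v|\,dS_x\,dv$, $\mu(v)=e^{-|v|^2/2}$, $\langle v\rangle=\sqrt{1+|v|^2}$. Write $\|\cdot\|_1$ for the norm of $L^1(\Omega\times\mathbb{R}^3)$, $|\cdot|_1$ for the norm of $L^1(\partial\Omega\times\mathbb{R}^3,dS_x\,dv)$ and $|\cdot|_{\gamma_\pm,1}$ for the norm of $L^1(\gamma_\pm,d\gamma)$. Fix constants $C_1,C_2>0$. Then there are constants $K>0$ and $\delta_0>0$, and for every $0<\delta<\delta_0$ a constant $C_\delta>0$, all depending only on $\Omega,C_1,C_2$ (and $C_\delta$ also on $\delta$), such that the following holds. Let $T>0$, let $\nu=\nu(t,x,v)\ge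 0$ be measurable, let $h_0\in L^1(\Omega\times\mathbb{R}^3)$, and let $(h^m)_{m\ge 0}\subset L^\infty([0,T];L^1(\Omega\times\mathbb{R}^3))$ have traces on $\gamma_+$ in $L^1([0,T];L^1(\gamma_+,d\gamma))$. Suppose that for every $m\ge 0$, with $\nu h^{m+1}$ locally integrable in $[0,T)\times\Omega\times\mathbb{R}^3$, $$(\partial_t+v\cdot\nabla_x+\nu)\,h^{m+1}=H^m,\qquad h^{m+1}|_{t=0}=h_0$$ in the sense of distributions, that $h^{m+1}$ has a measurable trace on $\gamma_-$, and that for almost every $(t,x,v)\in[0,T]\times\gamma_-$ $$|h^{m+1}(t,x,v)|\le C_1\sqrt{\mu(v)}\Big(1+\frac{\langle v\rangle}{|n(x)\cdot v|}\Big)\int_{n(x)\cdot u>0}|h^m(t,x,u)|\,\mu(u)^{1/4}\{n(x)\cdot u\}\,du+\Big(1+\frac{e^{-C_2|v|^2}}{|n(x)\cdot v|}\Big)R^m(t,x,v),$$ where $H^m\in L^1([0,T];L^1(\Omega\times\mathbb{R}^3))$ and $R^m\in L^1([0,T];L^1(\partial\Omega\times\mathbb{R}^3,\langle v\rangle\,dS_x\,dv))$.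 (The trace of $h$ at $(t,x,v)\in[0,T]\times\gamma_\pm$ is the essential limit of $h(t\mp s,x\mp sv,v)$ as $s\downarrow0$, taken for almost every $(t,x,v)$ with respect to $dt\,d\gamma$.) Then for all $m\ge 1$ the trace of $h^{m+1}$ on $\gamma_-$ belongs to $L^1([0,T];L^1(\gamma_-,d\gamma))$, and for all $t\in[0,T]$ and $0<\delta<\delta_0$ $$\int_0^t|h^{m+1}(s)|_{\gamma_-,1}\,ds\le K\delta\int_0^t|h^{m-1}(s)|_{\gamma_+,1}\,ds+C_\delta\|h_0\|_1+C_\delta\max_{i=m,m-1}\Big\{\int_0^t\|h^i(s)\|_1\,ds+\int_0^t|\langle v\rangle R^i(s)|_1\,ds+\int_0^t\|H^i(s)\|_1\,ds\Big\}.$$ -/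

import Mathlib

open MeasureTheory Set Filter Topology
open scoped ContDiff

namespace KineticTrace

noncomputable section

/-- The space `ℝ³` with its Euclidean structure (used both for positions and for velocities). -/
abbrev E3 : Type := EuclideanSpace ℝ (Fin 3)

/-- The space `ℝ²` with its Euclidean structure. -/
abbrev E2 : Type := EuclideanSpace ℝ (Fin 2)

/-! ### Domains with `C²` boundary, normal vector, surface measure -/

/-- The first two coordinates of a point of `ℝ³`. -/
def horiz (y : E3) : E2 := !₂[y 0, y 1]

/-- Inside the ball `B(x₀; r)` and up to the linear isometry `A` (a rotation and a relabelling of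
the coordinates), the boundary of `Ω` is the graph of the `C²` function `η : ℝ² → ℝ`, and `Ω` is
the part of the ball above the graph. -/
structure IsGraphChart (Ω : Set E3) (x₀ : E3) (r : ℝ) (A : E3 ≃ₗᵢ[ℝ] E3) (η : E2 → ℝ) : Prop where
  radius_pos : 0 < r
  contDiff : ContDiff ℝ 2 η
  mem_frontier_iff : ∀ y ∈ Metric.ball x₀ r, (y ∈ frontier Ω ↔ A y 2 = η (horiz (A y)))
  mem_iff : ∀ y ∈ Metric.ball x₀ r, (y ∈ Ω ↔ η (horiz (A y)) < A y 2)

/-- The boundary of `Ω` is locally the graph of a `C²` function, with `Ω` on one side of it. -/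
def HasC2Boundary (Ω : Set E3) : Prop :=
  ∀ x₀ ∈ frontier Ω, ∃ (r : ℝ) (A : E3 ≃ₗᵢ[ℝ] E3) (η : E2 → ℝ), IsGraphChart Ω x₀ r A η

/-- The `i`-th partial derivative of `η : ℝ² → ℝ`. -/
def partialDeriv (i : Fin 2) (η : E2 → ℝ) (y : E2) : ℝ :=
  fderiv ℝ η y (EuclideanSpace.single i 1)

/-- The unit vector `(∂₁η, ∂₂η, -1) / √(1 + |∇η|²)` at the point above `y`: the unit normal of the
graph of `η` that points out of the region above the graph. -/
def graphNormal (η : E2 → ℝ) (y : E2) : E3 :=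
  (Real.sqrt (1 + partialDeriv 0 η y ^ 2 + partialDeriv 1 η y ^ 2))⁻¹ •
    !₂[partialDeriv 0 η y, partialDeriv 1 η y, -1]

/-- `n` is the outward unit normal of `Ω` at `x`, computed in a graph chart at `x`. -/
def IsOutwardNormal (Ω : Set E3) (x n : E3) : Prop :=
  ∃ (r : ℝ) (A : E3 ≃ₗᵢ[ℝ] E3) (η : E2 → ℝ),
    IsGraphChart Ω x r A η ∧ n = A.symm (graphNormal η (horiz (A x)))

open Classical in
/-- The outward unit normal `n(x)` at `x ∈ ∂Ω` (with the value `0` off the boundary). -/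
def normal (Ω : Set E3) (x : E3) : E3 :=
  if h : x ∈ frontier Ω ∧ ∃ n, IsOutwardNormal Ω x n then h.2.choose else 0

/-- The normal velocity `n(x) · v` at the phase point `p = (x, v)`. -/
def normalVel (Ω : Set E3) (p : E3 × E3) : ℝ := inner ℝ (normal Ω p.1) p.2

/-- The surface measure `dS_x` on `∂Ω`: the two-dimensional Hausdorff measure, normalized so as to
agree with Lebesgue measure on planes. -/
def surfaceMeasure (Ω : Set E3) : Measure E3 := (μHE[2] : Measure E3).restrict (frontier Ω)

/-- The measure `dS_x dv` on `∂Ω × ℝ³`. -/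
def boundaryMeasure (Ω : Set E3) : Measure (E3 × E3) := (surfaceMeasure Ω).prod volume

/-- The measure `dγ = |n(x) · v| dS_x dv` on `∂Ω × ℝ³`. -/
def gammaMeasure (Ω : Set E3) : Measure (E3 × E3) :=
  (boundaryMeasure Ω).withDensity fun p => ENNReal.ofReal |normalVel Ω p|

/-- The outgoing set `γ₊`. -/
def gammaPlus (Ω : Set E3) : Set (E3 × E3) := {p | p.1 ∈ frontier Ω ∧ 0 < normalVel Ω p}

/-- The incoming set `γ₋`. -/
def gammaMinus (Ω : Set E3) : Set (E3 × E3) := {p | p.1 ∈ frontier Ω ∧ normalVel Ω p < 0}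

/-! ### Weights and norms -/

/-- The global Maxwellian `μ(v) = exp(-|v|²/2)`. -/
def maxwellian (v : E3) : ℝ := Real.exp (-‖v‖ ^ 2 / 2)

/-- The weight `⟨v⟩ = √(1 + |v|²)`. -/
def bracket (v : E3) : ℝ := Real.sqrt (1 + ‖v‖ ^ 2)

/-- The phase space `Ω × ℝ³`. -/
def phase (Ω : Set E3) : Set (E3 × E3) := Ω ×ˢ (univ : Set E3)

/-- The norm `‖f‖₁` of `L¹(Ω × ℝ³)`. -/
def bulkNorm (Ω : Set E3) (f : E3 × E3 → ℝ) : ℝ := ∫ p in phase Ω, |f p|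

/-- The norm `|f|₁` of `L¹(∂Ω × ℝ³, dS_x dv)`. -/
def bdryNorm (Ω : Set E3) (f : E3 × E3 → ℝ) : ℝ := ∫ p, |f p| ∂(boundaryMeasure Ω)

/-- The norm `|f|_{γ₊,1}`. -/
def gammaPlusNorm (Ω : Set E3) (f : E3 × E3 → ℝ) : ℝ :=
  ∫ p in gammaPlus Ω, |f p| ∂(gammaMeasure Ω)

/-- The norm `|f|_{γ₋,1}`. -/
def gammaMinusNorm (Ω : Set E3) (f : E3 × E3 → ℝ) : ℝ :=
  ∫ p in gammaMinus Ω, |f p| ∂(gammaMeasure Ω)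

/-- Lebesgue measure `dt` on `[0, T]`. -/
def timeMeasure (T : ℝ) : Measure ℝ := volume.restrict (Icc 0 T)

/-- The measure `dt dx dv` on `[0, T] × Ω × ℝ³`. -/
def bulkTimeMeasure (Ω : Set E3) (T : ℝ) : Measure (ℝ × (E3 × E3)) :=
  (timeMeasure T).prod (volume.restrict (phase Ω))

/-- The measure `dt dS_x dv` on `[0, T] × ∂Ω × ℝ³`. -/
def bdryTimeMeasure (Ω : Set E3) (T : ℝ) : Measure (ℝ × (E3 × E3)) :=
  (timeMeasure T).prod (boundaryMeasure Ω)

/-- The measure `dt dγ` on `[0, T] × γ₊`. -/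
def gammaPlusTimeMeasure (Ω : Set E3) (T : ℝ) : Measure (ℝ × (E3 × E3)) :=
  (timeMeasure T).prod ((gammaMeasure Ω).restrict (gammaPlus Ω))

/-- The measure `dt dγ` on `[0, T] × γ₋`. -/
def gammaMinusTimeMeasure (Ω : Set E3) (T : ℝ) : Measure (ℝ × (E3 × E3)) :=
  (timeMeasure T).prod ((gammaMeasure Ω).restrict (gammaMinus Ω))

/-- `h ∈ L^∞([0, T]; L¹(Ω × ℝ³))`. -/
structure MemLinftyL1 (Ω : Set E3) (T : ℝ) (h : ℝ → E3 × E3 → ℝ) : Prop where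
  aestronglyMeasurable : AEStronglyMeasurable (Function.uncurry h) (bulkTimeMeasure Ω T)
  bounded : ∃ M : ℝ, ∀ᵐ t ∂(timeMeasure T), IntegrableOn (h t) (phase Ω) ∧ bulkNorm Ω (h t) ≤ M

/-! ### Solutions and traces -/

/-- The transport derivative `(∂ₜ + v · ∇ₓ) φ` of a smooth function, at `z = (t, (x, v))`. -/
def transport (φ : ℝ × (E3 × E3) → ℝ) (z : ℝ × (E3 × E3)) : ℝ := fderiv ℝ φ z (1, (z.2.2, 0))

/-- `h` solves `(∂ₜ + v · ∇ₓ + ν) h = H` in `(0, T) × Ω × ℝ³` with `h|_{t = 0} = h₀`, in the sense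
of distributions: the test functions are smooth with compact support in `[0, T) × Ω × ℝ³`.
The local integrability of `ν h` is what gives `ν h` a meaning as a distribution. -/
structure IsWeakSolution (Ω : Set E3) (T : ℝ) (ν H : ℝ → E3 × E3 → ℝ) (h₀ : E3 × E3 → ℝ)
    (h : ℝ → E3 × E3 → ℝ) : Prop where
  locallyIntegrable : LocallyIntegrableOn (fun z : ℝ × (E3 × E3) => ν z.1 z.2 * h z.1 z.2)
    (Ico 0 T ×ˢ phase Ω)
  weak_eq : ∀ φ : ℝ × (E3 × E3) → ℝ, ContDiff ℝ ∞ φ → HasCompactSupport φ →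
    tsupport φ ⊆ Iio T ×ˢ phase Ω →
    ∫ z, (-(h z.1 z.2 * transport φ z) + ν z.1 z.2 * h z.1 z.2 * φ z) ∂(bulkTimeMeasure Ω T) =
      (∫ z, H z.1 z.2 * φ z ∂(bulkTimeMeasure Ω T)) + ∫ p in phase Ω, h₀ p * φ (0, p)

/-- `g` is the trace of `h` on `[0, T] × γ₊`: for almost every `(t, x, v)` with respect to `dt dγ`,
`h` converges to `g(t, x, v)` along the characteristic that reaches `(t, x, v)` from inside, that is
`h(t - s, x - s v, v) → g(t, x, v)` as `s ↓ 0`. The limit is the essential one (it ignores null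
sets of `s`), so that the trace does not depend on the representative of `h`. -/
structure IsOutgoingTrace (Ω : Set E3) (T : ℝ) (h g : ℝ → E3 × E3 → ℝ) : Prop where
  aestronglyMeasurable : AEStronglyMeasurable (Function.uncurry g) (gammaPlusTimeMeasure Ω T)
  tendsto : ∀ᵐ z ∂(gammaPlusTimeMeasure Ω T),
    Tendsto (fun s : ℝ => h (z.1 - s) (z.2.1 - s • z.2.2, z.2.2)) (𝓝[>] 0 ⊓ ae volume)
      (𝓝 (g z.1 z.2))

/-- `g` is the trace of `h` on `[0, T] × γ₋`: for almost every `(t, x, v)` with respect to `dt dγ`,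
`h(t + s, x + s v, v) → g(t, x, v)` as `s ↓ 0`, as an essential limit along the characteristic
that starts at `(t, x, v)`. -/
structure IsIncomingTrace (Ω : Set E3) (T : ℝ) (h g : ℝ → E3 × E3 → ℝ) : Prop where
  aestronglyMeasurable : AEStronglyMeasurable (Function.uncurry g) (gammaMinusTimeMeasure Ω T)
  tendsto : ∀ᵐ z ∂(gammaMinusTimeMeasure Ω T),
    Tendsto (fun s : ℝ => h (z.1 + s) (z.2.1 + s • z.2.2, z.2.2)) (𝓝[>] 0 ⊓ ae volume)
      (𝓝 (g z.1 z.2))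

/-- The diffuse-type bound of an incoming trace `g'` by an outgoing trace `g` and a remainder `R`:
for almost every `(t, x, v)` in `[0, T] × γ₋`,
`|g'(t,x,v)| ≤ C₁ √μ(v) (1 + ⟨v⟩/|n(x)·v|) ∫_{n(x)·u>0} |g(t,x,u)| μ(u)^{1/4} {n(x)·u} du
  + (1 + e^{-C₂|v|²}/|n(x)·v|) R(t,x,v)`. -/
def DiffuseBound (Ω : Set E3) (T C₁ C₂ : ℝ) (g' g R : ℝ → E3 × E3 → ℝ) : Prop :=
  ∀ᵐ z ∂(gammaMinusTimeMeasure Ω T),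
    |g' z.1 z.2| ≤
      C₁ * Real.sqrt (maxwellian z.2.2) * (1 + bracket z.2.2 / |normalVel Ω z.2|) *
        (∫ u in {u : E3 | 0 < normalVel Ω (z.2.1, u)},
          |g z.1 (z.2.1, u)| * maxwellian u ^ (1 / 4 : ℝ) * normalVel Ω (z.2.1, u)) +
      (1 + Real.exp (-C₂ * ‖z.2.2‖ ^ 2) / |normalVel Ω z.2|) * R z.1 z.2

end

end KineticTrace

open KineticTrace

/-! Multiplying the boundary inequality by |n·v| removes both singular factors: since |n·v| ≤ ⟨v⟩,
it gives |n·v||h^{m+1}| ≤ 2C₁√μ(v)⟨v⟩ J + 2⟨v⟩|R^m|, where J(t,x) is the outgoing flux of |h^m| with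
the weight μ^{1/4} (`diffuse_pointwise`). As √μ⟨v⟩ is integrable, the incoming norm of h^{m+1} is at
most a constant times the weighted outgoing norm of h^m, plus a remainder term
(`lintegral_incoming_le`). One reflection yields no small factor; the second one does.

The outgoing trace of h^m is followed backward along x - s v. Because ν ≥ 0, |h^m| grows forward
along a trajectory by at most the integral of |H^{m-1}|. There are three cases
(`exists_lintegral_outgoing_le`). If the trajectory reaches time 0 inside Ω, the value is charged to
h₀. If it spends at least a time ε in Ω, averaging over that time charges it to ε⁻¹ times the
integral of |h^m|. If it is shorter than ε, the value is charged to the incoming trace at the entry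
point, where the boundary inequality applies again, now with h^{m-1} and only over velocities whose
flight time is below ε. In a C² domain a chord of length d leaves the tangent plane by O(d²), so
these velocities satisfy |n·v| ≤ Cε|v|² or |v| ≥ r/ε, and the integral of √μ⟨v⟩ over them tends to 0
with ε, uniformly in the boundary point (`exists_lintegral_short_le`). A suitable ε produces the
factor δ.

Two tools make this rigorous. The first is the change of variables (x, s) ↦ x - s v from the
boundary to the interior, under which |n·v| dS ds and dx are comparable (`exists_lintegral_flow_le`,
`exists_le_lintegral_flow`). Constants are free, so two-sided bounds for the surface measure replace
the area formula. These bounds also show that trajectories from almost every boundary point avoid a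
given interior null set. The second is the passage from the weak equation to almost every single
trajectory, by test functions ψ(t)χ(x - t v, v) and the lemma of du Bois-Reymond
(`ae_exists_growth`). Extending h by h₀ to negative times absorbs the initial condition, and
essential limits then bring in the traces (`ae_trace_le`). -/

namespace KineticTrace

noncomputable section

/-! ### Graph charts and the outward normal -/

/-- `horiz` as a continuous linear map. -/
def horizL : E3 →L[ℝ] E2 :=
  LinearMap.toContinuousLinearMap
    { toFun := horiz
      map_add' := fun x y => by ext i; fin_cases i <;> simp [horiz]
      map_smul' := fun c x => by ext i; fin_cases i <;> simp [horiz] }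

theorem horizL_apply (x : E3) : horizL x = horiz x := rfl

theorem norm_horiz_le (x : E3) : ‖horiz x‖ ≤ ‖x‖ := by
  rw [EuclideanSpace.norm_eq, EuclideanSpace.norm_eq]
  apply Real.sqrt_le_sqrt
  simp [Fin.sum_univ_three, horiz]
  positivity

theorem continuous_horiz : Continuous horiz := horizL.continuous

/-- The derivative of `z ↦ η (horiz z) - z 2` at a point above `y`, in the direction `w`. -/
def slope (η : E2 → ℝ) (y : E2) (w : E3) : ℝ := fderiv ℝ η y (horiz w) - w 2

/-- The Jacobian factor `√(1 + |∇η|²)`. -/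
def areaFactor (η : E2 → ℝ) (y : E2) : ℝ :=
  Real.sqrt (1 + partialDeriv 0 η y ^ 2 + partialDeriv 1 η y ^ 2)

theorem one_le_areaFactor (η : E2 → ℝ) (y : E2) : 1 ≤ areaFactor η y := by
  rw [areaFactor, Real.one_le_sqrt]
  nlinarith [sq_nonneg (partialDeriv 0 η y), sq_nonneg (partialDeriv 1 η y)]

theorem fderiv_horiz (η : E2 → ℝ) (y : E2) (w : E3) :
    fderiv ℝ η y (horiz w) = w 0 * partialDeriv 0 η y + w 1 * partialDeriv 1 η y := by
  have : horiz w = w 0 • EuclideanSpace.single 0 1 + w 1 • EuclideanSpace.single 1 1 := by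
    ext i; fin_cases i <;> simp [horiz]
  rw [this, map_add, map_smul, map_smul]
  rfl

theorem inner_graphNormal (η : E2 → ℝ) (y : E2) (w : E3) :
    inner ℝ (graphNormal η y) w = (areaFactor η y)⁻¹ * slope η y w := by
  rw [graphNormal, inner_smul_left, slope, fderiv_horiz, areaFactor]
  simp [PiLp.inner_apply, Fin.sum_univ_three]
  left; ring

theorem norm_graphNormal (η : E2 → ℝ) (y : E2) : ‖graphNormal η y‖ = 1 := by
  have h : inner ℝ (graphNormal η y) (graphNormal η y) = (1 : ℝ) := by
    rw [inner_graphNormal, slope, fderiv_horiz]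
    have h1 := one_le_areaFactor η y
    have h2 : areaFactor η y ^ 2 = 1 + partialDeriv 0 η y ^ 2 + partialDeriv 1 η y ^ 2 :=
      Real.sq_sqrt (by positivity)
    have e : ∀ i, graphNormal η y i = (areaFactor η y)⁻¹ *
        (!₂[partialDeriv 0 η y, partialDeriv 1 η y, -1] : E3) i := fun i => rfl
    rw [e, e, e]
    simp
    field_simp
    linarith
  rw [real_inner_self_eq_norm_sq] at h
  nlinarith [norm_nonneg (graphNormal η y)]

theorem continuous_partialDeriv {η : E2 → ℝ} (hη : ContDiff ℝ 2 η) (i : Fin 2) :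
    Continuous (partialDeriv i η) :=
  (hη.continuous_fderiv (by norm_num)).clm_apply continuous_const

theorem continuous_areaFactor {η : E2 → ℝ} (hη : ContDiff ℝ 2 η) : Continuous (areaFactor η) := by
  have h0 := continuous_partialDeriv hη 0
  have h1 := continuous_partialDeriv hη 1
  unfold areaFactor
  fun_prop

theorem continuous_graphNormal {η : E2 → ℝ} (hη : ContDiff ℝ 2 η) :
    Continuous (graphNormal η) := by
  have h0 := continuous_partialDeriv hη 0
  have h1 := continuous_partialDeriv hη 1
  have h2 : Continuous fun y => (areaFactor η y)⁻¹ :=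
    (continuous_areaFactor hη).inv₀ fun y => by linarith [one_le_areaFactor η y]
  refine h2.smul ?_
  refine (PiLp.continuous_toLp 2 _).comp (continuous_pi fun i => ?_)
  fin_cases i
  · exact h0
  · exact h1
  · exact continuous_const

/-- The unit normal in the chart `(A, η)`, as a function on `ℝ³`. -/
def chartNormal (A : E3 ≃ₗᵢ[ℝ] E3) (η : E2 → ℝ) (x : E3) : E3 :=
  A.symm (graphNormal η (horiz (A x)))

theorem continuous_chartNormal (A : E3 ≃ₗᵢ[ℝ] E3) {η : E2 → ℝ} (hη : ContDiff ℝ 2 η) :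
    Continuous (chartNormal A η) :=
  A.symm.continuous.comp
    ((continuous_graphNormal hη).comp (continuous_horiz.comp A.continuous))

theorem norm_chartNormal (A : E3 ≃ₗᵢ[ℝ] E3) (η : E2 → ℝ) (x : E3) : ‖chartNormal A η x‖ = 1 := by
  rw [chartNormal, LinearIsometryEquiv.norm_map, norm_graphNormal]

/-- The chart normal is the normalized gradient of the defining function of the graph, so n·w is a
directional derivative divided by the area factor. All sign and size statements about n·v go through
this identity. -/
theorem inner_chartNormal (A : E3 ≃ₗᵢ[ℝ] E3) (η : E2 → ℝ) (x w : E3) :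
    inner ℝ (chartNormal A η x) w =
      (areaFactor η (horiz (A x)))⁻¹ * slope η (horiz (A x)) (A w) := by
  rw [← inner_graphNormal, chartNormal]
  conv_lhs => rw [← A.symm_apply_apply w]
  rw [A.symm.inner_map_map]

/-- The defining function `η (horiz (A x)) - (A x)₂` of a graph chart. -/
def chartFun (A : E3 ≃ₗᵢ[ℝ] E3) (η : E2 → ℝ) (x : E3) : ℝ := η (horiz (A x)) - A x 2

theorem hasDerivAt_chartFun (A : E3 ≃ₗᵢ[ℝ] E3) {η : E2 → ℝ} (hη : ContDiff ℝ 2 η) (x w : E3) :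
    HasDerivAt (fun s : ℝ => chartFun A η (x + s • w)) (slope η (horiz (A x)) (A w)) 0 := by
  have h1 : HasDerivAt (fun s : ℝ => A (x + s • w)) (A w) 0 := by
    have : HasDerivAt (fun s : ℝ => x + s • w) w 0 := by
      simpa using ((hasDerivAt_id (0 : ℝ)).smul_const w).const_add x
    exact (A.toContinuousLinearEquiv : E3 →L[ℝ] E3).hasFDerivAt.comp_hasDerivAt 0 this
  have h2 : HasDerivAt (fun s : ℝ => horiz (A (x + s • w))) (horiz (A w)) 0 :=
    horizL.hasFDerivAt.comp_hasDerivAt 0 h1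
  have h3 : HasDerivAt (fun s : ℝ => A (x + s • w) 2) (A w 2) 0 :=
    (EuclideanSpace.proj (2 : Fin 3) : E3 →L[ℝ] ℝ).hasFDerivAt.comp_hasDerivAt 0 h1
  have hd : DifferentiableAt ℝ η (horiz (A (x + (0 : ℝ) • w))) :=
    (hη.differentiable (by norm_num)).differentiableAt
  have h4 := hd.hasFDerivAt.comp_hasDerivAt 0 h2
  have h5 := h4.sub h3
  simp only [zero_smul, add_zero] at h5
  exact h5

namespace IsGraphChart

variable {Ω : Set E3} {x₀ : E3} {r : ℝ} {A : E3 ≃ₗᵢ[ℝ] E3} {η : E2 → ℝ}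

theorem mono (h : IsGraphChart Ω x₀ r A η) {x : E3} {s : ℝ} (hs : 0 < s)
    (hsub : Metric.ball x s ⊆ Metric.ball x₀ r) : IsGraphChart Ω x s A η :=
  ⟨hs, h.contDiff, fun y hy => h.mem_frontier_iff y (hsub hy), fun y hy => h.mem_iff y (hsub hy)⟩

theorem mem_iff_chartFun (h : IsGraphChart Ω x₀ r A η) {y : E3} (hy : y ∈ Metric.ball x₀ r) :
    y ∈ Ω ↔ chartFun A η y < 0 := by
  rw [h.mem_iff y hy, chartFun, sub_neg]

theorem mem_frontier_iff_chartFun (h : IsGraphChart Ω x₀ r A η) {y : E3}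
    (hy : y ∈ Metric.ball x₀ r) : y ∈ frontier Ω ↔ chartFun A η y = 0 := by
  rw [h.mem_frontier_iff y hy, chartFun, sub_eq_zero, eq_comm]

theorem tendsto_chartFun_div (h : IsGraphChart Ω x₀ r A η) (hx : x₀ ∈ frontier Ω) (w : E3) :
    Tendsto (fun s : ℝ => s⁻¹ * chartFun A η (x₀ + s • w)) (𝓝[>] 0)
      (𝓝 (slope η (horiz (A x₀)) (A w))) := by
  have h0 : chartFun A η x₀ = 0 :=
    (h.mem_frontier_iff_chartFun (Metric.mem_ball_self h.radius_pos)).1 hx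
  have := (hasDerivAt_iff_tendsto_slope_zero.1 (hasDerivAt_chartFun A h.contDiff x₀ w)).mono_left
    (nhdsGT_le_nhdsNE (0 : ℝ))
  simpa [h0] using this

theorem eventually_mem_ball (h : IsGraphChart Ω x₀ r A η) (w : E3) :
    ∀ᶠ s : ℝ in 𝓝[>] 0, x₀ + s • w ∈ Metric.ball x₀ r := by
  have hc : ContinuousAt (fun s : ℝ => x₀ + s • w) 0 := by fun_prop
  have : Metric.ball x₀ r ∈ 𝓝 (x₀ + (0 : ℝ) • w) := by
    simpa using Metric.ball_mem_nhds x₀ h.radius_pos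
  exact nhdsWithin_le_nhds (hc this)

/-- Near the base point Ω is the region where `chartFun` is negative, and `chartFun` vanishes at the
base point; the sign of its derivative along w decides on which side the half-line starts. -/
theorem eventually_mem_of_slope_neg (h : IsGraphChart Ω x₀ r A η) (hx : x₀ ∈ frontier Ω) {w : E3}
    (hw : slope η (horiz (A x₀)) (A w) < 0) : ∀ᶠ s : ℝ in 𝓝[>] 0, x₀ + s • w ∈ Ω := by
  filter_upwards [(h.tendsto_chartFun_div hx w).eventually_lt_const hw, h.eventually_mem_ball w,
    self_mem_nhdsWithin] with s h1 h2 (h3 : 0 < s)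
  rw [h.mem_iff_chartFun h2]
  by_contra hc
  push Not at hc
  exact absurd h1 (not_lt.2 (by positivity))

theorem eventually_notMem_of_slope_pos (h : IsGraphChart Ω x₀ r A η) (hx : x₀ ∈ frontier Ω)
    {w : E3} (hw : 0 < slope η (horiz (A x₀)) (A w)) : ∀ᶠ s : ℝ in 𝓝[>] 0, x₀ + s • w ∉ Ω := by
  filter_upwards [(h.tendsto_chartFun_div hx w).eventually_const_lt hw, h.eventually_mem_ball w,
    self_mem_nhdsWithin] with s h1 h2 (h3 : 0 < s)
  rw [h.mem_iff_chartFun h2]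
  intro hc
  have : s⁻¹ * chartFun A η (x₀ + s • w) < 0 := mul_neg_of_pos_of_neg (by positivity) hc
  linarith

end IsGraphChart

theorem areaFactor_pos (η : E2 → ℝ) (y : E2) : 0 < areaFactor η y :=
  one_pos.trans_le (one_le_areaFactor η y)

theorem IsOutwardNormal.norm_eq_one {Ω : Set E3} {x n : E3} (h : IsOutwardNormal Ω x n) :
    ‖n‖ = 1 := by
  obtain ⟨r, A, η, -, rfl⟩ := h
  exact norm_chartNormal A η x

theorem IsOutwardNormal.eventually_mem {Ω : Set E3} {x n w : E3} (h : IsOutwardNormal Ω x n)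
    (hx : x ∈ frontier Ω) (hw : inner ℝ n w < 0) : ∀ᶠ s : ℝ in 𝓝[>] 0, x + s • w ∈ Ω := by
  obtain ⟨r, A, η, hc, rfl⟩ := h
  refine hc.eventually_mem_of_slope_neg hx ?_
  have := inner_chartNormal A η x w
  rw [chartNormal] at this
  rw [this] at hw
  by_contra hcon
  push Not at hcon
  have := areaFactor_pos η (horiz (A x))
  exact absurd hw (not_lt.2 (by positivity))

theorem IsOutwardNormal.eventually_notMem {Ω : Set E3} {x n w : E3} (h : IsOutwardNormal Ω x n)
    (hx : x ∈ frontier Ω) (hw : 0 < inner ℝ n w) : ∀ᶠ s : ℝ in 𝓝[>] 0, x + s • w ∉ Ω := by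
  obtain ⟨r, A, η, hc, rfl⟩ := h
  refine hc.eventually_notMem_of_slope_pos hx ?_
  have := inner_chartNormal A η x w
  rw [chartNormal] at this
  rw [this] at hw
  exact pos_of_mul_pos_right hw (by have := areaFactor_pos η (horiz (A x)); positivity)

/-- Two different unit vectors n, n' satisfy n·w < 0 < n'·w for w = n' - n, so the half-line in
direction w would start both inside and outside Ω. Hence the vector chosen in `normal` is the one
given by any chart. -/
theorem IsOutwardNormal.unique {Ω : Set E3} {x n n' : E3} (hx : x ∈ frontier Ω)
    (h : IsOutwardNormal Ω x n) (h' : IsOutwardNormal Ω x n') : n = n' := by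
  by_contra hne
  have h1 : inner ℝ n n' < (1 : ℝ) :=
    lt_of_le_of_ne (by simpa [h.norm_eq_one, h'.norm_eq_one] using real_inner_le_norm n n')
      (fun he => hne ((inner_eq_one_iff_of_norm_eq_one h.norm_eq_one h'.norm_eq_one).1 he))
  have e1 : inner ℝ n (n' - n) < (0 : ℝ) := by
    rw [inner_sub_right, real_inner_self_eq_norm_sq, h.norm_eq_one]; linarith
  have e2 : (0 : ℝ) < inner ℝ n' (n' - n) := by
    rw [inner_sub_right, real_inner_self_eq_norm_sq, h'.norm_eq_one, real_inner_comm]; linarith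
  obtain ⟨s, hs1, hs2⟩ := ((h.eventually_mem hx e1).and (h'.eventually_notMem hx e2)).exists
  exact hs2 hs1

theorem normal_eq {Ω : Set E3} {x n : E3} (hx : x ∈ frontier Ω) (h : IsOutwardNormal Ω x n) :
    normal Ω x = n := by
  have hex : x ∈ frontier Ω ∧ ∃ n, IsOutwardNormal Ω x n := ⟨hx, n, h⟩
  rw [normal, dif_pos hex]
  exact IsOutwardNormal.unique hx hex.2.choose_spec h

theorem normal_of_notMem {Ω : Set E3} {x : E3} (hx : x ∉ frontier Ω) : normal Ω x = 0 := by
  rw [normal, dif_neg (fun h => hx h.1)]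

theorem HasC2Boundary.isOutwardNormal {Ω : Set E3} (hΩ : HasC2Boundary Ω) {x : E3}
    (hx : x ∈ frontier Ω) : IsOutwardNormal Ω x (normal Ω x) := by
  obtain ⟨r, A, η, hc⟩ := hΩ x hx
  have : IsOutwardNormal Ω x (A.symm (graphNormal η (horiz (A x)))) := ⟨r, A, η, hc, rfl⟩
  rwa [normal_eq hx this]

theorem IsGraphChart.normal_eq {Ω : Set E3} {x₀ x : E3} {r : ℝ} {A : E3 ≃ₗᵢ[ℝ] E3} {η : E2 → ℝ}
    (h : IsGraphChart Ω x₀ r A η) (hx : x ∈ frontier Ω) (hxr : x ∈ Metric.ball x₀ r) :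
    normal Ω x = chartNormal A η x := by
  obtain ⟨s, hs, hsub⟩ := Metric.isOpen_iff.1 Metric.isOpen_ball x hxr
  exact KineticTrace.normal_eq hx ⟨s, A, η, h.mono hs hsub, rfl⟩

theorem HasC2Boundary.norm_normal_le {Ω : Set E3} (hΩ : HasC2Boundary Ω) (x : E3) :
    ‖normal Ω x‖ ≤ 1 := by
  by_cases hx : x ∈ frontier Ω
  · exact (hΩ.isOutwardNormal hx).norm_eq_one.le
  · simp [normal_of_notMem hx]

theorem HasC2Boundary.abs_normalVel_le {Ω : Set E3} (hΩ : HasC2Boundary Ω) (p : E3 × E3) :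
    |normalVel Ω p| ≤ ‖p.2‖ := by
  refine (abs_real_inner_le_norm _ _).trans ?_
  exact mul_le_of_le_one_left (norm_nonneg _) (hΩ.norm_normal_le _)

theorem normalVel_neg (Ω : Set E3) (x v : E3) : normalVel Ω (x, -v) = -normalVel Ω (x, v) := by
  simp [normalVel]

end

noncomputable section

open scoped NNReal ENNReal

/-! ### The graph parametrization and the surface measure -/

/-- The inclusion `ℝ² → ℝ³` as the horizontal plane. -/
def embL : E2 →L[ℝ] E3 :=
  LinearMap.toContinuousLinearMap
    { toFun := fun y => !₂[y 0, y 1, 0]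
      map_add' := fun x y => by ext i; fin_cases i <;> simp
      map_smul' := fun c x => by ext i; fin_cases i <;> simp }

theorem embL_apply (y : E2) : embL y = !₂[y 0, y 1, 0] := rfl

/-- The point above `y` of the graph of `η`, in the coordinates given by `A`. -/
def chartParam (A : E3 ≃ₗᵢ[ℝ] E3) (η : E2 → ℝ) (y : E2) : E3 :=
  A.symm (embL y + η y • EuclideanSpace.single 2 1)

theorem horiz_chartParam (A : E3 ≃ₗᵢ[ℝ] E3) (η : E2 → ℝ) (y : E2) :
    horiz (A (chartParam A η y)) = y := by
  ext i; fin_cases i <;> simp [horiz, chartParam, embL_apply]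

theorem chartParam_of_chartFun_eq_zero {A : E3 ≃ₗᵢ[ℝ] E3} {η : E2 → ℝ} {x : E3}
    (hx : chartFun A η x = 0) : chartParam A η (horiz (A x)) = x := by
  rw [chartParam, LinearIsometryEquiv.symm_apply_eq]
  rw [chartFun, sub_eq_zero] at hx
  ext i; fin_cases i <;> simp [horiz, embL_apply, ← hx]

theorem chartFun_chartParam (A : E3 ≃ₗᵢ[ℝ] E3) (η : E2 → ℝ) (y : E2) :
    chartFun A η (chartParam A η y) = 0 := by
  rw [chartFun, horiz_chartParam]
  simp [chartParam, embL_apply]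

theorem contDiff_chartParam (A : E3 ≃ₗᵢ[ℝ] E3) {η : E2 → ℝ} (hη : ContDiff ℝ 2 η) :
    ContDiff ℝ 2 (chartParam A η) := by
  unfold chartParam
  exact A.symm.toContinuousLinearEquiv.contDiff.comp
    (embL.contDiff.add (hη.smul contDiff_const))

theorem lipschitzWith_horiz_comp (A : E3 ≃ₗᵢ[ℝ] E3) : LipschitzWith 1 (fun x => horiz (A x)) := by
  refine LipschitzWith.of_dist_le_mul fun x y => ?_
  rw [dist_eq_norm, dist_eq_norm, NNReal.coe_one, one_mul, ← horizL_apply, ← horizL_apply,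
    ← map_sub, ← map_sub, horizL_apply]
  exact (norm_horiz_le _).trans (A.norm_map _).le

/-- The set of parameters of the points of the graph in a ball. -/
def paramDomain (x₀ : E3) (r : ℝ) (A : E3 ≃ₗᵢ[ℝ] E3) (η : E2 → ℝ) : Set E2 :=
  chartParam A η ⁻¹' Metric.ball x₀ r

theorem paramDomain_subset (x₀ : E3) (r : ℝ) (A : E3 ≃ₗᵢ[ℝ] E3) (η : E2 → ℝ) :
    paramDomain x₀ r A η ⊆ Metric.ball (horiz (A x₀)) r := by
  intro y hy
  have := (lipschitzWith_horiz_comp A).dist_le_mul (chartParam A η y) x₀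
  rw [horiz_chartParam, NNReal.coe_one, one_mul] at this
  exact this.trans_lt hy

theorem measurableSet_paramDomain (x₀ : E3) (r : ℝ) (A : E3 ≃ₗᵢ[ℝ] E3) {η : E2 → ℝ}
    (hη : ContDiff ℝ 2 η) : MeasurableSet (paramDomain x₀ r A η) :=
  (contDiff_chartParam A hη).continuous.measurable Metric.isOpen_ball.measurableSet

theorem euclideanHausdorffMeasure_image_le {X Y : Type*} [EMetricSpace X] [EMetricSpace Y]
    [MeasurableSpace X] [BorelSpace X] [MeasurableSpace Y] [BorelSpace Y] {K : ℝ≥0} {f : X → Y}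
    {s : Set X} (h : LipschitzOnWith K f s) :
    (μHE[2] : Measure Y) (f '' s) ≤ (K : ℝ≥0∞) ^ 2 * (μHE[2] : Measure X) s := by
  rw [Measure.euclideanHausdorffMeasure_def, Measure.euclideanHausdorffMeasure_def,
    Measure.smul_apply, Measure.smul_apply, mul_smul_comm]
  gcongr
  have := h.hausdorffMeasure_image_le (d := (2 : ℕ)) (by norm_num)
  simpa using this

variable {Ω : Set E3} {x₀ : E3} {r : ℝ} {A : E3 ≃ₗᵢ[ℝ] E3} {η : E2 → ℝ}

theorem IsGraphChart.exists_lipschitzOnWith (h : IsGraphChart Ω x₀ r A η) :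
    ∃ L : ℝ≥0, LipschitzOnWith L (chartParam A η) (paramDomain x₀ r A η) := by
  obtain ⟨L, hL⟩ := ((contDiff_chartParam A h.contDiff).of_le (by norm_num : (1 : WithTop ℕ∞) ≤ 2)
    |>.contDiffOn (s := Metric.closedBall (horiz (A x₀)) r)).exists_lipschitzOnWith
      (by norm_num) (convex_closedBall _ _) (isCompact_closedBall _ _)
  exact ⟨L, hL.mono ((paramDomain_subset _ _ _ _).trans Metric.ball_subset_closedBall)⟩

theorem IsGraphChart.image_chartParam (h : IsGraphChart Ω x₀ r A η) (E : Set E3) :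
    chartParam A η '' (chartParam A η ⁻¹' E ∩ paramDomain x₀ r A η) =
      E ∩ (frontier Ω ∩ Metric.ball x₀ r) := by
  ext x
  constructor
  · rintro ⟨y, ⟨hy, hy'⟩, rfl⟩
    exact ⟨hy, (h.mem_frontier_iff_chartFun hy').2 (chartFun_chartParam A η y), hy'⟩
  · rintro ⟨hE, hf, hb⟩
    have := chartParam_of_chartFun_eq_zero ((h.mem_frontier_iff_chartFun hb).1 hf)
    exact ⟨horiz (A x), ⟨by rwa [mem_preimage, this], by rwa [paramDomain, mem_preimage, this]⟩,
      this⟩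

/-- The parametrization is Lipschitz on the bounded parameter domain, and Lipschitz maps distort
two-dimensional Hausdorff measure by at most the square of the constant. The opposite bound below
holds because the projection to the plane is 1-Lipschitz. -/
theorem IsGraphChart.surfaceMeasure_le (h : IsGraphChart Ω x₀ r A η) {L : ℝ≥0}
    (hL : LipschitzOnWith L (chartParam A η) (paramDomain x₀ r A η)) :
    (surfaceMeasure Ω).restrict (Metric.ball x₀ r) ≤
      (L : ℝ≥0∞) ^ 2 • (volume.restrict (paramDomain x₀ r A η)).map (chartParam A η) := by
  refine Measure.le_iff.2 fun E hE => ?_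
  have hm := (contDiff_chartParam A h.contDiff).continuous.measurable
  rw [surfaceMeasure, Measure.restrict_apply hE, Measure.restrict_apply
    (hE.inter Metric.isOpen_ball.measurableSet), Measure.smul_apply, Measure.map_apply hm hE,
    Measure.restrict_apply (hm hE), inter_assoc, inter_comm (Metric.ball _ _),
    ← h.image_chartParam, smul_eq_mul, ← EuclideanSpace.euclideanHausdorffMeasure_eq_volume 2]
  exact euclideanHausdorffMeasure_image_le (hL.mono inter_subset_right)

theorem IsGraphChart.le_surfaceMeasure (h : IsGraphChart Ω x₀ r A η) :
    (volume.restrict (paramDomain x₀ r A η)).map (chartParam A η) ≤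
      (surfaceMeasure Ω).restrict (Metric.ball x₀ r) := by
  refine Measure.le_iff.2 fun E hE => ?_
  have hm := (contDiff_chartParam A h.contDiff).continuous.measurable
  rw [surfaceMeasure, Measure.restrict_apply hE, Measure.restrict_apply
    (hE.inter Metric.isOpen_ball.measurableSet), Measure.map_apply hm hE,
    Measure.restrict_apply (hm hE), ← EuclideanSpace.euclideanHausdorffMeasure_eq_volume 2]
  have e : chartParam A η ⁻¹' E ∩ paramDomain x₀ r A η =
      (fun x => horiz (A x)) '' (E ∩ (frontier Ω ∩ Metric.ball x₀ r)) := by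
    rw [← h.image_chartParam, image_image]
    simp [horiz_chartParam]
  rw [e]
  refine (euclideanHausdorffMeasure_image_le (lipschitzWith_horiz_comp A).lipschitzOnWith).trans ?_
  rw [ENNReal.coe_one, one_pow, one_mul, inter_assoc, inter_comm (Metric.ball _ _)]

/-! ### The change of variables `(x, s) ↦ x - s v` in a chart -/

/-- The flow-out `z ↦ Γ(z₀, z₁) - z₂ v` of the graph along `-v`. -/
def chartFlow (A : E3 ≃ₗᵢ[ℝ] E3) (η : E2 → ℝ) (v : E3) (z : E3) : E3 :=
  chartParam A η (horiz z) - z 2 • v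

/-- `chartFlow` before the isometry is applied. -/
def flatFlow (η : E2 → ℝ) (w : E3) (z : E3) : E3 :=
  embL (horizL z) + η (horizL z) • EuclideanSpace.single 2 1 - z 2 • w

/-- The derivative of `flatFlow`. -/
def flatFlowDeriv (η : E2 → ℝ) (w : E3) (z : E3) : E3 →L[ℝ] E3 :=
  embL.comp horizL + ((fderiv ℝ η (horizL z)).comp horizL).smulRight (EuclideanSpace.single 2 1) -
    (EuclideanSpace.proj (2 : Fin 3) : E3 →L[ℝ] ℝ).smulRight w

theorem chartFlow_eq (A : E3 ≃ₗᵢ[ℝ] E3) (η : E2 → ℝ) (v z : E3) :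
    chartFlow A η v z = A.symm (flatFlow η (A v) z) := by
  rw [chartFlow, chartParam, flatFlow, map_sub A.symm, map_smul A.symm, A.symm_apply_apply]
  rfl

theorem hasFDerivAt_flatFlow (hη : ContDiff ℝ 2 η) (w z : E3) :
    HasFDerivAt (flatFlow η w) (flatFlowDeriv η w z) z := by
  unfold flatFlow flatFlowDeriv
  have hd : DifferentiableAt ℝ η (horizL z) :=
    (hη.differentiable (by norm_num)).differentiableAt
  have h1 := (hd.hasFDerivAt.comp z horizL.hasFDerivAt)
  refine HasFDerivAt.sub (HasFDerivAt.add ?_ ?_) ?_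
  · exact (embL.comp horizL).hasFDerivAt
  · exact h1.smul_const _
  · exact (EuclideanSpace.proj (2 : Fin 3) : E3 →L[ℝ] ℝ).hasFDerivAt.smul_const w

/-- The columns of the derivative are e₀ + ∂₀η e₂, e₁ + ∂₁η e₂ and -w. The determinant is n·v times
the area factor, which is the source of the weight |n·v| in dγ. -/
theorem det_flatFlowDeriv (η : E2 → ℝ) (w z : E3) :
    (flatFlowDeriv η w z).det = slope η (horiz z) w := by
  rw [ContinuousLinearMap.det, ← LinearMap.det_toMatrix (EuclideanSpace.basisFun (Fin 3) ℝ).toBasis,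
    Matrix.det_fin_three]
  have e0 : horiz (EuclideanSpace.single 0 1) = EuclideanSpace.single 0 1 := by
    ext i; fin_cases i <;> simp [horiz]
  have e1 : horiz (EuclideanSpace.single 1 1) = EuclideanSpace.single 1 1 := by
    ext i; fin_cases i <;> simp [horiz]
  have e2 : horiz (EuclideanSpace.single 2 1) = 0 := by
    ext i; fin_cases i <;> simp [horiz]
  simp only [LinearMap.toMatrix_apply, slope, fderiv_horiz, partialDeriv]
  simp [flatFlowDeriv, horizL_apply, embL_apply, e0, e1, e2]
  ring

theorem measurePreserving_isometry (A : E3 ≃ₗᵢ[ℝ] E3) : MeasurePreserving A volume volume :=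
  A.measurePreserving

theorem lintegral_image_chartFlow (A : E3 ≃ₗᵢ[ℝ] E3) (hη : ContDiff ℝ 2 η) (v : E3) {D : Set E3}
    (hD : MeasurableSet D) (hinj : InjOn (chartFlow A η v) D) (F : E3 → ℝ≥0∞) :
    ∫⁻ x in chartFlow A η v '' D, F x =
      ∫⁻ z in D, ENNReal.ofReal |slope η (horiz z) (A v)| * F (chartFlow A η v z) := by
  have hfun : chartFlow A η v = A.symm ∘ flatFlow η (A v) := funext (chartFlow_eq A η v)
  have hinj' : InjOn (flatFlow η (A v)) D := by
    rw [hfun] at hinj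
    exact hinj.of_comp
  rw [hfun, image_comp, ← (measurePreserving_isometry A.symm).setLIntegral_comp_emb
    A.symm.toHomeomorph.measurableEmbedding,
    lintegral_image_eq_lintegral_abs_det_fderiv_mul volume hD
      (fun z _ => (hasFDerivAt_flatFlow hη (A v) z).hasFDerivWithinAt) hinj']
  simp only [det_flatFlowDeriv, Function.comp_apply]

theorem lintegral_horiz_last {f : E2 → ℝ → ℝ≥0∞} (hf : Measurable (Function.uncurry f)) :
    ∫⁻ z : E3, f (horiz z) (z 2) = ∫⁻ y : E2, ∫⁻ s : ℝ, f y s := by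
  have h1 := (EuclideanSpace.volume_preserving_symm_measurableEquiv_toLp (Fin 3))
  have h2 := volume_preserving_piFinSuccAbove (fun _ : Fin 3 => ℝ) 2
  have h3 := (EuclideanSpace.volume_preserving_symm_measurableEquiv_toLp (Fin 2)).symm
  have h4 : MeasurePreserving (Prod.map (id : ℝ → ℝ) (MeasurableEquiv.toLp 2 (Fin 2 → ℝ)))
    (volume.prod volume) (volume.prod volume) := (MeasurePreserving.id _).prod h3
  have h5 := Measure.measurePreserving_swap (μ := (volume : Measure ℝ)) (ν := (volume : Measure E2))
  have h := h5.comp (h4.comp (h2.comp h1))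
  refine Eq.trans ?_ (lintegral_prod (μ := volume) (ν := volume) _ hf.aemeasurable)
  rw [← h.lintegral_comp hf]
  refine lintegral_congr fun z => ?_
  have : horiz z = (Prod.swap (Prod.map id (MeasurableEquiv.toLp 2 (Fin 2 → ℝ))
      (MeasurableEquiv.piFinSuccAbove (fun _ : Fin 3 => ℝ) 2
        ((MeasurableEquiv.toLp 2 (Fin 3 → ℝ)).symm z)))).1 := by
    ext i; fin_cases i <;> rfl
  rw [this]
  rfl

end

noncomputable section

open scoped NNReal ENNReal

/-! ### The backward exit time -/

/-- The backward exit time from `Ω` of the trajectory that is at `x` with velocity `v`. -/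
def backTime (Ω : Set E3) (x v : E3) : ℝ := sInf {s : ℝ | 0 < s ∧ x - s • v ∉ Ω}

variable {Ω : Set E3}

theorem backTime_nonneg (Ω : Set E3) (x v : E3) : 0 ≤ backTime Ω x v :=
  Real.sInf_nonneg fun _ hs => hs.1.le

theorem sub_smul_mem_of_lt_backTime {x v : E3} {s : ℝ} (hs : 0 < s) (h : s < backTime Ω x v) :
    x - s • v ∈ Ω := by
  by_contra hc
  exact notMem_of_lt_csInf h ⟨0, fun _ ht => ht.1.le⟩ ⟨hs, hc⟩

/-- Boundedness makes the set in `backTime` nonempty for v ≠ 0; for an empty set the infimum takes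
the default value 0. -/
theorem exists_sub_smul_notMem (hb : Bornology.IsBounded Ω) (x : E3) {v : E3} (hv : v ≠ 0) :
    ∃ s : ℝ, 0 < s ∧ x - s • v ∉ Ω := by
  obtain ⟨R, hR⟩ := hb.subset_closedBall x
  have hv' : 0 < ‖v‖ := norm_pos_iff.2 hv
  refine ⟨(|R| + 1) / ‖v‖, by positivity, fun hmem => ?_⟩
  have := hR hmem
  rw [Metric.mem_closedBall, dist_eq_norm, sub_sub_cancel_left, norm_neg, norm_smul, Real.norm_eq_abs,
    abs_of_pos (by positivity), div_mul_cancel₀ _ hv'.ne'] at this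
  linarith [le_abs_self R]

theorem isOpen_setOf_sub_smul_mem (ho : IsOpen Ω) :
    IsOpen {q : (E3 × E3) × ℝ | q.1.1 - q.2 • q.1.2 ∈ Ω} :=
  ho.preimage (by fun_prop)

/-- The infimum is attained because the complement of Ω is closed: if the exit point lay in Ω, so
would all points shortly after it, and the infimum would be larger. -/
theorem sub_backTime_notMem (ho : IsOpen Ω) (hb : Bornology.IsBounded Ω) {x v : E3}
    (hv : v ≠ 0) : x - backTime Ω x v • v ∉ Ω := by
  intro hmem
  have hopen : IsOpen {s : ℝ | x - s • v ∈ Ω} := ho.preimage (by fun_prop)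
  obtain ⟨ε, hε, hsub⟩ := Metric.isOpen_iff.1 hopen _ hmem
  obtain ⟨s, ⟨hs0, hs⟩, hlt⟩ := exists_lt_of_csInf_lt (exists_sub_smul_notMem hb x hv)
    (show sInf {s : ℝ | 0 < s ∧ x - s • v ∉ Ω} < backTime Ω x v + ε from lt_add_of_pos_right _ hε)
  have hle : backTime Ω x v ≤ s := csInf_le ⟨0, fun _ ht => ht.1.le⟩ ⟨hs0, hs⟩
  exact hs (hsub (by rw [Metric.mem_ball, Real.dist_eq, abs_of_nonneg (by linarith)]; linarith))

theorem backTime_eq {x v : E3} {T : ℝ} (hT : 0 < T) (h : ∀ s, 0 < s → s < T → x - s • v ∈ Ω)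
    (hT' : x - T • v ∉ Ω) : backTime Ω x v = T := by
  refine le_antisymm (csInf_le ⟨0, fun _ ht => ht.1.le⟩ ⟨hT, hT'⟩) ?_
  refine le_csInf ⟨T, hT, hT'⟩ fun s hs => ?_
  by_contra hc
  exact hs.2 (h s hs.1 (not_le.1 hc))

theorem backTime_pos_of_eventually (hb : Bornology.IsBounded Ω) {x v : E3} (hv : v ≠ 0)
    (h : ∀ᶠ s : ℝ in 𝓝[>] 0, x - s • v ∈ Ω) : 0 < backTime Ω x v := by
  obtain ⟨ε, hε, hsub⟩ := mem_nhdsGT_iff_exists_Ioo_subset.1 h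
  refine lt_of_lt_of_le hε (le_csInf (exists_sub_smul_notMem hb x hv) fun s hs => ?_)
  by_contra hc
  exact hs.2 (hsub ⟨hs.1, not_le.1 hc⟩)

theorem eventually_of_backTime_pos {x v : E3} (h : 0 < backTime Ω x v) :
    ∀ᶠ s : ℝ in 𝓝[>] 0, x - s • v ∈ Ω := by
  filter_upwards [Ioo_mem_nhdsGT h] with s hs using sub_smul_mem_of_lt_backTime hs.1 hs.2

theorem backTime_pos_of_mem (ho : IsOpen Ω) (hb : Bornology.IsBounded Ω) {x v : E3} (hv : v ≠ 0)
    (hx : x ∈ Ω) : 0 < backTime Ω x v := by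
  refine backTime_pos_of_eventually hb hv (nhdsWithin_le_nhds ?_)
  have hopen : IsOpen {s : ℝ | x - s • v ∈ Ω} := ho.preimage (by fun_prop)
  exact hopen.mem_nhds (by simpa using hx)

theorem sub_backTime_mem_frontier (ho : IsOpen Ω) (hb : Bornology.IsBounded Ω) {x v : E3}
    (hv : v ≠ 0) (h : 0 < backTime Ω x v) : x - backTime Ω x v • v ∈ frontier Ω := by
  rw [ho.frontier_eq]
  refine ⟨?_, sub_backTime_notMem ho hb hv⟩
  have hc : Tendsto (fun s : ℝ => x - s • v) (𝓝[<] (backTime Ω x v))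
      (𝓝 (x - backTime Ω x v • v)) := by
    have : Continuous fun s : ℝ => x - s • v := by fun_prop
    exact (this.tendsto _).mono_left nhdsWithin_le_nhds
  refine mem_closure_of_tendsto hc ?_
  filter_upwards [Ioo_mem_nhdsLT h] with s hs using sub_smul_mem_of_lt_backTime hs.1 hs.2

theorem notMem_of_mem_frontier (ho : IsOpen Ω) {x : E3} (hx : x ∈ frontier Ω) : x ∉ Ω := by
  rw [ho.frontier_eq] at hx
  exact hx.2

theorem backTime_sub_smul (ho : IsOpen Ω) (hb : Bornology.IsBounded Ω) {x v : E3} (hv : v ≠ 0)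
    {s : ℝ} (hs : 0 < s) (h : s < backTime Ω x v) :
    backTime Ω (x - s • v) v = backTime Ω x v - s := by
  refine backTime_eq (by linarith) (fun r hr hr' => ?_) ?_
  · rw [sub_sub, ← add_smul]
    exact sub_smul_mem_of_lt_backTime (by linarith) (by linarith)
  · rw [sub_sub, ← add_smul, add_sub_cancel]
    exact sub_backTime_notMem ho hb hv

theorem backTime_sub_smul_neg (ho : IsOpen Ω) {x v : E3} (hx : x ∈ frontier Ω)
    {s : ℝ} (hs : 0 < s) (h : s < backTime Ω x v) : backTime Ω (x - s • v) (-v) = s := by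
  refine backTime_eq hs (fun r hr hr' => ?_) ?_
  · have : x - s • v - r • -v = x - (s - r) • v := by module
    rw [this]
    exact sub_smul_mem_of_lt_backTime (by linarith) (by linarith)
  · have : x - s • v - s • -v = x := by module
    rw [this]
    exact notMem_of_mem_frontier ho hx

theorem backTime_add_smul (ho : IsOpen Ω) (hb : Bornology.IsBounded Ω) {z v : E3} (hv : v ≠ 0)
    (hz : z ∈ Ω) : backTime Ω (z + backTime Ω z (-v) • v) v = backTime Ω z (-v) + backTime Ω z v := by
  have h1 := backTime_pos_of_mem ho hb hv hz
  have h2 := backTime_pos_of_mem ho hb (neg_ne_zero.2 hv) hz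
  refine backTime_eq (by linarith) (fun r hr hr' => ?_) ?_
  · rcases lt_trichotomy r (backTime Ω z (-v)) with hlt | heq | hgt
    · have := sub_smul_mem_of_lt_backTime (Ω := Ω) (x := z) (v := -v)
        (s := backTime Ω z (-v) - r) (by linarith) (by linarith)
      convert! this using 1
      module
    · rw [heq, add_sub_cancel_right]; exact hz
    · have := sub_smul_mem_of_lt_backTime (Ω := Ω) (x := z) (v := v)
        (s := r - backTime Ω z (-v)) (by linarith) (by linarith)
      convert! this using 1
      module
  · have := sub_backTime_notMem (x := z) ho hb hv
    convert! this using 2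
    module

/-- Leaving Ω within a compact time interval is a closed condition on (x, v), by compactness and
openness of Ω. The sublevel sets of the exit time are countable unions of such sets, up to the
trajectories that never leave. -/
theorem measurable_backTime (ho : IsOpen Ω) :
    Measurable fun p : E3 × E3 => backTime Ω p.1 p.2 := by
  have hcl : ∀ a b : ℝ, MeasurableSet {p : E3 × E3 | ∃ s ∈ Icc a b, p.1 - s • p.2 ∉ Ω} := by
    intro a b
    have : IsOpen {p : E3 × E3 | ∀ s ∈ Icc a b, p.1 - s • p.2 ∈ Ω} := by
      rw [isOpen_iff_eventually]
      intro p hp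
      exact isCompact_Icc.eventually_forall_of_forall_eventually fun s hs =>
        (isOpen_setOf_sub_smul_mem ho).mem_nhds (x := (p, s)) (hp s hs)
    convert! this.measurableSet.compl using 1
    ext p
    simp [and_assoc]
  have hoo : ∀ c : ℝ, MeasurableSet {p : E3 × E3 | ∃ s : ℝ, 0 < s ∧ s < c ∧ p.1 - s • p.2 ∉ Ω} := by
    intro c
    have : {p : E3 × E3 | ∃ s : ℝ, 0 < s ∧ s < c ∧ p.1 - s • p.2 ∉ Ω} =
        ⋃ n : ℕ, {p : E3 × E3 | ∃ s ∈ Icc (1 / ((n : ℝ) + 1)) (c - 1 / ((n : ℝ) + 1)),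
          p.1 - s • p.2 ∉ Ω} := by
      ext p
      simp only [mem_ofPred_eq, mem_iUnion]
      constructor
      · rintro ⟨s, h0, hc, hs⟩
        obtain ⟨n, hn⟩ := exists_nat_one_div_lt (lt_min h0 (sub_pos.2 hc))
        have h1 := hn.trans_le (min_le_left _ _)
        have h2 := hn.trans_le (min_le_right _ _)
        exact ⟨n, s, ⟨h1.le, by linarith⟩, hs⟩
      · rintro ⟨n, s, hs, hs'⟩
        have : 0 < 1 / ((n : ℝ) + 1) := by positivity
        exact ⟨s, by linarith [hs.1], by linarith [hs.2], hs'⟩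
    rw [this]
    exact MeasurableSet.iUnion fun n => hcl _ _
  have hex : MeasurableSet {p : E3 × E3 | ∃ s : ℝ, 0 < s ∧ p.1 - s • p.2 ∉ Ω} := by
    have : {p : E3 × E3 | ∃ s : ℝ, 0 < s ∧ p.1 - s • p.2 ∉ Ω} =
        ⋃ n : ℕ, {p : E3 × E3 | ∃ s : ℝ, 0 < s ∧ s < (n : ℝ) ∧ p.1 - s • p.2 ∉ Ω} := by
      ext p
      simp only [mem_ofPred_eq, mem_iUnion]
      constructor
      · rintro ⟨s, h0, hs⟩
        obtain ⟨n, hn⟩ := exists_nat_gt s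
        exact ⟨n, s, h0, hn, hs⟩
      · rintro ⟨n, s, h0, -, hs⟩
        exact ⟨s, h0, hs⟩
    rw [this]
    exact MeasurableSet.iUnion fun n => hoo n
  refine measurable_of_Iio fun c => ?_
  rcases le_or_gt c 0 with hc | hc
  · convert! MeasurableSet.empty using 1
    ext p
    simp only [mem_preimage, mem_Iio, mem_empty_iff_false, iff_false, not_lt]
    exact hc.trans (backTime_nonneg Ω _ _)
  -- Trajectories that never leave count as well: their exit time has the default value 0 < c.
  · convert! (hoo c).union hex.compl using 1
    ext p
    simp only [mem_preimage, mem_Iio, mem_union, mem_ofPred_eq, mem_compl_iff]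
    constructor
    · intro hlt
      by_contra hcon
      push Not at hcon
      obtain ⟨h1, s₀, h2⟩ := hcon
      have hne : {s : ℝ | 0 < s ∧ p.1 - s • p.2 ∉ Ω}.Nonempty := ⟨s₀, h2⟩
      obtain ⟨s, hs, hsc⟩ := exists_lt_of_csInf_lt hne hlt
      exact hs.2 (h1 s hs.1 hsc)
    · rintro (⟨s, h0, hsc, hs⟩ | hcon)
      · have hle : backTime Ω p.1 p.2 ≤ s := csInf_le ⟨0, fun _ ht => ht.1.le⟩ ⟨h0, hs⟩
        exact hle.trans_lt hsc
      · have : {s : ℝ | 0 < s ∧ p.1 - s • p.2 ∉ Ω} = ∅ := by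
          refine eq_empty_of_forall_notMem fun s hs => hcon ⟨s, hs⟩
        rwa [backTime, this, Real.sInf_empty]

attribute [irreducible] backTime

theorem measurable_backTime_comp (ho : IsOpen Ω) {α : Type*} [MeasurableSpace α] {f g : α → E3}
    (hf : Measurable f) (hg : Measurable g) : Measurable fun a => backTime Ω (f a) (g a) :=
  (measurable_backTime ho).comp (hf.prodMk hg)

end

noncomputable section

open scoped NNReal ENNReal

/-! ### Change of variables between the boundary and the interior -/

variable {Ω : Set E3} {x₀ : E3} {r : ℝ} {A : E3 ≃ₗᵢ[ℝ] E3} {η : E2 → ℝ}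

theorem surfaceMeasure_ae_mem (Ω : Set E3) : ∀ᵐ x ∂(surfaceMeasure Ω), x ∈ frontier Ω :=
  ae_restrict_mem isClosed_frontier.measurableSet

theorem Measurable.uncurry_comp {α β γ δ : Type*} [MeasurableSpace α] [MeasurableSpace β]
    [MeasurableSpace γ] [MeasurableSpace δ] {f : α → β → γ} (hf : Measurable (Function.uncurry f))
    {g : δ → α} {h : δ → β} (hg : Measurable g) (hh : Measurable h) :
    Measurable fun d => f (g d) (h d) :=
  hf.comp (hg.prodMk hh)

/-- The integrand on `E3 × ℝ` of the flow-out change of variables, in a chart. -/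
def flowIntegrand (Ω : Set E3) (A : E3 ≃ₗᵢ[ℝ] E3) (η : E2 → ℝ) (v : E3) (F : E3 → ℝ≥0∞)
    (x : E3) (s : ℝ) : ℝ≥0∞ :=
  ENNReal.ofReal |inner ℝ (chartNormal A η x) v| *
    (Ioo 0 (backTime Ω x v)).indicator (fun s => F (x - s • v)) s

theorem measurable_flowIntegrand (ho : IsOpen Ω) (hη : ContDiff ℝ 2 η) (v : E3)
    {F : E3 → ℝ≥0∞} (hF : Measurable F) :
    Measurable (Function.uncurry (flowIntegrand Ω A η v F)) := by
  have h1 : Measurable fun q : E3 × ℝ => ENNReal.ofReal |inner ℝ (chartNormal A η q.1) v| := by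
    have := continuous_chartNormal A hη
    exact ENNReal.measurable_ofReal.comp (by fun_prop : Continuous fun q : E3 × ℝ =>
      |inner ℝ (chartNormal A η q.1) v|).measurable
  have hb : Measurable fun q : E3 × ℝ => backTime Ω q.1 v :=
    measurable_backTime_comp ho measurable_fst measurable_const
  have hS : MeasurableSet {q : E3 × ℝ | 0 < q.2 ∧ q.2 < backTime Ω q.1 v} := by
    rw [ofPred_and]
    exact (measurableSet_lt measurable_const measurable_snd).inter
      (measurableSet_lt measurable_snd hb)
  have h2 : Measurable fun q : E3 × ℝ => F (q.1 - q.2 • v) :=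
    hF.comp (by fun_prop)
  exact h1.mul (h2.indicator hS)

/-- The parameters of the chart flow at points that have not left the domain. -/
def flowDomain (Ω : Set E3) (x₀ : E3) (r : ℝ) (A : E3 ≃ₗᵢ[ℝ] E3) (η : E2 → ℝ) (v : E3) : Set E3 :=
  {z | horiz z ∈ paramDomain x₀ r A η ∧ 0 < z 2 ∧
    z 2 < backTime Ω (chartParam A η (horiz z)) v}

theorem measurableSet_flowDomain (ho : IsOpen Ω) (hη : ContDiff ℝ 2 η) (v : E3) :
    MeasurableSet (flowDomain Ω x₀ r A η v) := by
  have h2 : Measurable fun z : E3 => z 2 := by fun_prop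
  have hb : Measurable fun z : E3 => backTime Ω (chartParam A η (horiz z)) v :=
    measurable_backTime_comp ho
      ((contDiff_chartParam A hη).continuous.comp continuous_horiz).measurable measurable_const
  rw [flowDomain, ofPred_and, ofPred_and]
  exact (continuous_horiz.measurable (measurableSet_paramDomain x₀ r A hη)).inter
    ((measurableSet_lt measurable_const h2).inter (measurableSet_lt h2 hb))

/-- Fubini in the parameters: the first two coordinates of z are the boundary parameter and the
third is the flight time, so that the change of variables in ℝ³ applies. -/
theorem lintegral_flowIntegrand (ho : IsOpen Ω) (hη : ContDiff ℝ 2 η) (v : E3)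
    {F : E3 → ℝ≥0∞} (hF : Measurable F) :
    ∫⁻ x, (∫⁻ s, flowIntegrand Ω A η v F x s)
        ∂((volume.restrict (paramDomain x₀ r A η)).map (chartParam A η)) =
      ∫⁻ z in flowDomain Ω x₀ r A η v,
        ENNReal.ofReal |inner ℝ (chartNormal A η (chartParam A η (horiz z))) v| *
          F (chartFlow A η v z) := by
  have hm := (contDiff_chartParam A hη).continuous.measurable
  have hg := measurable_flowIntegrand (A := A) ho hη v hF
  rw [lintegral_map hg.lintegral_prod_right hm,
    ← lintegral_indicator (measurableSet_paramDomain x₀ r A hη),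
    ← lintegral_indicator (measurableSet_flowDomain ho hη v)]
  have hU := measurableSet_paramDomain x₀ r A hη
  have hf : Measurable (Function.uncurry fun (y : E2) (s : ℝ) =>
      (paramDomain x₀ r A η).indicator
        (fun y => flowIntegrand Ω A η v F (chartParam A η y) s) y) := by
    have h1 : Measurable fun q : E2 × ℝ => flowIntegrand Ω A η v F (chartParam A η q.1) q.2 :=
      Measurable.uncurry_comp hg (hm.comp measurable_fst) measurable_snd
    exact h1.indicator (measurable_fst hU)
  have := lintegral_horiz_last hf
  refine Eq.trans ?_ (this.symm.trans ?_)
  · refine lintegral_congr fun y => ?_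
    by_cases hy : y ∈ paramDomain x₀ r A η <;> simp [hy]
  · refine lintegral_congr fun z => ?_
    by_cases hy : horiz z ∈ paramDomain x₀ r A η
    · rw [indicator_of_mem hy, flowIntegrand]
      by_cases hz : 0 < z 2 ∧ z 2 < backTime Ω (chartParam A η (horiz z)) v
      · rw [indicator_of_mem (show z ∈ flowDomain Ω x₀ r A η v from ⟨hy, hz⟩),
          indicator_of_mem (show z 2 ∈ Ioo _ _ from hz)]
        rfl
      · rw [indicator_of_notMem (show z ∉ flowDomain Ω x₀ r A η v from fun h => hz h.2),
          indicator_of_notMem (show z 2 ∉ Ioo _ _ from hz), mul_zero]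
    · rw [indicator_of_notMem hy,
        indicator_of_notMem (show z ∉ flowDomain Ω x₀ r A η v from fun h => hy h.1)]

/-- If two trajectories with the same velocity met inside, the one with the longer flight would have
passed through the starting point of the other, which is on the boundary, while still in the open
set Ω. -/
theorem IsGraphChart.injOn_chartFlow (h : IsGraphChart Ω x₀ r A η) (ho : IsOpen Ω) (v : E3) :
    InjOn (chartFlow A η v) (flowDomain Ω x₀ r A η v) := by
  have key : ∀ z ∈ flowDomain Ω x₀ r A η v, ∀ z' ∈ flowDomain Ω x₀ r A η v,
      chartFlow A η v z = chartFlow A η v z' → z 2 ≤ z' 2 := by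
    intro z hz z' hz' he
    by_contra hlt
    push Not at hlt
    have hf : chartParam A η (horiz z') ∈ frontier Ω :=
      (h.mem_frontier_iff_chartFun hz'.1).2 (chartFun_chartParam A η _)
    refine notMem_of_mem_frontier ho hf ?_
    have e : chartParam A η (horiz z') = chartParam A η (horiz z) - (z 2 - z' 2) • v := by
      simp only [chartFlow] at he
      rw [sub_smul, ← sub_add, he, sub_add_cancel]
    rw [e]
    exact sub_smul_mem_of_lt_backTime (by linarith) (by linarith [hz.2.2, hz'.2.1])
  intro z hz z' hz' he
  have h2 : z 2 = z' 2 := le_antisymm (key z hz z' hz' he) (key z' hz' z hz he.symm)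
  have hp : chartParam A η (horiz z) = chartParam A η (horiz z') := by
    simp only [chartFlow, h2] at he
    exact sub_left_injective he
  have hh : horiz z = horiz z' := by
    rw [← horiz_chartParam A η (horiz z), hp, horiz_chartParam]
  ext i
  fin_cases i
  · simpa [horiz] using congrArg (fun y : E2 => y 0) hh
  · simpa [horiz] using congrArg (fun y : E2 => y 1) hh
  · exact h2

theorem abs_inner_chartNormal_chartParam (A : E3 ≃ₗᵢ[ℝ] E3) (η : E2 → ℝ) (y : E2) (v : E3) :
    |inner ℝ (chartNormal A η (chartParam A η y)) v| =
      (areaFactor η y)⁻¹ * |slope η y (A v)| := by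
  rw [inner_chartNormal, horiz_chartParam, abs_mul,
    abs_of_pos (inv_pos.2 (areaFactor_pos η y))]

theorem IsGraphChart.lintegral_surface_eq (h : IsGraphChart Ω x₀ r A η) (v : E3)
    (F : E3 → ℝ≥0∞) :
    ∫⁻ x in Metric.ball x₀ r, ENNReal.ofReal |normalVel Ω (x, v)| *
        (∫⁻ s in Ioo 0 (backTime Ω x v), F (x - s • v)) ∂(surfaceMeasure Ω) =
      ∫⁻ x in Metric.ball x₀ r, (∫⁻ s, flowIntegrand Ω A η v F x s) ∂(surfaceMeasure Ω) := by
  refine lintegral_congr_ae ?_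
  filter_upwards [ae_restrict_of_ae (surfaceMeasure_ae_mem Ω),
    ae_restrict_mem Metric.isOpen_ball.measurableSet] with x hx hxb
  rw [normalVel, h.normal_eq hx hxb, ← lintegral_indicator measurableSet_Ioo,
    ← lintegral_const_mul' _ _ ENNReal.ofReal_ne_top]
  rfl

/-- The Jacobian is |n·v| times an area factor ≥ 1, the flow-out is injective and it stays in Ω; L²
is the price of replacing the surface measure by the parameter measure. The converse bound below
uses instead an upper bound a of the area factor. -/
theorem IsGraphChart.lintegral_flow_le (h : IsGraphChart Ω x₀ r A η) (ho : IsOpen Ω) {L : ℝ≥0}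
    (hL : LipschitzOnWith L (chartParam A η) (paramDomain x₀ r A η)) (v : E3)
    {F : E3 → ℝ≥0∞} (hF : Measurable F) :
    ∫⁻ x in Metric.ball x₀ r, ENNReal.ofReal |normalVel Ω (x, v)| *
        (∫⁻ s in Ioo 0 (backTime Ω x v), F (x - s • v)) ∂(surfaceMeasure Ω) ≤
      (L : ℝ≥0∞) ^ 2 * ∫⁻ z in Ω, F z := by
  rw [h.lintegral_surface_eq]
  refine (lintegral_mono' (h.surfaceMeasure_le hL) le_rfl).trans ?_
  rw [lintegral_smul_measure, smul_eq_mul, lintegral_flowIntegrand ho h.contDiff v hF]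
  refine mul_le_mul_right ?_ _
  calc _ ≤ ∫⁻ z in flowDomain Ω x₀ r A η v, ENNReal.ofReal |slope η (horiz z) (A v)| *
        F (chartFlow A η v z) := by
        refine lintegral_mono fun z => ?_
        refine mul_le_mul_left (ENNReal.ofReal_le_ofReal ?_) _
        rw [abs_inner_chartNormal_chartParam]
        exact mul_le_of_le_one_left (abs_nonneg _) (inv_le_one_of_one_le₀ (one_le_areaFactor _ _))
    _ = ∫⁻ x in chartFlow A η v '' flowDomain Ω x₀ r A η v, F x :=
        (lintegral_image_chartFlow A h.contDiff v (measurableSet_flowDomain ho h.contDiff v)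
          (h.injOn_chartFlow ho v) F).symm
    _ ≤ _ := by
        refine lintegral_mono_set ?_
        rintro _ ⟨z, hz, rfl⟩
        exact sub_smul_mem_of_lt_backTime hz.2.1 hz.2.2

theorem IsGraphChart.le_lintegral_flow (h : IsGraphChart Ω x₀ r A η) (ho : IsOpen Ω) {a : ℝ≥0}
    (ha : ∀ y ∈ paramDomain x₀ r A η, areaFactor η y ≤ a) (v : E3)
    {F : E3 → ℝ≥0∞} (hF : Measurable F) :
    ∫⁻ x in chartFlow A η v '' flowDomain Ω x₀ r A η v, F x ≤
      a * ∫⁻ x in Metric.ball x₀ r, ENNReal.ofReal |normalVel Ω (x, v)| *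
        (∫⁻ s in Ioo 0 (backTime Ω x v), F (x - s • v)) ∂(surfaceMeasure Ω) := by
  rw [h.lintegral_surface_eq, lintegral_image_chartFlow A h.contDiff v
    (measurableSet_flowDomain ho h.contDiff v) (h.injOn_chartFlow ho v) F]
  refine le_trans ?_ (mul_le_mul_right (lintegral_mono' h.le_surfaceMeasure le_rfl) _)
  rw [lintegral_flowIntegrand ho h.contDiff v hF, ← lintegral_const_mul' _ _ ENNReal.coe_ne_top]
  refine setLIntegral_mono' (measurableSet_flowDomain ho h.contDiff v) fun z hz => ?_
  rw [← mul_assoc, ← ENNReal.ofReal_coe_nnreal (p := a), ← ENNReal.ofReal_mul a.coe_nonneg]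
  gcongr
  rw [abs_inner_chartNormal_chartParam, ← mul_assoc]
  refine le_mul_of_one_le_left (abs_nonneg _) ?_
  rw [← div_eq_mul_inv, one_le_div (areaFactor_pos _ _)]
  exact ha _ hz.1

theorem exists_areaFactor_le (hη : ContDiff ℝ 2 η) (x₀ : E3) (r : ℝ) (A : E3 ≃ₗᵢ[ℝ] E3) :
    ∃ a : ℝ≥0, ∀ y ∈ paramDomain x₀ r A η, areaFactor η y ≤ a := by
  obtain ⟨a, ha⟩ := (isCompact_closedBall (horiz (A x₀)) r).bddAbove_image
    (continuous_areaFactor hη).continuousOn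
  refine ⟨a.toNNReal, fun y hy => le_trans (ha ⟨y, ?_, rfl⟩) (Real.le_coe_toNNReal a)⟩
  exact Metric.ball_subset_closedBall (paramDomain_subset _ _ _ _ hy)

/-- A finite family of graph charts whose half-radius balls cover the boundary. -/
theorem HasC2Boundary.exists_finite_charts (hΩ : HasC2Boundary Ω) (hb : Bornology.IsBounded Ω) :
    ∃ (ι : Type) (_ : Fintype ι) (c : ι → E3) (ρ : ι → ℝ) (A : ι → E3 ≃ₗᵢ[ℝ] E3) (η : ι → E2 → ℝ),
      (∀ i, IsGraphChart Ω (c i) (ρ i) (A i) (η i)) ∧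
      frontier Ω ⊆ ⋃ i, Metric.ball (c i) (ρ i / 2) := by
  have hK : IsCompact (frontier Ω) :=
    hb.closure.isCompact_closure.of_isClosed_subset isClosed_frontier
      (frontier_subset_closure.trans (by rw [closure_closure]))
  choose! ρ A η hc using hΩ
  obtain ⟨t, ht, hcov⟩ := hK.elim_nhds_subcover (fun x => Metric.ball x (ρ x / 2))
    fun x hx => Metric.ball_mem_nhds x (half_pos (hc x hx).radius_pos)
  refine ⟨ULift.{0} t, inferInstance, fun i => i.down, fun i => ρ i.down, fun i => A i.down,
    fun i => η i.down, fun i => hc _ (ht _ i.down.2), fun x hx => ?_⟩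
  obtain ⟨y, hy, hxy⟩ := mem_iUnion₂.1 (hcov hx)
  exact mem_iUnion.2 ⟨⟨⟨y, hy⟩⟩, hxy⟩

theorem lintegral_surfaceMeasure_le {ι : Type} [Fintype ι] {c : ι → E3} {ρ : ι → ℝ}
    (hcov : frontier Ω ⊆ ⋃ i, Metric.ball (c i) (ρ i)) (f : E3 → ℝ≥0∞) :
    ∫⁻ x, f x ∂(surfaceMeasure Ω) ≤
      ∑ i, ∫⁻ x in Metric.ball (c i) (ρ i), f x ∂(surfaceMeasure Ω) := by
  have : ∫⁻ x, f x ∂(surfaceMeasure Ω) =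
      ∫⁻ x in ⋃ i, Metric.ball (c i) (ρ i), f x ∂(surfaceMeasure Ω) := by
    rw [Measure.restrict_eq_self_of_ae_mem]
    filter_upwards [surfaceMeasure_ae_mem Ω] with x hx using hcov hx
  rw [this]
  refine (lintegral_iUnion_le _ _).trans ?_
  rw [tsum_fintype]

theorem HasC2Boundary.isFiniteMeasure_surfaceMeasure (hΩ : HasC2Boundary Ω)
    (hb : Bornology.IsBounded Ω) : IsFiniteMeasure (surfaceMeasure Ω) := by
  obtain ⟨ι, _, c, ρ, A, η, hc, hcov⟩ := hΩ.exists_finite_charts hb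
  have hcov' : frontier Ω ⊆ ⋃ i, Metric.ball (c i) (ρ i) :=
    hcov.trans (iUnion_mono fun i => Metric.ball_subset_ball
      (by linarith [(hc i).radius_pos]))
  refine ⟨?_⟩
  have := lintegral_surfaceMeasure_le hcov' (fun _ => 1)
  rw [lintegral_one] at this
  refine this.trans_lt (ENNReal.sum_lt_top.2 fun i _ => ?_)
  obtain ⟨L, hL⟩ := (hc i).exists_lipschitzOnWith
  rw [lintegral_one]
  refine ((hc i).surfaceMeasure_le hL univ).trans_lt ?_
  rw [Measure.smul_apply, Measure.map_apply (contDiff_chartParam (A i) (hc i).contDiff).continuous.measurable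
    MeasurableSet.univ, preimage_univ, Measure.restrict_apply_univ, smul_eq_mul]
  refine ENNReal.mul_lt_top (by finiteness) ?_
  exact (measure_mono (paramDomain_subset _ _ _ _)).trans_lt Metric.isBounded_ball.measure_lt_top

theorem HasC2Boundary.exists_lintegral_flow_le (hΩ : HasC2Boundary Ω) (ho : IsOpen Ω)
    (hb : Bornology.IsBounded Ω) :
    ∃ C : ℝ≥0, ∀ (v : E3) (F : E3 → ℝ≥0∞), Measurable F →
      ∫⁻ x, ENNReal.ofReal |normalVel Ω (x, v)| *
        (∫⁻ s in Ioo 0 (backTime Ω x v), F (x - s • v)) ∂(surfaceMeasure Ω) ≤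
      C * ∫⁻ z in Ω, F z := by
  obtain ⟨ι, _, c, ρ, A, η, hc, hcov⟩ := hΩ.exists_finite_charts hb
  have hcov' : frontier Ω ⊆ ⋃ i, Metric.ball (c i) (ρ i) :=
    hcov.trans (iUnion_mono fun i => Metric.ball_subset_ball
      (by linarith [(hc i).radius_pos]))
  choose L hL using fun i => (hc i).exists_lipschitzOnWith
  refine ⟨∑ i, L i ^ 2, fun v F hF => (lintegral_surfaceMeasure_le hcov' _).trans ?_⟩
  rw [ENNReal.ofNNReal_finsetSum, Finset.sum_mul]
  refine Finset.sum_le_sum fun i _ => ?_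
  rw [ENNReal.coe_pow]
  exact (hc i).lintegral_flow_le ho (hL i) v hF

/-- Every z in Ω is reached: moving forward with velocity v ≠ 0 it exits at a boundary point z + τ
v, which lies in one of the charts, and z is obtained by flowing back from there for the time τ. -/
theorem HasC2Boundary.exists_le_lintegral_flow (hΩ : HasC2Boundary Ω) (ho : IsOpen Ω)
    (hb : Bornology.IsBounded Ω) :
    ∃ C : ℝ≥0, ∀ v : E3, v ≠ 0 → ∀ F : E3 → ℝ≥0∞, Measurable F →
      ∫⁻ z in Ω, F z ≤ C * ∫⁻ x, ENNReal.ofReal |normalVel Ω (x, v)| *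
        (∫⁻ s in Ioo 0 (backTime Ω x v), F (x - s • v)) ∂(surfaceMeasure Ω) := by
  obtain ⟨ι, _, c, ρ, A, η, hc, hcov⟩ := hΩ.exists_finite_charts hb
  have hcov' : frontier Ω ⊆ ⋃ i, Metric.ball (c i) (ρ i) :=
    hcov.trans (iUnion_mono fun i => Metric.ball_subset_ball
      (by linarith [(hc i).radius_pos]))
  choose a ha using fun i => exists_areaFactor_le (hc i).contDiff (c i) (ρ i) (A i)
  refine ⟨∑ i, a i, fun v hv F hF => ?_⟩
  have hsub : Ω ⊆ ⋃ i, chartFlow (A i) (η i) v '' flowDomain Ω (c i) (ρ i) (A i) (η i) v := by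
    intro z hz
    have h1 := backTime_pos_of_mem ho hb hv hz
    have h2 := backTime_pos_of_mem ho hb (neg_ne_zero.2 hv) hz
    have h3 := backTime_add_smul ho hb hv hz
    have h4 := sub_backTime_mem_frontier ho hb (neg_ne_zero.2 hv) h2
    rw [smul_neg, sub_neg_eq_add] at h4
    obtain ⟨i, hi⟩ := mem_iUnion.1 (hcov' h4)
    set τ := backTime Ω z (-v) with hτ
    have h5 := chartParam_of_chartFun_eq_zero (((hc i).mem_frontier_iff_chartFun hi).1 h4)
    -- The parameters of z in chart i: the projection of its forward exit point, and the forward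
    -- exit time τ.
    set y : E3 := !₂[horiz (A i (z + τ • v)) 0, horiz (A i (z + τ • v)) 1, τ] with hy
    have hy1 : horiz y = horiz (A i (z + τ • v)) := by
      ext j; fin_cases j <;> simp [horiz, hy]
    have hy2 : y 2 = τ := by simp [hy]
    refine mem_iUnion.2 ⟨i, y, ⟨?_, ?_, ?_⟩, ?_⟩
    · rw [hy1, paramDomain, mem_preimage, h5]; exact hi
    · rw [hy2]; exact h2
    · rw [hy1, hy2, h5, h3]; linarith
    · rw [chartFlow, hy1, hy2, h5, add_sub_cancel_right]
  refine (lintegral_mono_set hsub).trans ((lintegral_iUnion_le _ _).trans ?_)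
  rw [tsum_fintype, ENNReal.ofNNReal_finsetSum, Finset.sum_mul]
  refine Finset.sum_le_sum fun i _ => ((hc i).le_lintegral_flow ho (ha i) v hF).trans ?_
  gcongr
  exact Measure.restrict_le_self

end

noncomputable section

open scoped NNReal ENNReal

/-! ### Measurability of the normal, integrals over the boundary phase space -/

variable {Ω : Set E3}

/-- The normal is defined by choice, but by uniqueness it coincides with a continuous function in
each of finitely many charts, and it is 0 off the boundary. -/
theorem HasC2Boundary.measurable_normal (hΩ : HasC2Boundary Ω) (hb : Bornology.IsBounded Ω) :
    Measurable (normal Ω) := by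
  obtain ⟨ι, _, c, ρ, A, η, hc, hcov⟩ := hΩ.exists_finite_charts hb
  refine measurable_of_isOpen fun O hO => ?_
  have e : normal Ω ⁻¹' O = (⋃ i, (Metric.ball (c i) (ρ i) ∩ frontier Ω) ∩
      chartNormal (A i) (η i) ⁻¹' O) ∪ ((frontier Ω)ᶜ ∩ (fun _ => (0 : E3)) ⁻¹' O) := by
    ext x
    simp only [mem_preimage, mem_union, mem_iUnion, mem_inter_iff, mem_compl_iff]
    constructor
    · intro hx
      by_cases hf : x ∈ frontier Ω
      · obtain ⟨i, hi⟩ := mem_iUnion.1 (hcov hf)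
        have hi' : x ∈ Metric.ball (c i) (ρ i) :=
          Metric.ball_subset_ball (by linarith [(hc i).radius_pos]) hi
        exact Or.inl ⟨i, ⟨hi', hf⟩, by rwa [← (hc i).normal_eq hf hi']⟩
      · exact Or.inr ⟨hf, by rwa [← normal_of_notMem hf]⟩
    · rintro (⟨i, ⟨hi, hf⟩, hx⟩ | ⟨hf, hx⟩)
      · rwa [(hc i).normal_eq hf hi]
      · rwa [normal_of_notMem hf]
  rw [e]
  refine MeasurableSet.union (MeasurableSet.iUnion fun i => ?_) ?_
  · exact (Metric.isOpen_ball.measurableSet.inter isClosed_frontier.measurableSet).inter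
      ((continuous_chartNormal (A i) (hc i).contDiff).measurable hO.measurableSet)
  · exact isClosed_frontier.measurableSet.compl.inter (measurable_const hO.measurableSet)

theorem HasC2Boundary.measurable_normalVel (hΩ : HasC2Boundary Ω) (hb : Bornology.IsBounded Ω) :
    Measurable (normalVel Ω) :=
  ((hΩ.measurable_normal hb).comp measurable_fst).inner measurable_snd

theorem HasC2Boundary.measurableSet_gammaPlus (hΩ : HasC2Boundary Ω)
    (hb : Bornology.IsBounded Ω) : MeasurableSet (gammaPlus Ω) := by
  rw [gammaPlus, ofPred_and]
  exact (measurable_fst isClosed_frontier.measurableSet).inter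
    (measurableSet_lt measurable_const (hΩ.measurable_normalVel hb))

theorem HasC2Boundary.measurableSet_gammaMinus (hΩ : HasC2Boundary Ω)
    (hb : Bornology.IsBounded Ω) : MeasurableSet (gammaMinus Ω) := by
  rw [gammaMinus, ofPred_and]
  exact (measurable_fst isClosed_frontier.measurableSet).inter
    (measurableSet_lt (hΩ.measurable_normalVel hb) measurable_const)

theorem HasC2Boundary.sFinite_boundaryMeasure (hΩ : HasC2Boundary Ω)
    (hb : Bornology.IsBounded Ω) : SFinite (boundaryMeasure Ω) := by
  have := hΩ.isFiniteMeasure_surfaceMeasure hb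
  unfold boundaryMeasure
  infer_instance

theorem HasC2Boundary.sFinite_gammaMeasure (hΩ : HasC2Boundary Ω)
    (hb : Bornology.IsBounded Ω) : SFinite (gammaMeasure Ω) := by
  have := hΩ.sFinite_boundaryMeasure hb
  unfold gammaMeasure
  infer_instance

instance sFinite_timeMeasure (T : ℝ) : SFinite (timeMeasure T) := by
  unfold timeMeasure
  infer_instance

theorem HasC2Boundary.lintegral_gammaMeasure (hΩ : HasC2Boundary Ω) (hb : Bornology.IsBounded Ω)
    {f : E3 × E3 → ℝ≥0∞} (hf : Measurable f) :
    ∫⁻ p, f p ∂(gammaMeasure Ω) =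
      ∫⁻ v, ∫⁻ x, ENNReal.ofReal |normalVel Ω (x, v)| * f (x, v) ∂(surfaceMeasure Ω) := by
  have := hΩ.isFiniteMeasure_surfaceMeasure hb
  have hw : Measurable fun p => ENNReal.ofReal |normalVel Ω p| :=
    ENNReal.measurable_ofReal.comp
      (continuous_abs.measurable.comp (hΩ.measurable_normalVel hb))
  rw [gammaMeasure, lintegral_withDensity_eq_lintegral_mul _ hw hf, boundaryMeasure,
    lintegral_prod_symm _ (hw.mul hf).aemeasurable]
  rfl

theorem HasC2Boundary.lintegral_time_gamma (hΩ : HasC2Boundary Ω) (hb : Bornology.IsBounded Ω)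
    (T : ℝ) {f : ℝ × (E3 × E3) → ℝ≥0∞} (hf : Measurable f) :
    ∫⁻ z, f z ∂((timeMeasure T).prod (gammaMeasure Ω)) =
      ∫⁻ v, ∫⁻ x, ENNReal.ofReal |normalVel Ω (x, v)| * (∫⁻ t in Icc 0 T, f (t, (x, v)))
        ∂(surfaceMeasure Ω) := by
  have := hΩ.sFinite_gammaMeasure hb
  rw [lintegral_prod_symm _ hf.aemeasurable,
    hΩ.lintegral_gammaMeasure hb hf.lintegral_prod_left']
  rfl

theorem HasC2Boundary.gammaPlusTimeMeasure_le (hΩ : HasC2Boundary Ω) (hb : Bornology.IsBounded Ω)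
    (T : ℝ) : gammaPlusTimeMeasure Ω T ≤ (timeMeasure T).prod (gammaMeasure Ω) := by
  have := hΩ.sFinite_gammaMeasure hb
  exact Measure.prod_mono le_rfl Measure.restrict_le_self

theorem HasC2Boundary.gammaMinusTimeMeasure_eq (hΩ : HasC2Boundary Ω)
    (hb : Bornology.IsBounded Ω) (T : ℝ) : gammaMinusTimeMeasure Ω T =
      ((timeMeasure T).prod (gammaMeasure Ω)).restrict (univ ×ˢ gammaMinus Ω) := by
  have := hΩ.sFinite_gammaMeasure hb
  rw [gammaMinusTimeMeasure, ← Measure.prod_restrict, Measure.restrict_univ]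

theorem HasC2Boundary.gammaPlusTimeMeasure_eq (hΩ : HasC2Boundary Ω)
    (hb : Bornology.IsBounded Ω) (T : ℝ) : gammaPlusTimeMeasure Ω T =
      ((timeMeasure T).prod (gammaMeasure Ω)).restrict (univ ×ˢ gammaPlus Ω) := by
  have := hΩ.sFinite_gammaMeasure hb
  rw [gammaPlusTimeMeasure, ← Measure.prod_restrict, Measure.restrict_univ]

theorem lintegral_Icc_shift_le (T : ℝ) {s : ℝ} (hs : 0 ≤ s) (g : ℝ → ℝ≥0∞) :
    ∫⁻ t in Icc 0 T, (if s < t then g (t - s) else 0) ≤ ∫⁻ t in Icc 0 T, g t := by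
  rw [← lintegral_indicator measurableSet_Icc, ← lintegral_indicator measurableSet_Icc,
    ← lintegral_sub_right_eq_self ((Icc 0 T).indicator g) s]
  refine lintegral_mono fun t => ?_
  by_cases ht : t ∈ Icc 0 T
  · rw [indicator_of_mem ht]
    split_ifs with h
    · rw [indicator_of_mem]
      exact ⟨by linarith, by linarith [ht.2]⟩
    · exact zero_le
  · rw [indicator_of_notMem ht]
    exact zero_le

theorem lintegral_bulkTimeMeasure {T : ℝ} {F : ℝ × (E3 × E3) → ℝ≥0∞} (hF : Measurable F) :
    ∫⁻ z, F z ∂(bulkTimeMeasure Ω T) =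
      ∫⁻ v, ∫⁻ x in Ω, ∫⁻ t in Icc 0 T, F (t, (x, v)) := by
  rw [bulkTimeMeasure, lintegral_prod_symm _ hF.aemeasurable, phase, Measure.volume_eq_prod,
    ← Measure.prod_restrict, Measure.restrict_univ,
    lintegral_prod_symm _ hF.lintegral_prod_left'.aemeasurable]
  rfl

theorem lintegral_phase {F : E3 × E3 → ℝ≥0∞} (hF : Measurable F) :
    ∫⁻ z in phase Ω, F z = ∫⁻ v, ∫⁻ x in Ω, F (x, v) := by
  rw [phase, Measure.volume_eq_prod, ← Measure.prod_restrict, Measure.restrict_univ,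
    lintegral_prod_symm _ hF.aemeasurable]

/-- Integrals along backward trajectories from the boundary are controlled by integrals over
the interior. -/
theorem HasC2Boundary.exists_lintegral_trajectory_le (hΩ : HasC2Boundary Ω) (ho : IsOpen Ω)
    (hb : Bornology.IsBounded Ω) :
    ∃ C : ℝ≥0, ∀ (T : ℝ) (F : ℝ × (E3 × E3) → ℝ≥0∞), Measurable F →
      ∫⁻ z, (∫⁻ s in Ioo 0 (backTime Ω z.2.1 z.2.2),
        if s < z.1 then F (z.1 - s, (z.2.1 - s • z.2.2, z.2.2)) else 0)
          ∂((timeMeasure T).prod (gammaMeasure Ω)) ≤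
      C * ∫⁻ z, F z ∂(bulkTimeMeasure Ω T) := by
  obtain ⟨C, hC⟩ := hΩ.exists_lintegral_flow_le ho hb
  refine ⟨C, fun T F hF => ?_⟩
  have hm : Measurable fun q : (ℝ × (E3 × E3)) × ℝ =>
      (if q.2 < q.1.1 then F (q.1.1 - q.2, (q.1.2.1 - q.2 • q.1.2.2, q.1.2.2)) else 0) :=
    Measurable.ite (measurableSet_lt measurable_snd (by fun_prop))
      (hF.comp (by fun_prop)) measurable_const
  have hbt : Measurable fun q : (ℝ × (E3 × E3)) × ℝ => backTime Ω q.1.2.1 q.1.2.2 :=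
    measurable_backTime_comp ho (by fun_prop) (by fun_prop)
  have hS : MeasurableSet ({q : (ℝ × (E3 × E3)) × ℝ | 0 < q.2} ∩
      {q | q.2 < backTime Ω q.1.2.1 q.1.2.2}) :=
    (measurableSet_lt measurable_const measurable_snd).inter (measurableSet_lt measurable_snd hbt)
  have hm2 := (hm.indicator hS).lintegral_prod_right' (ν := volume)
  have e : ∀ z : ℝ × (E3 × E3), (∫⁻ s in Ioo 0 (backTime Ω z.2.1 z.2.2),
        if s < z.1 then F (z.1 - s, (z.2.1 - s • z.2.2, z.2.2)) else 0) =
      ∫⁻ s, ({q : (ℝ × (E3 × E3)) × ℝ | 0 < q.2} ∩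
      {q | q.2 < backTime Ω q.1.2.1 q.1.2.2}).indicator (fun q : (ℝ × (E3 × E3)) × ℝ =>
      (if q.2 < q.1.1 then F (q.1.1 - q.2, (q.1.2.1 - q.2 • q.1.2.2, q.1.2.2)) else 0)) (z, s) := by
    intro z
    rw [← lintegral_indicator measurableSet_Ioo]
    rfl
  simp_rw [e]
  rw [hΩ.lintegral_time_gamma hb T hm2, lintegral_bulkTimeMeasure hF,
    ← lintegral_const_mul' _ _ ENNReal.coe_ne_top]
  refine lintegral_mono fun v => ?_
  refine le_trans (lintegral_mono fun x => ?_)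
    (hC v (fun x => ∫⁻ t in Icc 0 T, F (t, (x, v))) ?_)
  · refine mul_le_mul_right ?_ _
    simp_rw [← e]
    have hm3 : Measurable (Function.uncurry fun (t s : ℝ) =>
        if s < t then F (t - s, (x - s • v, v)) else 0) :=
      Measurable.ite (measurableSet_lt measurable_snd measurable_fst)
        (hF.comp (by fun_prop)) measurable_const
    -- For fixed s the integrand is a time translate, so the time integral is taken first;
    -- translating by s ≥ 0 stays below the integral over [0, T].
    rw [lintegral_lintegral_swap hm3.aemeasurable]
    refine setLIntegral_mono' measurableSet_Ioo fun s hs => ?_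
    exact lintegral_Icc_shift_le T hs.1.le fun t => F (t, (x - s • v, v))
  · exact (hF.comp (by fun_prop : Measurable fun q : E3 × ℝ => (q.2, (q.1, v)))).lintegral_prod_right'

/-- The initial datum transported to the boundary is controlled by its integral. -/
theorem HasC2Boundary.exists_lintegral_initial_le (hΩ : HasC2Boundary Ω) (ho : IsOpen Ω)
    (hb : Bornology.IsBounded Ω) :
    ∃ C : ℝ≥0, ∀ (T : ℝ) (F : E3 × E3 → ℝ≥0∞), Measurable F →
      ∫⁻ z, (if z.1 < backTime Ω z.2.1 z.2.2 then F (z.2.1 - z.1 • z.2.2, z.2.2) else 0)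
          ∂((timeMeasure T).prod (gammaMeasure Ω)) ≤
      C * ∫⁻ p in phase Ω, F p := by
  obtain ⟨C, hC⟩ := hΩ.exists_lintegral_flow_le ho hb
  refine ⟨C, fun T F hF => ?_⟩
  have hm : Measurable fun z : ℝ × (E3 × E3) =>
      (if z.1 < backTime Ω z.2.1 z.2.2 then F (z.2.1 - z.1 • z.2.2, z.2.2) else 0) :=
    Measurable.ite (measurableSet_lt measurable_fst
      (measurable_backTime_comp ho (by fun_prop) (by fun_prop)))
      (hF.comp (by fun_prop)) measurable_const
  rw [hΩ.lintegral_time_gamma hb T hm, lintegral_phase hF,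
    ← lintegral_const_mul' _ _ ENNReal.coe_ne_top]
  refine lintegral_mono fun v => ?_
  refine le_trans (lintegral_mono fun x => ?_) (hC v (fun x => F (x, v)) (hF.comp (by fun_prop)))
  refine mul_le_mul_right ?_ _
  rw [← lintegral_indicator measurableSet_Icc, ← lintegral_indicator measurableSet_Ioo]
  refine lintegral_mono_ae ?_
  -- The time t = 0 belongs to the closed interval but not to the open interval of flight times.
  have h0 : ∀ᵐ t : ℝ, t ≠ 0 := by simp [ae_iff]
  filter_upwards [h0] with t ht
  by_cases h1 : t ∈ Icc 0 T
  · rw [indicator_of_mem h1]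
    split_ifs with h2
    · rw [indicator_of_mem]
      exact ⟨lt_of_le_of_ne h1.1 (Ne.symm ht), h2⟩
    · exact zero_le
  · rw [indicator_of_notMem h1]
    exact zero_le

/-- A trajectory with n·v > 0 leaves Ω at once, whereas a positive forward flight time keeps it
inside for a while. Tangential velocities are not excluded, hence only ≤. -/
theorem HasC2Boundary.normalVel_nonpos (hΩ : HasC2Boundary Ω) {x v : E3} (hx : x ∈ frontier Ω)
    (h : 0 < backTime Ω x (-v)) : normalVel Ω (x, v) ≤ 0 := by
  by_contra hc
  push Not at hc
  have h1 := (hΩ.isOutwardNormal hx).eventually_notMem hx hc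
  obtain ⟨s, hs1, hs2⟩ := (h1.and (eventually_of_backTime_pos h)).exists
  rw [smul_neg, sub_neg_eq_add] at hs2
  exact hs1 hs2

theorem HasC2Boundary.backTime_pos (hΩ : HasC2Boundary Ω) (hb : Bornology.IsBounded Ω)
    {p : E3 × E3} (h : p ∈ gammaPlus Ω) : 0 < backTime Ω p.1 p.2 := by
  obtain ⟨hx, hv⟩ := h
  have hv0 : p.2 ≠ 0 := by
    intro h0
    rw [normalVel, h0, inner_zero_right] at hv
    exact lt_irrefl _ hv
  refine backTime_pos_of_eventually hb hv0 ?_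
  have := (hΩ.isOutwardNormal hx).eventually_mem (w := -p.2) hx
    (by rw [inner_neg_right]; exact neg_neg_of_pos hv)
  simpa [sub_eq_add_neg] using this

end

noncomputable section

open scoped NNReal ENNReal

variable {Ω : Set E3}

/-! ### Transfer from the outgoing to the incoming boundary -/

theorem boundaryMeasure_ae_mem (Ω : Set E3) : ∀ᵐ p ∂(boundaryMeasure Ω), p.1 ∈ frontier Ω :=
  Measure.quasiMeasurePreserving_fst.ae (surfaceMeasure_ae_mem Ω)

theorem gammaMeasure_ae_mem (Ω : Set E3) : ∀ᵐ p ∂(gammaMeasure Ω), p.1 ∈ frontier Ω :=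
  (withDensity_absolutelyContinuous _ _).ae_le (boundaryMeasure_ae_mem Ω)

theorem time_gamma_ae_mem (Ω : Set E3) (T : ℝ) :
    ∀ᵐ z ∂((timeMeasure T).prod (gammaMeasure Ω)), z.2.1 ∈ frontier Ω :=
  Measure.quasiMeasurePreserving_snd.ae (gammaMeasure_ae_mem Ω)

theorem ne_zero_of_backTime_pos (ho : IsOpen Ω) {x v : E3} (hx : x ∈ frontier Ω)
    (h : 0 < backTime Ω x v) : v ≠ 0 := by
  rintro rfl
  have := sub_smul_mem_of_lt_backTime (half_pos h) (half_lt_self h)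
  rw [smul_zero, sub_zero] at this
  exact notMem_of_mem_frontier ho hx this

/-- The density on the interior phase space that carries a function of the entry point of
trajectories. -/
def entryDensity (Ω : Set E3) (Φ : ℝ × (E3 × E3) → ℝ≥0∞) (z : ℝ × (E3 × E3)) : ℝ≥0∞ :=
  (if backTime Ω z.2.1 z.2.2 < z.1 then
    Φ (z.1 - backTime Ω z.2.1 z.2.2, (z.2.1 - backTime Ω z.2.1 z.2.2 • z.2.2, z.2.2)) else 0) /
  ENNReal.ofReal (backTime Ω z.2.1 z.2.2 + backTime Ω z.2.1 (-z.2.2))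

theorem measurable_entryDensity (ho : IsOpen Ω) {Φ : ℝ × (E3 × E3) → ℝ≥0∞} (hΦ : Measurable Φ) :
    Measurable (entryDensity Ω Φ) := by
  have h1 : Measurable fun z : ℝ × (E3 × E3) => backTime Ω z.2.1 z.2.2 :=
    measurable_backTime_comp ho (by fun_prop) (by fun_prop)
  have h2 : Measurable fun z : ℝ × (E3 × E3) => backTime Ω z.2.1 (-z.2.2) :=
    measurable_backTime_comp ho (by fun_prop) (by fun_prop)
  refine Measurable.div (Measurable.ite (measurableSet_lt h1 measurable_fst) ?_ measurable_const)
    (ENNReal.measurable_ofReal.comp (h1.add h2))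
  exact hΦ.comp ((measurable_fst.sub h1).prodMk
    (((measurable_fst.comp measurable_snd).sub (h1.smul (measurable_snd.comp measurable_snd))).prodMk
      (measurable_snd.comp measurable_snd)))

/-- The entry point and the full length in time of the chord are constant along the chord. Dividing
by that length spreads Φ uniformly over the chord, and integrating along it gives back exactly the
value at the entry point. -/
theorem lintegral_entryDensity_backward (ho : IsOpen Ω) (hb : Bornology.IsBounded Ω)
    (Φ : ℝ × (E3 × E3) → ℝ≥0∞) {t : ℝ} {x v : E3} (hx : x ∈ frontier Ω)
    (h0 : 0 < backTime Ω x v) (ht : backTime Ω x v < t) :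
    ∫⁻ s in Ioo 0 (backTime Ω x v),
        (if s < t then entryDensity Ω Φ (t - s, (x - s • v, v)) else 0) =
      Φ (t - backTime Ω x v, (x - backTime Ω x v • v, v)) := by
  have hv := ne_zero_of_backTime_pos ho hx h0
  have e : ∀ s ∈ Ioo 0 (backTime Ω x v),
      (if s < t then entryDensity Ω Φ (t - s, (x - s • v, v)) else 0) =
      Φ (t - backTime Ω x v, (x - backTime Ω x v • v, v)) / ENNReal.ofReal (backTime Ω x v) := by
    intro s hs
    rw [if_pos (hs.2.trans ht), entryDensity]
    dsimp only
    rw [backTime_sub_smul ho hb hv hs.1 hs.2, backTime_sub_smul_neg ho hx hs.1 hs.2,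
      if_pos (by linarith), sub_add_cancel]
    have e1 : t - s - (backTime Ω x v - s) = t - backTime Ω x v := by ring
    have e2 : x - s • v - (backTime Ω x v - s) • v = x - backTime Ω x v • v := by module
    rw [e1, e2]
  rw [setLIntegral_congr_fun measurableSet_Ioo e, lintegral_const, Measure.restrict_apply_univ,
    Real.volume_Ioo, sub_zero]
  exact ENNReal.div_mul_cancel (by simpa using h0) ENNReal.ofReal_ne_top

/-- The same computation seen from the entry point. It is only an inequality, since translating the
time pushes part of the mass beyond T. -/
theorem lintegral_entryDensity_forward_le (ho : IsOpen Ω) (hb : Bornology.IsBounded Ω)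
    (Φ : ℝ × (E3 × E3) → ℝ≥0∞) (T : ℝ) {x v : E3} (hx : x ∈ frontier Ω) :
    ∫⁻ s in Ioo 0 (backTime Ω x (-v)), (∫⁻ t in Icc 0 T,
        entryDensity Ω Φ (t, (x - s • -v, v))) ≤ ∫⁻ t in Icc 0 T, Φ (t, (x, v)) := by
  rcases (backTime_nonneg Ω x (-v)).eq_or_lt with h0 | h0
  · rw [← h0]; simp
  have hv := ne_zero_of_backTime_pos ho hx h0
  have e : ∀ s ∈ Ioo 0 (backTime Ω x (-v)), (∫⁻ t in Icc 0 T,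
        entryDensity Ω Φ (t, (x - s • -v, v))) ≤
      (∫⁻ t in Icc 0 T, Φ (t, (x, v))) / ENNReal.ofReal (backTime Ω x (-v)) := by
    intro s hs
    have e1 := backTime_sub_smul ho hb hv hs.1 hs.2
    have e2 := backTime_sub_smul_neg ho hx hs.1 hs.2
    rw [neg_neg] at e2
    have e3 : x - s • -v - s • v = x := by module
    simp only [entryDensity, e1, e2, e3, add_sub_cancel, div_eq_mul_inv]
    rw [lintegral_mul_const' _ _ (ENNReal.inv_ne_top.2 (by simpa using h0))]
    exact mul_le_mul_left (lintegral_Icc_shift_le T hs.1.le fun t => Φ (t, (x, v))) _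
  refine (setLIntegral_mono' measurableSet_Ioo e).trans ?_
  rw [lintegral_const, Measure.restrict_apply_univ, Real.volume_Ioo, sub_zero,
    ENNReal.div_mul_cancel (by simpa using h0) ENNReal.ofReal_ne_top]

/-- Integrals over outgoing points of functions of the entry point of the trajectory are
controlled by integrals over incoming points. -/
theorem HasC2Boundary.exists_lintegral_entry_le (hΩ : HasC2Boundary Ω) (ho : IsOpen Ω)
    (hb : Bornology.IsBounded Ω) :
    ∃ C : ℝ≥0, ∀ (T : ℝ) (Φ : ℝ × (E3 × E3) → ℝ≥0∞), Measurable Φ →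
      ∫⁻ z, (if 0 < backTime Ω z.2.1 z.2.2 ∧ backTime Ω z.2.1 z.2.2 < z.1 then
        Φ (z.1 - backTime Ω z.2.1 z.2.2, (z.2.1 - backTime Ω z.2.1 z.2.2 • z.2.2, z.2.2)) else 0)
          ∂((timeMeasure T).prod (gammaMeasure Ω)) ≤
      C * ∫⁻ z, Φ z ∂(gammaMinusTimeMeasure Ω T) := by
  obtain ⟨C₁, hC₁⟩ := hΩ.exists_lintegral_trajectory_le ho hb
  obtain ⟨C₂, hC₂⟩ := hΩ.exists_le_lintegral_flow ho hb
  refine ⟨C₁ * C₂, fun T Φ hΦ => ?_⟩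
  have hF := measurable_entryDensity ho hΦ
  calc _ ≤ ∫⁻ z, (∫⁻ s in Ioo 0 (backTime Ω z.2.1 z.2.2),
        if s < z.1 then entryDensity Ω Φ (z.1 - s, (z.2.1 - s • z.2.2, z.2.2)) else 0)
          ∂((timeMeasure T).prod (gammaMeasure Ω)) := by
        refine lintegral_mono_ae ?_
        filter_upwards [time_gamma_ae_mem Ω T] with z hz
        split_ifs with h
        · exact (lintegral_entryDensity_backward ho hb Φ hz h.1 h.2).ge
        · exact zero_le
    _ ≤ C₁ * ∫⁻ z, entryDensity Ω Φ z ∂(bulkTimeMeasure Ω T) := hC₁ T _ hF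
    _ ≤ C₁ * (C₂ * ∫⁻ z, Φ z ∂(gammaMinusTimeMeasure Ω T)) := ?_
    _ = _ := by rw [ENNReal.coe_mul, mul_assoc]
  refine mul_le_mul_right ?_ _
  have hmS : MeasurableSet ((univ : Set ℝ) ×ˢ gammaMinus Ω) :=
    MeasurableSet.univ.prod (hΩ.measurableSet_gammaMinus hb)
  rw [lintegral_bulkTimeMeasure hF, hΩ.gammaMinusTimeMeasure_eq hb, ← lintegral_indicator hmS,
    hΩ.lintegral_time_gamma hb T (hΦ.indicator hmS), ← lintegral_const_mul' _ _ ENNReal.coe_ne_top]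
  have hv0 : ∀ᵐ v : E3, v ≠ 0 := by simp [ae_iff]
  refine lintegral_mono_ae ?_
  filter_upwards [hv0] with v hv
  -- With -v in place of v the interior is swept by the forward trajectories from the entry points.
  -- Points without a forward trajectory and tangential velocities then contribute nothing.
  refine (hC₂ (-v) (neg_ne_zero.2 hv) (fun x => ∫⁻ t in Icc 0 T, entryDensity Ω Φ (t, (x, v)))
    (hF.comp (by fun_prop : Measurable fun q : E3 × ℝ => (q.2, (q.1, v)))).lintegral_prod_right').trans ?_
  refine mul_le_mul_right (lintegral_mono_ae ?_) _
  filter_upwards [surfaceMeasure_ae_mem Ω] with x hx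
  rw [normalVel_neg, abs_neg]
  rcases (backTime_nonneg Ω x (-v)).eq_or_lt with h0 | h0
  · rw [← h0]; simp
  rcases (hΩ.normalVel_nonpos hx h0).eq_or_lt with h1 | h1
  · rw [h1]; simp
  refine mul_le_mul_right ?_ _
  refine (lintegral_entryDensity_forward_le ho hb Φ T hx).trans_eq ?_
  refine lintegral_congr fun t => ?_
  rw [indicator_of_mem]
  exact ⟨mem_univ _, hx, h1⟩

/-! ### Short trajectories are grazing -/

/-- Both points lie on the graph, so the normal part of the chord is the first-order Taylor
remainder of η. It is quadratic because ∇η is Lipschitz on a compact ball; here the C² regularity of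
the boundary enters. -/
theorem IsGraphChart.exists_abs_inner_le {x₀ : E3} {r : ℝ} {A : E3 ≃ₗᵢ[ℝ] E3} {η : E2 → ℝ}
    (h : IsGraphChart Ω x₀ r A η) :
    ∃ C : ℝ, 0 ≤ C ∧ ∀ x ∈ frontier Ω ∩ Metric.ball x₀ r, ∀ x' ∈ frontier Ω ∩ Metric.ball x₀ r,
      |inner ℝ (chartNormal A η x) (x' - x)| ≤ C * ‖x' - x‖ ^ 2 := by
  obtain ⟨K, hK⟩ :=
    ((h.contDiff.fderiv_right (m := 1) (by norm_num)).contDiffOn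
      (s := Metric.closedBall (horiz (A x₀)) r)).exists_lipschitzOnWith
      (by norm_num) (convex_closedBall _ _) (isCompact_closedBall _ _)
  refine ⟨K, K.2, fun x hx x' hx' => ?_⟩
  have hlip := lipschitzWith_horiz_comp A
  have hmem : ∀ x ∈ frontier Ω ∩ Metric.ball x₀ r,
      horiz (A x) ∈ Metric.closedBall (horiz (A x₀)) r := by
    intro x hx
    have := hlip.dist_le_mul x x₀
    rw [NNReal.coe_one, one_mul] at this
    exact this.trans (le_of_lt hx.2)
  have hd : ‖horiz (A x') - horiz (A x)‖ ≤ ‖x' - x‖ := by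
    have := hlip.dist_le_mul x' x
    rwa [NNReal.coe_one, one_mul, dist_eq_norm, dist_eq_norm] at this
  set y := horiz (A x) with hy
  set y' := horiz (A x') with hy'
  have hseg : segment ℝ y y' ⊆ Metric.closedBall (horiz (A x₀)) r :=
    (convex_closedBall _ _).segment_subset (hmem x hx) (hmem x' hx')
  have hmv : ‖η y' - η y - fderiv ℝ η y (y' - y)‖ ≤ (K * ‖y' - y‖) * ‖y' - y‖ := by
    refine (convex_segment y y').norm_image_sub_le_of_norm_hasFDerivWithin_le'
      (f' := fderiv ℝ η) (fun ξ _ => ((h.contDiff.differentiable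
        (by norm_num)).differentiableAt.hasFDerivAt).hasFDerivWithinAt) (fun ξ hξ => ?_)
      (left_mem_segment ℝ y y') (right_mem_segment ℝ y y')
    have := hK.norm_sub_le (hseg hξ) (hmem x hx)
    refine this.trans (mul_le_mul_of_nonneg_left ?_ K.2)
    exact norm_sub_le_of_mem_segment hξ
  have e0 := (h.mem_frontier_iff x hx.2).1 hx.1
  have e1 := (h.mem_frontier_iff x' hx'.2).1 hx'.1
  have es : slope η y (A (x' - x)) = -(η y' - η y - fderiv ℝ η y (y' - y)) := by
    rw [slope, ← horizL_apply, map_sub, map_sub, horizL_apply, horizL_apply, ← e0, PiLp.sub_apply,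
      e0, e1, ← hy, ← hy']
    ring
  rw [inner_chartNormal, abs_mul, abs_of_pos (inv_pos.2 (areaFactor_pos η _)), ← hy, es, abs_neg]
  calc _ ≤ |η y' - η y - fderiv ℝ η y (y' - y)| :=
        mul_le_of_le_one_left (abs_nonneg _) (inv_le_one_of_one_le₀ (one_le_areaFactor _ _))
    _ ≤ (K * ‖y' - y‖) * ‖y' - y‖ := hmv
    _ = K * ‖y' - y‖ ^ 2 := by ring
    _ ≤ K * ‖x' - x‖ ^ 2 := by
        have := K.2
        gcongr

theorem HasC2Boundary.exists_abs_normalVel_le (hΩ : HasC2Boundary Ω) (hb : Bornology.IsBounded Ω) :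
    ∃ C : ℝ, 0 ≤ C ∧ ∃ r : ℝ, 0 < r ∧ ∀ x ∈ frontier Ω, ∀ x' ∈ frontier Ω, ‖x' - x‖ < r →
      |normalVel Ω (x, x' - x)| ≤ C * ‖x' - x‖ ^ 2 := by
  obtain ⟨ι, _, c, ρ, A, η, hc, hcov⟩ := hΩ.exists_finite_charts hb
  choose C hC0 hC using fun i => (hc i).exists_abs_inner_le
  -- A Lebesgue number of the cover: a point within r of a half-radius ball remains in the full
  -- ball, so both ends of a short chord share a chart.
  have hev : ∀ᶠ r : ℝ in 𝓝[>] 0, ∀ i, r < ρ i / 2 :=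
    eventually_all.2 fun i => by
      filter_upwards [Ioo_mem_nhdsGT (half_pos (hc i).radius_pos)] with s hs using hs.2
  obtain ⟨r, hr, hr0⟩ := (hev.and self_mem_nhdsWithin).exists
  refine ⟨∑ i, C i, Finset.sum_nonneg fun i _ => hC0 i, r, hr0, fun x hx x' hx' hlt => ?_⟩
  obtain ⟨i, hi⟩ := mem_iUnion.1 (hcov hx)
  have h1 : x ∈ Metric.ball (c i) (ρ i) :=
    Metric.ball_subset_ball (by linarith [(hc i).radius_pos]) hi
  have h2 : x' ∈ Metric.ball (c i) (ρ i) := by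
    rw [Metric.mem_ball] at hi ⊢
    have := dist_triangle x' x (c i)
    rw [dist_eq_norm x' x] at this
    linarith [hr i]
  rw [normalVel, (hc i).normal_eq hx h1]
  refine (hC i x ⟨hx, h1⟩ x' ⟨hx', h2⟩).trans ?_
  gcongr
  exact Finset.single_le_sum (fun i _ => hC0 i) (Finset.mem_univ i)

/-- Velocities that are nearly tangential with respect to `e`, or large. -/
def grazingSet (C r ε : ℝ) (e : E3) : Set E3 := {v | |inner ℝ e v| ≤ C * ε * ‖v‖ ^ 2 ∨ r ≤ ε * ‖v‖}

theorem measurableSet_grazingSet (C r ε : ℝ) (e : E3) : MeasurableSet (grazingSet C r ε e) := by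
  rw [grazingSet, ofPred_or]
  exact (measurableSet_le (by fun_prop) (by fun_prop)).union
    (measurableSet_le (by fun_prop) (by fun_prop))

/-- The reflection that exchanges e and e' preserves norms and Lebesgue measure. Smallness for one
fixed direction is therefore smallness uniform over all boundary normals. -/
theorem lintegral_grazingSet_congr (C r ε : ℝ) {e e' : E3} (he : ‖e‖ = ‖e'‖) {W : ℝ → ℝ≥0∞} :
    ∫⁻ v in grazingSet C r ε e, W ‖v‖ = ∫⁻ v in grazingSet C r ε e', W ‖v‖ := by
  set R := (Submodule.span ℝ {e - e'})ᗮ.reflection with hR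
  have hRe : R e = e' := Submodule.reflection_sub he
  rw [← (measurePreserving_isometry R).setLIntegral_comp_preimage_emb
    R.toHomeomorph.measurableEmbedding _ (grazingSet C r ε e')]
  have : R ⁻¹' grazingSet C r ε e' = grazingSet C r ε e := by
    ext v
    simp only [grazingSet, mem_preimage, mem_ofPred_eq, LinearIsometryEquiv.norm_map, ← hRe,
      LinearIsometryEquiv.inner_map_map]
  rw [this]
  simp

/-- As ε ↓ 0 every v with e·v ≠ 0 eventually leaves the set, and the plane e·v = 0 is null;
dominated convergence concludes. -/
theorem tendsto_lintegral_grazingSet (C : ℝ) {r : ℝ} (hr : 0 < r) {e : E3} (he : e ≠ 0)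
    {f : E3 → ℝ≥0∞} (hf : Measurable f) (hfin : ∫⁻ v, f v ≠ ⊤) :
    Tendsto (fun ε : ℝ => ∫⁻ v in grazingSet C r ε e, f v) (𝓝[>] 0) (𝓝 0) := by
  simp_rw [← fun ε => lintegral_indicator (μ := volume) (measurableSet_grazingSet C r ε e) f]
  rw [show (0 : ℝ≥0∞) = ∫⁻ _ : E3, 0 by simp]
  refine tendsto_lintegral_filter_of_dominated_convergence f
    (Eventually.of_forall fun ε => hf.indicator (measurableSet_grazingSet C r ε e))
    (Eventually.of_forall fun ε => Eventually.of_forall fun v => indicator_le_self _ _ v) hfin ?_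
  have hnull : ∀ᵐ v : E3, inner ℝ e v ≠ (0 : ℝ) := by
    have h1 : (LinearMap.ker (innerSL ℝ e : E3 →ₗ[ℝ] ℝ)) ≠ ⊤ := by
      intro htop
      have : e ∈ LinearMap.ker (innerSL ℝ e : E3 →ₗ[ℝ] ℝ) := htop ▸ Submodule.mem_top
      rw [LinearMap.mem_ker] at this
      exact he (inner_self_eq_zero.1 this)
    have h2 := Measure.addHaar_submodule (volume : Measure E3) _ h1
    rw [ae_iff]
    convert! h2 using 2
    ext v
    simp
  filter_upwards [hnull] with v hv
  refine tendsto_const_nhds.congr' ?_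
  have t1 : Tendsto (fun ε : ℝ => C * ε * ‖v‖ ^ 2) (𝓝[>] 0) (𝓝 0) := by
    have : Continuous fun ε : ℝ => C * ε * ‖v‖ ^ 2 := by fun_prop
    simpa using (this.tendsto 0).mono_left nhdsWithin_le_nhds
  have t2 : Tendsto (fun ε : ℝ => ε * ‖v‖) (𝓝[>] 0) (𝓝 0) := by
    have : Continuous fun ε : ℝ => ε * ‖v‖ := by fun_prop
    simpa using (this.tendsto 0).mono_left nhdsWithin_le_nhds
  filter_upwards [t1.eventually_lt_const (abs_pos.2 hv), t2.eventually_lt_const hr] with ε h1 h2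
  rw [indicator_of_notMem]
  rintro (h | h)
  · exact absurd h1 (not_lt.2 h)
  · exact absurd h2 (not_lt.2 h)

/-- Radial weights have small integrals over the incoming velocities with a short trajectory,
uniformly in the boundary point. -/
theorem HasC2Boundary.exists_lintegral_short_le (hΩ : HasC2Boundary Ω) (ho : IsOpen Ω)
    (hb : Bornology.IsBounded Ω) {W : ℝ → ℝ≥0∞} (hW : Measurable W)
    (hfin : ∫⁻ v : E3, W ‖v‖ ≠ ⊤) {κ : ℝ≥0∞} (hκ : 0 < κ) :
    ∃ ε : ℝ, 0 < ε ∧ ∀ x ∈ frontier Ω,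
      ∫⁻ v in {v : E3 | 0 < backTime Ω x (-v) ∧ backTime Ω x (-v) < ε}, W ‖v‖ ≤ κ := by
  obtain ⟨C, hC0, r, hr, hC⟩ := hΩ.exists_abs_normalVel_le hb
  set e₀ : E3 := EuclideanSpace.single 0 1 with he₀
  have hn₀ : ‖e₀‖ = 1 := by simp [he₀]
  have ht := tendsto_lintegral_grazingSet C hr (e := e₀)
    (norm_ne_zero_iff.1 (by rw [hn₀]; norm_num)) (hW.comp measurable_norm) hfin
  obtain ⟨ε, hε, hε0⟩ := ((ht.eventually_lt_const hκ).and self_mem_nhdsWithin).exists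
  refine ⟨ε, hε0, fun x hx => ?_⟩
  have hn : ‖normal Ω x‖ = ‖e₀‖ := by rw [hn₀, (hΩ.isOutwardNormal hx).norm_eq_one]
  refine le_trans (lintegral_mono_set ?_) ((lintegral_grazingSet_congr C r ε hn).trans_le hε.le)
  rintro v ⟨h0, hlt⟩
  have hv := ne_zero_of_backTime_pos ho hx h0
  set τ := backTime Ω x (-v) with hτ
  rcases le_or_gt r (ε * ‖v‖) with hle | hgt
  · exact Or.inr hle
  left
  have hfr := sub_backTime_mem_frontier ho hb hv h0
  have e1 : x - τ • -v - x = τ • v := by module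
  have hlen : ‖τ • v‖ = τ * ‖v‖ := by rw [norm_smul, Real.norm_eq_abs, abs_of_pos h0]
  -- The chord from x to the exit point is τ v, of length below r. Dividing the quadratic bound for
  -- its normal part by τ gives |n·v| ≤ Cτ|v|².
  have h2 := hC x hx _ hfr (by
    rw [← hτ, e1, hlen]
    exact (mul_le_mul_of_nonneg_right hlt.le (norm_nonneg v)).trans_lt hgt)
  rw [← hτ, e1, hlen, normalVel] at h2
  simp only [inner_smul_right, abs_mul, abs_of_pos h0] at h2
  have h3 : |inner ℝ (normal Ω x) v| ≤ C * τ * ‖v‖ ^ 2 := by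
    refine le_of_mul_le_mul_left (h2.trans_eq ?_) h0
    ring
  refine h3.trans ?_
  gcongr

end

noncomputable section

/-! ### Weak derivatives on an interval -/

/-- Smooth functions on `ℝ` with compact support in the open interval `(a, b)`. -/
structure IsTestFun (a b : ℝ) (ψ : ℝ → ℝ) : Prop where
  contDiff : ContDiff ℝ ∞ ψ
  hasCompactSupport : HasCompactSupport ψ
  tsupport_subset : tsupport ψ ⊆ Ioo a b

namespace IsTestFun

variable {a b : ℝ} {ψ : ℝ → ℝ}

theorem eq_zero (h : IsTestFun a b ψ) {t : ℝ} (ht : t ∉ Ioo a b) : ψ t = 0 :=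
  image_eq_zero_of_notMem_tsupport fun hc => ht (h.tsupport_subset hc)

theorem deriv_eq_zero (h : IsTestFun a b ψ) {t : ℝ} (ht : t ∉ Ioo a b) : deriv ψ t = 0 := by
  by_contra hc
  exact ht (h.tsupport_subset (support_deriv_subset hc))

theorem continuous (h : IsTestFun a b ψ) : Continuous ψ := h.contDiff.continuous

theorem continuous_deriv (h : IsTestFun a b ψ) : Continuous (deriv ψ) :=
  h.contDiff.continuous_deriv (by norm_num)

end IsTestFun

theorem exists_isTestFun_integral_eq_one {a b : ℝ} (hab : a < b) :
    ∃ θ, IsTestFun a b θ ∧ ∫ t in a..b, θ t = 1 := by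
  let f : ContDiffBump ((a + b) / 2) := ⟨(b - a) / 8, (b - a) / 4, by linarith, by linarith⟩
  have hsub : tsupport (f.normed volume) ⊆ Ioo a b := by
    rw [f.tsupport_normed_eq, Real.closedBall_eq_Icc]
    intro t ht
    have h1 := ht.1
    have h2 := ht.2
    simp only [f] at h1 h2
    constructor <;> linarith
  have hT : IsTestFun a b (f.normed volume) := ⟨f.contDiff_normed, f.hasCompactSupport_normed, hsub⟩
  refine ⟨_, hT, ?_⟩
  rw [← f.integral_normed (μ := volume), intervalIntegral.integral_of_le hab.le]
  refine setIntegral_eq_integral_of_forall_compl_eq_zero fun t ht => hT.eq_zero fun hc => ht ?_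
  exact Ioo_subset_Ioc_self hc

/-- To the right of the support of θ the primitive equals the full integral of θ, which vanishes. So
a test function of mean zero is the derivative of a test function. -/
theorem isTestFun_primitive {a b : ℝ} {θ : ℝ → ℝ} (hθ : IsTestFun a b θ)
    (h0 : ∫ t in a..b, θ t = 0) :
    IsTestFun a b (fun t => ∫ s in a..t, θ s) ∧ deriv (fun t => ∫ s in a..t, θ s) = θ := by
  have hd : ∀ t, HasDerivAt (fun t => ∫ s in a..t, θ s) (θ t) t := fun t =>
    hθ.continuous.integral_hasStrictDerivAt a t |>.hasDerivAt
  have hderiv : deriv (fun t => ∫ s in a..t, θ s) = θ := funext fun t => (hd t).deriv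
  have hC : ContDiff ℝ ∞ (fun t => ∫ s in a..t, θ s) := by
    rw [contDiff_infty_iff_deriv, hderiv]
    exact ⟨fun t => (hd t).differentiableAt, hθ.contDiff⟩
  obtain ⟨a', b', ha, hb, hK⟩ : ∃ a' b', a < a' ∧ b' < b ∧ tsupport θ ⊆ Icc a' b' := by
    rcases (tsupport θ).eq_empty_or_nonempty with he | hne
    · exact ⟨a + 1, b - 1, by linarith, by linarith, by rw [he]; exact empty_subset _⟩
    · have hc : IsCompact (tsupport θ) := hθ.hasCompactSupport
      refine ⟨sInf (tsupport θ), sSup (tsupport θ), ?_, ?_, fun t ht =>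
        ⟨csInf_le hc.bddBelow ht, le_csSup hc.bddAbove ht⟩⟩
      · exact (hθ.tsupport_subset (hc.sInf_mem hne)).1
      · exact (hθ.tsupport_subset (hc.sSup_mem hne)).2
  have hzero : ∀ t, t ∉ Icc a' b' → ∫ s in a..t, θ s = 0 := by
    intro t ht
    have hz : ∀ s, s ∉ Icc a' b' → θ s = 0 := fun s hs =>
      image_eq_zero_of_notMem_tsupport fun hc => hs (hK hc)
    rcases lt_or_ge t a' with hlt | hge
    · have : EqOn θ (fun _ => 0) (uIcc a t) := fun s hs => hz s fun hc => by
        have := (Set.mem_uIcc.1 hs)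
        rcases this with h | h <;> linarith [hc.1, h.2]
      rw [intervalIntegral.integral_congr this, intervalIntegral.integral_zero]
    · have hgt : b' < t := by
        by_contra hcon
        exact ht ⟨hge, not_lt.1 hcon⟩
      have : EqOn θ (fun _ => 0) (uIcc t b) := fun s hs => hz s fun hc => by
        have := (Set.mem_uIcc.1 hs)
        rcases this with h | h <;> linarith [hc.2, h.1]
      rw [← h0, ← intervalIntegral.integral_add_adjacent_intervals
        (hθ.continuous.intervalIntegrable a t) (hθ.continuous.intervalIntegrable t b),
        intervalIntegral.integral_congr this, intervalIntegral.integral_zero, add_zero]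
  have hts : tsupport (fun t => ∫ s in a..t, θ s) ⊆ Icc a' b' := by
    refine closure_minimal (fun t ht => ?_) isClosed_Icc
    by_contra hc
    exact ht (hzero t hc)
  refine ⟨⟨hC, ?_, fun t ht => ⟨ha.trans_le (hts ht).1, (hts ht).2.trans_lt hb⟩⟩, hderiv⟩
  exact isCompact_Icc.of_isClosed_subset (isClosed_tsupport _) hts

theorem IsTestFun.sub_smul {a b : ℝ} {θ θ₀ : ℝ → ℝ} (h : IsTestFun a b θ) (h₀ : IsTestFun a b θ₀)
    (c : ℝ) : IsTestFun a b (fun t => θ t - c * θ₀ t) := by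
  refine ⟨h.contDiff.sub (contDiff_const.mul h₀.contDiff), ?_, ?_⟩
  · exact h.hasCompactSupport.sub h₀.hasCompactSupport.mul_left
  · refine (closure_mono (t := Function.support θ ∪ Function.support θ₀) fun t ht => ?_).trans ?_
    · by_contra hc
      simp only [mem_union, Function.mem_support, not_or, not_not] at hc
      exact ht (by simp [hc.1, hc.2])
    · rw [closure_union]
      exact union_subset h.tsupport_subset h₀.tsupport_subset

/-- The lemma of du Bois-Reymond: a function with an integrable weak derivative is a primitive of
that derivative. -/
theorem exists_ae_eq_primitive {a b : ℝ} (hab : a < b) {U g : ℝ → ℝ}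
    (hU : IntervalIntegrable U volume a b) (hg : IntervalIntegrable g volume a b)
    (h : ∀ ψ, IsTestFun a b ψ → ∫ t in a..b, U t * deriv ψ t = -∫ t in a..b, g t * ψ t) :
    ∃ c, ∀ᵐ t : ℝ, t ∈ Ioo a b → U t = c + ∫ s in a..t, g s := by
  set G : ℝ → ℝ := fun t => ∫ s in a..t, g s with hG
  have hGac : AbsolutelyContinuousOnInterval G a b :=
    hg.absolutelyContinuousOnInterval_intervalIntegral (by simp)
  have hGint : IntervalIntegrable G volume a b := hGac.continuousOn.intervalIntegrable
  have hparts : ∀ ψ, IsTestFun a b ψ → ∫ t in a..b, G t * deriv ψ t = -∫ t in a..b, g t * ψ t := by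
    intro ψ hψ
    have hψac : AbsolutelyContinuousOnInterval ψ a b :=
      (hψ.contDiff.of_le (by norm_num : (1 : WithTop ℕ∞) ≤ ∞)).contDiffOn.absolutelyContinuousOnInterval
    rw [hGac.integral_mul_deriv_eq_deriv_mul hψac, hψ.eq_zero (by simp), hψ.eq_zero (by simp)]
    simp only [mul_zero, sub_zero, zero_sub, neg_inj]
    refine intervalIntegral.integral_congr_ae ?_
    filter_upwards [hg.ae_hasDerivAt_integral] with t ht htm
    rw [(ht (uIoc_subset_uIcc htm) a (by simp)).deriv]
  obtain ⟨θ₀, hθ₀, hθ₀1⟩ := exists_isTestFun_integral_eq_one hab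
  set w : ℝ → ℝ := fun t => U t - G t with hw
  have hwint : IntervalIntegrable w volume a b := hU.sub hGint
  set c := ∫ t in a..b, w t * θ₀ t with hc
  have hmulint : ∀ {f ψ : ℝ → ℝ}, IntervalIntegrable f volume a b → Continuous ψ →
      IntervalIntegrable (fun t => f t * ψ t) volume a b := fun hf hψ =>
    hf.mul_continuousOn hψ.continuousOn
  have hmain : ∀ θ, IsTestFun a b θ → ∫ t in a..b, θ t * (w t - c) = 0 := by
    intro θ hθ
    set I := ∫ t in a..b, θ t with hI
    -- Subtracting the mean of θ times θ₀ leaves a function of mean zero, hence the derivative of a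
    -- test function, against which w = U - G integrates to 0. What remains says that w equals c in
    -- the weak sense.
    have hT := hθ.sub_smul hθ₀ I
    have hi1 := hθ.continuous.intervalIntegrable (μ := volume) a b
    have hi2 := (hθ₀.continuous.intervalIntegrable (μ := volume) a b).const_mul I
    have hT0 : ∫ t in a..b, (θ t - I * θ₀ t) = 0 := by
      rw [intervalIntegral.integral_sub hi1 hi2, intervalIntegral.integral_const_mul, hθ₀1]
      ring
    obtain ⟨hP, hPd⟩ := isTestFun_primitive hT hT0
    have e1 := h _ hP
    have e2 := hparts _ hP
    rw [hPd] at e1 e2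
    have e3 : ∫ t in a..b, w t * (θ t - I * θ₀ t) = 0 := by
      simp only [hw, sub_mul]
      rw [intervalIntegral.integral_sub (hmulint hU hT.continuous) (hmulint hGint hT.continuous),
        e1, e2, sub_self]
    have e4 : ∫ t in a..b, w t * (θ t - I * θ₀ t) =
        (∫ t in a..b, w t * θ t) - I * c := by
      rw [hc, ← intervalIntegral.integral_const_mul, ← intervalIntegral.integral_sub
        (hmulint hwint hθ.continuous) ((hmulint hwint hθ₀.continuous).const_mul I)]
      refine intervalIntegral.integral_congr fun t _ => ?_
      ring
    have e5 : ∫ t in a..b, θ t * (w t - c) = (∫ t in a..b, w t * θ t) - I * c := by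
      rw [hI, ← intervalIntegral.integral_mul_const, ← intervalIntegral.integral_sub
        (hmulint hwint hθ.continuous) (hi1.mul_const c)]
      refine intervalIntegral.integral_congr fun t _ => ?_
      ring
    rw [e5, ← e4, e3]
  have hloc : LocallyIntegrableOn (fun t => w t - c) (Ioo a b) :=
    (((intervalIntegrable_iff_integrableOn_Ioc_of_le hab.le).1
      (hwint.sub (intervalIntegrable_const (c := c)))).mono_set Ioo_subset_Ioc_self).locallyIntegrableOn
  have hz := isOpen_Ioo.ae_eq_zero_of_integral_contDiff_smul_eq_zero hloc fun θ h1 h2 h3 => by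
    have hθ : IsTestFun a b θ := ⟨h1, h2, h3⟩
    rw [← hmain θ hθ, intervalIntegral.integral_of_le hab.le]
    refine (setIntegral_eq_integral_of_forall_compl_eq_zero fun t ht => ?_).symm
    rw [hθ.eq_zero fun hc => ht (Ioo_subset_Ioc_self hc), zero_smul]
  refine ⟨c, ?_⟩
  filter_upwards [hz] with t ht htm
  have := ht htm
  simp only [hw] at this
  linarith

/-- If `V' = f - N` with `N V ≥ 0`, then `|V|` grows at most by the integral of `|f|`. -/
theorem abs_primitive_le {a b c : ℝ} {V f N : ℝ → ℝ}
    (hf : IntervalIntegrable f volume a b) (hN : IntervalIntegrable N volume a b)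
    (hV : ∀ t ∈ Icc a b, V t = c + ∫ s in a..t, (f s - N s))
    (hNV : ∀ᵐ t : ℝ, t ∈ Ioo a b → 0 ≤ N t * V t) {t₁ t₂ : ℝ} (h1 : a ≤ t₁) (h12 : t₁ ≤ t₂)
    (h2 : t₂ ≤ b) : |V t₂| ≤ |V t₁| + ∫ s in t₁..t₂, |f s| := by
  have hab : a ≤ b := h1.trans (h12.trans h2)
  -- the case of a positive final value; the other one follows by changing signs
  have key : ∀ {c : ℝ} {V f N : ℝ → ℝ}, IntervalIntegrable f volume a b →
      IntervalIntegrable N volume a b → (∀ t ∈ Icc a b, V t = c + ∫ s in a..t, (f s - N s)) →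
      (∀ᵐ t : ℝ, t ∈ Ioo a b → 0 ≤ N t * V t) → 0 < V t₂ →
      V t₂ ≤ |V t₁| + ∫ s in t₁..t₂, |f s| := by
    intro c V f N hf hN hV hNV hpos
    have hsub : ∀ {f : ℝ → ℝ}, IntervalIntegrable f volume a b → ∀ {p q : ℝ}, a ≤ p → p ≤ q →
        q ≤ b → IntervalIntegrable f volume p q := fun hf p q hp hpq hq =>
      hf.mono_set (by rw [uIcc_of_le hpq, uIcc_of_le hab]; exact Icc_subset_Icc hp hq)
    have hcont : ContinuousOn V (Icc a b) := by
      have : ContinuousOn (fun t => c + ∫ s in a..t, (f s - N s)) (Icc a b) := by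
        have := ((hf.sub hN).absolutelyContinuousOnInterval_intervalIntegral
          (c := a) (by simp)).continuousOn
        rw [uIcc_of_le hab] at this
        exact continuousOn_const.add this
      exact this.congr hV
    -- The time p is the last one in [t₁, t₂] with V ≤ 0, or t₁ if there is none. After p the
    -- function V is positive, so N ≥ 0 almost everywhere there and N may be dropped.
    obtain ⟨p, hp1, hp2, hpV, hpos'⟩ : ∃ p, t₁ ≤ p ∧ p ≤ t₂ ∧ V p ≤ |V t₁| ∧
        ∀ t ∈ Ioc p t₂, 0 < V t := by
      set Z := {t ∈ Icc t₁ t₂ | V t ≤ 0} with hZ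
      rcases Z.eq_empty_or_nonempty with he | hne
      · refine ⟨t₁, le_rfl, h12, le_abs_self _, fun t ht => ?_⟩
        by_contra hc
        have : t ∈ Z := ⟨⟨ht.1.le, ht.2⟩, not_lt.1 hc⟩
        rw [he] at this
        exact this
      · have hZc : IsCompact Z := by
          have hcl : IsClosed (Icc t₁ t₂ ∩ V ⁻¹' Iic 0) :=
            (hcont.mono (Icc_subset_Icc h1 h2)).preimage_isClosed_of_isClosed isClosed_Icc
              isClosed_Iic
          exact isCompact_Icc.of_isClosed_subset hcl fun t ht => ht.1
        have hm := hZc.sSup_mem hne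
        refine ⟨sSup Z, hm.1.1, hm.1.2, hm.2.trans (abs_nonneg _), fun t ht => ?_⟩
        by_contra hc
        exact absurd (le_csSup hZc.bddAbove (show t ∈ Z from
          ⟨⟨hm.1.1.trans ht.1.le, ht.2⟩, not_lt.1 hc⟩)) (not_le.2 ht.1)
    have hfp := hsub hf (h1.trans hp1) hp2 h2
    have hNp := hsub hN (h1.trans hp1) hp2 h2
    have hdiff : V t₂ = V p + ∫ s in p..t₂, (f s - N s) := by
      rw [hV t₂ ⟨h1.trans h12, h2⟩, hV p ⟨h1.trans hp1, hp2.trans h2⟩, add_assoc,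
        intervalIntegral.integral_add_adjacent_intervals
          (hsub (hf.sub hN) le_rfl (h1.trans hp1) (hp2.trans h2)) (hfp.sub hNp)]
    have hle : ∫ s in p..t₂, (f s - N s) ≤ ∫ s in p..t₂, |f s| := by
      refine intervalIntegral.integral_mono_ae_restrict hp2 (hfp.sub hNp) hfp.abs ?_
      have hne : ∀ᵐ s : ℝ, s ≠ p ∧ s ≠ t₂ := by
        refine Filter.Eventually.and ?_ ?_ <;> simp [ae_iff]
      filter_upwards [ae_restrict_of_ae hNV, ae_restrict_mem measurableSet_Icc,
        ae_restrict_of_ae hne] with s hs hsm hsne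
      have hsp : p < s := lt_of_le_of_ne hsm.1 (Ne.symm hsne.1)
      have hst : s < t₂ := lt_of_le_of_ne hsm.2 hsne.2
      have := hs ⟨(h1.trans hp1).trans_lt hsp, hst.trans_le h2⟩
      have hN0 : 0 ≤ N s := nonneg_of_mul_nonneg_left this (hpos' s ⟨hsp, hst.le⟩)
      linarith [le_abs_self (f s)]
    have hmono : ∫ s in p..t₂, |f s| ≤ ∫ s in t₁..t₂, |f s| :=
      intervalIntegral.integral_mono_interval hp1 hp2 le_rfl
        (Eventually.of_forall fun s => abs_nonneg _) (hsub hf h1 h12 h2).abs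
    linarith
  rcases lt_trichotomy (V t₂) 0 with hneg | h0 | hpos
  · have := key (c := -c) (V := fun t => -V t) (f := fun t => -f t) (N := fun t => -N t)
      hf.neg hN.neg (fun t ht => by
        rw [hV t ht, neg_add, ← intervalIntegral.integral_neg]
        congr 1
        refine intervalIntegral.integral_congr fun s _ => ?_
        ring) (by
        filter_upwards [hNV] with t ht htm
        have := ht htm
        nlinarith) (neg_pos.2 hneg)
    simpa only [abs_neg, abs_of_neg hneg] using this
  · rw [h0, abs_zero]
    have : 0 ≤ ∫ s in t₁..t₂, |f s| :=
      intervalIntegral.integral_nonneg h12 fun s _ => abs_nonneg _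
    positivity
  · rw [abs_of_pos hpos]
    exact key hf hN hV hNV hpos

/-- A countable family of test functions that is dense in the `C¹` norm. -/
theorem exists_countable_testFun (a b : ℝ) :
    ∃ S : Set (ℝ → ℝ), S.Countable ∧ (∀ ψ ∈ S, IsTestFun a b ψ) ∧
      ∀ ψ, IsTestFun a b ψ → ∀ ε, 0 < ε → ∃ ψ' ∈ S, ∀ t ∈ Icc a b,
        |ψ t - ψ' t| ≤ ε ∧ |deriv ψ t - deriv ψ' t| ≤ ε := by
  let X := C(Icc a b, ℝ) × C(Icc a b, ℝ)
  let J : {ψ // IsTestFun a b ψ} → X := fun ψ =>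
    (⟨fun t => ψ.1 t, ψ.2.continuous.comp continuous_subtype_val⟩,
      ⟨fun t => deriv ψ.1 t, ψ.2.continuous_deriv.comp continuous_subtype_val⟩)
  -- The pairs (ψ, ψ') form a subset of a separable metric space, hence a separable set.
  obtain ⟨D, hDc, hDd⟩ := TopologicalSpace.exists_countable_dense (range J)
  choose P hP using fun d : range J => d.2
  refine ⟨(fun d => (P d).1) '' D, hDc.image _, ?_, fun ψ hψ ε hε => ?_⟩
  · rintro _ ⟨d, -, rfl⟩
    exact (P d).2
  · obtain ⟨d, hd, hdist⟩ := Metric.mem_closure_iff.1 (hDd ⟨J ⟨ψ, hψ⟩, mem_range_self _⟩) ε hε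
    refine ⟨(P d).1, ⟨d, hd, rfl⟩, fun t ht => ?_⟩
    have h1 : dist (J ⟨ψ, hψ⟩) (J (P d)) < ε := by rw [hP d]; exact hdist
    have h2 := (ContinuousMap.dist_apply_le_dist (f := (J ⟨ψ, hψ⟩).1) (g := (J (P d)).1)
      ⟨t, ht⟩).trans ((le_max_left _ _).trans h1.le)
    have h3 := (ContinuousMap.dist_apply_le_dist (f := (J ⟨ψ, hψ⟩).2) (g := (J (P d)).2)
      ⟨t, ht⟩).trans ((le_max_right _ _).trans h1.le)
    exact ⟨h2, h3⟩

end

noncomputable section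

open scoped NNReal ENNReal

/-! ### The free transport flow -/

/-- The free transport flow `(t, (y, v)) ↦ (t, (y + t v, v))`. -/
def freeFlow : (ℝ × (E3 × E3)) ≃ₜ (ℝ × (E3 × E3)) where
  toFun z := (z.1, (z.2.1 + z.1 • z.2.2, z.2.2))
  invFun z := (z.1, (z.2.1 - z.1 • z.2.2, z.2.2))
  left_inv z := by simp
  right_inv z := by simp
  continuous_toFun := by fun_prop
  continuous_invFun := by fun_prop

theorem measurePreserving_shear (t : ℝ) :
    MeasurePreserving (fun q : E3 × E3 => (q.1 + t • q.2, q.2)) volume volume := by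
  have h1 : MeasurePreserving (fun p : E3 × E3 => (p.1, p.2 + t • p.1))
      (volume.prod volume) (volume.prod volume) :=
    (MeasurePreserving.id volume).skew_product (g := fun v y : E3 => y + t • v) (by fun_prop)
      (Eventually.of_forall fun v => (measurePreserving_add_right volume (t • v)).map_eq)
  exact (Measure.measurePreserving_swap.comp h1).comp Measure.measurePreserving_swap

theorem measurePreserving_freeFlow : MeasurePreserving freeFlow volume volume :=
  (MeasurePreserving.id volume).skew_product
    (g := fun (t : ℝ) (q : E3 × E3) => (q.1 + t • q.2, q.2)) (by fun_prop)
    (Eventually.of_forall fun t => (measurePreserving_shear t).map_eq)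

/-- `F` along the free trajectory of `q`, extended by zero to negative times. -/
def along (F : ℝ → E3 × E3 → ℝ) (q : E3 × E3) (t : ℝ) : ℝ :=
  if t < 0 then 0 else F t (q.1 + t • q.2, q.2)

theorem along_eq_indicator (F : ℝ → E3 × E3 → ℝ) (z : ℝ × (E3 × E3)) :
    along F z.2 z.1 =
      (Ici (0 : ℝ) ×ˢ (univ : Set (E3 × E3))).indicator (Function.uncurry F ∘ freeFlow) z := by
  rw [along]
  split_ifs with h
  · rw [indicator_of_notMem]
    exact fun hc => absurd hc.1 (not_le.2 h)
  · rw [indicator_of_mem (show z ∈ Ici (0 : ℝ) ×ˢ univ from ⟨not_lt.1 h, mem_univ _⟩)]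
    rfl

theorem integrableOn_along {F : ℝ → E3 × E3 → ℝ} {J : Set ℝ} {K : Set (E3 × E3)}
    (h : IntegrableOn (Function.uncurry F) (freeFlow '' ((J ∩ Ici 0) ×ˢ K))) :
    IntegrableOn (fun z : ℝ × (E3 × E3) => along F z.2 z.1) (J ×ˢ K) := by
  have h1 : IntegrableOn (Function.uncurry F ∘ freeFlow) ((J ∩ Ici 0) ×ˢ K) :=
    (measurePreserving_freeFlow.integrableOn_image freeFlow.measurableEmbedding).1 h
  have e : (fun z : ℝ × (E3 × E3) => along F z.2 z.1) =
      (Ici (0 : ℝ) ×ˢ (univ : Set (E3 × E3))).indicator (Function.uncurry F ∘ freeFlow) :=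
    funext (along_eq_indicator F)
  have hm : MeasurableSet (Ici (0 : ℝ) ×ˢ (univ : Set (E3 × E3))) :=
    measurableSet_Ici.prod MeasurableSet.univ
  rw [e, IntegrableOn, integrable_indicator_iff hm, IntegrableOn, Measure.restrict_restrict hm,
    prod_inter_prod, univ_inter, inter_comm]
  exact h1

variable {Ω : Set E3} {T : ℝ}

theorem bulkTimeMeasure_eq (Ω : Set E3) (T : ℝ) :
    bulkTimeMeasure Ω T = volume.restrict (Icc 0 T ×ˢ phase Ω) := by
  rw [bulkTimeMeasure, timeMeasure, Measure.prod_restrict]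
  rfl

theorem measurableSet_phase (ho : IsOpen Ω) : MeasurableSet (phase Ω) :=
  ho.measurableSet.prod MeasurableSet.univ

/-- A box of free trajectories that stay in `Ω` during the time interval `[a, b]`. -/
structure IsFlowBox (Ω : Set E3) (T a b : ℝ) (K B : Set (E3 × E3)) : Prop where
  lt : a < b
  lt_time : b < T
  isCompact : IsCompact K
  isOpen : IsOpen B
  subset : B ⊆ K
  mem : ∀ t ∈ Icc a b, ∀ q ∈ K, q.1 + t • q.2 ∈ Ω

namespace IsFlowBox

variable {a b : ℝ} {K B : Set (E3 × E3)}

theorem image_subset (hX : IsFlowBox Ω T a b K B) :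
    freeFlow '' ((Ioc a b ∩ Ici 0) ×ˢ K) ⊆ Icc 0 T ×ˢ phase Ω := by
  rintro _ ⟨⟨t, q⟩, ⟨⟨ht, ht0⟩, hq⟩, rfl⟩
  exact ⟨⟨ht0, ht.2.trans hX.lt_time.le⟩, hX.mem t (Ioc_subset_Icc_self ht) q hq, mem_univ _⟩

/-- Free transport preserves dt dx dv, so an integral over phase space becomes an integral over base
points and times in the box. The box may extend to negative times, where `along` is 0. -/
theorem integral_eq (hX : IsFlowBox Ω T a b K B) (ho : IsOpen Ω) {F : ℝ → E3 × E3 → ℝ}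
    (hF : ∀ t q, (t ∉ Ioc a b ∨ q ∉ K) → F t (q.1 + t • q.2, q.2) = 0) :
    ∫ z, F z.1 z.2 ∂(bulkTimeMeasure Ω T) = ∫ z in Ioc a b ×ˢ K, along F z.2 z.1 := by
  have hm : MeasurableSet (Ici (0 : ℝ) ×ˢ (univ : Set (E3 × E3))) :=
    measurableSet_Ici.prod MeasurableSet.univ
  have e : (fun z : ℝ × (E3 × E3) => along F z.2 z.1) =
      (Ici (0 : ℝ) ×ˢ (univ : Set (E3 × E3))).indicator (Function.uncurry F ∘ freeFlow) :=
    funext (along_eq_indicator F)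
  rw [e, setIntegral_indicator hm, prod_inter_prod, inter_univ, bulkTimeMeasure_eq]
  rw [show (∫ z in (Ioc a b ∩ Ici 0) ×ˢ K, (Function.uncurry F ∘ freeFlow) z) =
    ∫ z in freeFlow '' ((Ioc a b ∩ Ici 0) ×ˢ K), Function.uncurry F z from
      (measurePreserving_freeFlow.setIntegral_image_emb freeFlow.measurableEmbedding _ _).symm]
  refine setIntegral_eq_of_subset_of_forall_sdiff_eq_zero
    (measurableSet_Icc.prod (measurableSet_phase ho)) hX.image_subset fun z hz => ?_
  obtain ⟨w, rfl⟩ := freeFlow.surjective z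
  refine hF w.1 w.2 ?_
  by_contra hc
  push Not at hc
  exact hz.2 ⟨w, ⟨⟨hc.1, hz.1.1.1⟩, hc.2⟩, rfl⟩

end IsFlowBox

/-- The test function `ψ(t) χ(x - t v, v)`, transported along free trajectories. -/
def flowTest (ψ : ℝ → ℝ) (χ : E3 × E3 → ℝ) (z : ℝ × (E3 × E3)) : ℝ :=
  ψ z.1 * χ (z.2.1 - z.1 • z.2.2, z.2.2)

theorem contDiff_flowTest {ψ : ℝ → ℝ} {χ : E3 × E3 → ℝ} (hψ : ContDiff ℝ ∞ ψ)
    (hχ : ContDiff ℝ ∞ χ) : ContDiff ℝ ∞ (flowTest ψ χ) := by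
  unfold flowTest
  exact (hψ.comp contDiff_fst).mul (hχ.comp (by fun_prop))

/-- The factor χ(x - t v, v) is constant along free trajectories, so the transport derivative falls
on ψ alone. -/
theorem transport_flowTest {ψ : ℝ → ℝ} {χ : E3 × E3 → ℝ} (hψ : ContDiff ℝ ∞ ψ)
    (hχ : ContDiff ℝ ∞ χ) (t : ℝ) (q : E3 × E3) :
    transport (flowTest ψ χ) (t, (q.1 + t • q.2, q.2)) = deriv ψ t * χ q := by
  have hd : DifferentiableAt ℝ (flowTest ψ χ) (t, (q.1 + t • q.2, q.2)) :=
    (contDiff_flowTest hψ hχ).differentiable (by norm_num) _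
  have hγ : HasDerivAt (fun s : ℝ => ((s, (q.1 + s • q.2, q.2)) : ℝ × (E3 × E3)))
      (1, (q.2, 0)) t := by
    refine (hasDerivAt_id t).prodMk (HasDerivAt.prodMk ?_ (hasDerivAt_const t q.2))
    simpa using ((hasDerivAt_id t).smul_const q.2).const_add q.1
  have h1 := hd.hasFDerivAt.comp_hasDerivAt t hγ
  have h2 : HasDerivAt (fun s => ψ s * χ q) (deriv ψ t * χ q) t :=
    ((hψ.differentiable (by norm_num)) t).hasDerivAt.mul_const _
  have e : (flowTest ψ χ ∘ fun s : ℝ => ((s, (q.1 + s • q.2, q.2)) : ℝ × (E3 × E3))) =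
      fun s => ψ s * χ q := by
    funext s
    simp [flowTest]
  rw [e] at h1
  exact h1.unique h2

theorem tsupport_flowTest_subset {ψ : ℝ → ℝ} {χ : E3 × E3 → ℝ} (hψ : HasCompactSupport ψ)
    (hχ : HasCompactSupport χ) :
    tsupport (flowTest ψ χ) ⊆ freeFlow '' (tsupport ψ ×ˢ tsupport χ) := by
  have hc : IsCompact (freeFlow '' (tsupport ψ ×ˢ tsupport χ)) :=
    (IsCompact.prod hψ hχ).image freeFlow.continuous
  refine closure_minimal (fun z hz => ?_) hc.isClosed
  have hz' := mul_ne_zero_iff.1 hz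
  exact ⟨freeFlow.symm z, ⟨subset_tsupport _ hz'.1, subset_tsupport _ hz'.2⟩,
    freeFlow.apply_symm_apply z⟩

theorem hasCompactSupport_flowTest {ψ : ℝ → ℝ} {χ : E3 × E3 → ℝ} (hψ : HasCompactSupport ψ)
    (hχ : HasCompactSupport χ) : HasCompactSupport (flowTest ψ χ) :=
  ((IsCompact.prod hψ hχ).image freeFlow.continuous).of_isClosed_subset (isClosed_tsupport _)
    (tsupport_flowTest_subset hψ hχ)

theorem MemLinftyL1.integrable {h : ℝ → E3 × E3 → ℝ} (hh : MemLinftyL1 Ω T h) :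
    Integrable (Function.uncurry h) (bulkTimeMeasure Ω T) := by
  obtain ⟨M, hM⟩ := hh.bounded
  have hmeas := hh.aestronglyMeasurable
  rw [bulkTimeMeasure] at hmeas ⊢
  rw [integrable_prod_iff hmeas]
  refine ⟨hM.mono fun t ht => ht.1, ?_⟩
  have hfin : IsFiniteMeasure (timeMeasure T) := by
    unfold timeMeasure
    infer_instance
  refine Integrable.mono' (integrable_const M) hmeas.norm.integral_prod_right' ?_
  filter_upwards [hM] with t ht
  rw [Real.norm_of_nonneg (integral_nonneg fun _ => norm_nonneg _)]
  exact ht.2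

end

/-! ### The weak equation along trajectories in a box -/

noncomputable section

variable {Ω : Set E3} {T : ℝ}

/-- The constant extension to negative times produces exactly the term c ψ(0) of the initial datum,
so the extended solution satisfies a weak equation on all of (a, b), also across time 0. -/
theorem integral_neg_time_deriv {a b : ℝ} (hab : a ≤ b) {ψ : ℝ → ℝ} (hψ : IsTestFun a b ψ) (c : ℝ) :
    ∫ t in a..b, (if t < 0 then c else 0) * deriv ψ t = c * ψ 0 := by
  have h1 := HasCompactSupport.integral_Iic_deriv_eq
    (hψ.contDiff.of_le (by norm_num : (1 : WithTop ℕ∞) ≤ ∞)) hψ.hasCompactSupport 0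
  have e : (fun t => (if t < 0 then c else 0) * deriv ψ t) =
      (Iio (0 : ℝ)).indicator (fun t => c * deriv ψ t) := by
    funext t
    by_cases ht : t < 0
    · rw [if_pos ht, indicator_of_mem (show t ∈ Iio 0 from ht)]
    · rw [if_neg ht, indicator_of_notMem (show t ∉ Iio 0 from ht), zero_mul]
  rw [intervalIntegral.integral_of_le hab, setIntegral_eq_integral_of_forall_compl_eq_zero, e,
    integral_indicator measurableSet_Iio, integral_const_mul, ← integral_Iic_eq_integral_Iio, h1]
  intro t ht
  rw [hψ.deriv_eq_zero fun hc => ht (Ioo_subset_Ioc_self hc), mul_zero]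

/-- The solution along the free trajectory of `q`, equal to the initial datum for negative times. -/
def solAlong (h : ℝ → E3 × E3 → ℝ) (h₀ : E3 × E3 → ℝ) (q : E3 × E3) (t : ℝ) : ℝ :=
  if t < 0 then h₀ q else h t (q.1 + t • q.2, q.2)

theorem solAlong_eq (h : ℝ → E3 × E3 → ℝ) (h₀ : E3 × E3 → ℝ) (q : E3 × E3) (t : ℝ) :
    solAlong h h₀ q t = along h q t + if t < 0 then h₀ q else 0 := by
  rw [solAlong, along]
  split_ifs <;> simp

/-- The residual of the transport equation along the trajectory of `q`, tested with `ψ`. -/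
def residual (ν H h : ℝ → E3 × E3 → ℝ) (h₀ : E3 × E3 → ℝ) (a b : ℝ) (ψ : ℝ → ℝ) (q : E3 × E3) : ℝ :=
  (∫ t in Ioc a b, (-(along h q t * deriv ψ t) + along (fun t p => ν t p * h t p) q t * ψ t -
    along H q t * ψ t)) - ψ 0 * h₀ q

section Box

variable {ν H h : ℝ → E3 × E3 → ℝ} {h₀ : E3 × E3 → ℝ} {a b : ℝ} {K B : Set (E3 × E3)}

theorem IsFlowBox.integrableOn_along (hX : IsFlowBox Ω T a b K B) {F : ℝ → E3 × E3 → ℝ}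
    (hF : Integrable (Function.uncurry F) (bulkTimeMeasure Ω T)) :
    IntegrableOn (fun z : ℝ × (E3 × E3) => along F z.2 z.1) (Ioc a b ×ˢ K) := by
  rw [bulkTimeMeasure_eq] at hF
  exact KineticTrace.integrableOn_along (IntegrableOn.mono_set hF hX.image_subset)

theorem IsFlowBox.integrableOn_along_mul (hX : IsFlowBox Ω T a b K B)
    (hw : IsWeakSolution Ω T ν H h₀ h) :
    IntegrableOn (fun z : ℝ × (E3 × E3) => along (fun t p => ν t p * h t p) z.2 z.1)
      (Ioc a b ×ˢ K) := by
  refine KineticTrace.integrableOn_along ?_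
  have hc : IsCompact (freeFlow '' ((Icc a b ∩ Ici 0) ×ˢ K)) :=
    (((isCompact_Icc.inter_right isClosed_Ici).prod hX.isCompact).image freeFlow.continuous)
  have hsub : freeFlow '' ((Icc a b ∩ Ici 0) ×ˢ K) ⊆ Ico 0 T ×ˢ phase Ω := by
    rintro _ ⟨⟨t, q⟩, ⟨⟨ht, ht0⟩, hq⟩, rfl⟩
    exact ⟨⟨ht0, ht.2.trans_lt hX.lt_time⟩, hX.mem t ht q hq, mem_univ _⟩
  have := hw.locallyIntegrable.integrableOn_compact_subset hsub hc
  refine this.mono_set (image_mono ?_)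
  exact prod_mono (inter_subset_inter_left _ Ioc_subset_Icc_self) subset_rfl

theorem integrableOn_mul_bdd {f : ℝ × (E3 × E3) → ℝ} {S : Set (ℝ × (E3 × E3))}
    (hf : IntegrableOn f S) {ψ : ℝ → ℝ} (hψ : Continuous ψ) (hψc : HasCompactSupport ψ) :
    IntegrableOn (fun z => f z * ψ z.1) S := by
  obtain ⟨C, hC⟩ := hψ.bounded_above_of_compact_support hψc
  exact hf.mul_bdd (hψ.comp continuous_fst).aestronglyMeasurable
    (Eventually.of_forall fun z => hC z.1)

/-- Testing the equation with ψ(t)χ(x - t v, v) and using Fubini shows that the residual is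
orthogonal to every smooth χ supported in the open set B. -/
theorem IsFlowBox.residual_ae_eq_zero (hX : IsFlowBox Ω T a b K B) (ho : IsOpen Ω)
    (hh : Integrable (Function.uncurry h) (bulkTimeMeasure Ω T))
    (hH : Integrable (Function.uncurry H) (bulkTimeMeasure Ω T))
    (hh₀ : IntegrableOn h₀ (phase Ω)) (hw : IsWeakSolution Ω T ν H h₀ h) {ψ : ℝ → ℝ}
    (hψ : IsTestFun a b ψ) : ∀ᵐ q, q ∈ B → residual ν H h h₀ a b ψ q = 0 := by
  have ih := hX.integrableOn_along hh
  have iH := hX.integrableOn_along hH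
  have iN := hX.integrableOn_along_mul hw
  have hψ'c : HasCompactSupport (deriv ψ) := hψ.hasCompactSupport.deriv
  have i1 : IntegrableOn (fun z : ℝ × (E3 × E3) => -(along h z.2 z.1 * deriv ψ z.1) +
      along (fun t p => ν t p * h t p) z.2 z.1 * ψ z.1) (Ioc a b ×ˢ K) :=
    (integrableOn_mul_bdd ih hψ.continuous_deriv hψ'c).neg.add
    (integrableOn_mul_bdd iN hψ.continuous hψ.hasCompactSupport)
  have i2 := integrableOn_mul_bdd iH hψ.continuous hψ.hasCompactSupport
  have i12 : IntegrableOn (fun z : ℝ × (E3 × E3) => -(along h z.2 z.1 * deriv ψ z.1) +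
      along (fun t p => ν t p * h t p) z.2 z.1 * ψ z.1 - along H z.2 z.1 * ψ z.1)
      (Ioc a b ×ˢ K) := i1.sub i2
  -- The base points are positions at time 0. They are known to lie in Ω only if 0 belongs to the
  -- time interval of the box; otherwise ψ(0) = 0 and h₀ does not enter.
  have hKphase : ψ 0 ≠ 0 → K ⊆ phase Ω := by
    intro h0 q hq
    have : (0 : ℝ) ∈ Ioo a b := by
      by_contra hc
      exact h0 (hψ.eq_zero hc)
    have := hX.mem 0 (Ioo_subset_Icc_self this) q hq
    rw [zero_smul, add_zero] at this
    exact ⟨this, mem_univ _⟩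
  have i0 : IntegrableOn (fun q => ψ 0 * h₀ q) K := by
    by_cases h0 : ψ 0 = 0
    · simp [h0]
    · exact (hh₀.mono_set (hKphase h0)).const_mul _
  have hprod : ∀ f : ℝ × (E3 × E3) → ℝ, IntegrableOn f (Ioc a b ×ˢ K) →
      Integrable f ((volume.restrict (Ioc a b)).prod (volume.restrict K)) := by
    intro f hf
    rw [Measure.prod_restrict]
    exact hf
  have ires : IntegrableOn (residual ν H h h₀ a b ψ) K :=
    (hprod _ i12).integral_prod_right.sub i0
  have hBm := hX.isOpen.measurableSet
  refine hX.isOpen.ae_eq_zero_of_integral_contDiff_smul_eq_zero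
    (ires.mono_set hX.subset).locallyIntegrableOn fun χ hχ hχc hχs => ?_
  have hχ0 : ∀ q, q ∉ K → χ q = 0 := fun q hq =>
    image_eq_zero_of_notMem_tsupport fun hc => hq (hX.subset (hχs hc))
  have hφs : tsupport (flowTest ψ χ) ⊆ Iio T ×ˢ phase Ω := by
    refine (tsupport_flowTest_subset hψ.hasCompactSupport hχc).trans ?_
    rintro _ ⟨⟨t, q⟩, ⟨ht, hq⟩, rfl⟩
    have ht' := hψ.tsupport_subset ht
    exact ⟨ht'.2.trans hX.lt_time, hX.mem t (Ioo_subset_Icc_self ht') q (hX.subset (hχs hq)),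
      mem_univ _⟩
  have hweak := hw.weak_eq _ (contDiff_flowTest hψ.contDiff hχ)
    (hasCompactSupport_flowTest hψ.hasCompactSupport hχc) hφs
  have hft : ∀ t (q : E3 × E3), flowTest ψ χ (t, (q.1 + t • q.2, q.2)) = ψ t * χ q := by
    intro t q
    simp [flowTest]
  have hzero : ∀ t q, (t ∉ Ioc a b ∨ q ∉ K) → ψ t * χ q = 0 ∧ deriv ψ t * χ q = 0 := by
    rintro t q (ht | hq)
    · have ht' : t ∉ Ioo a b := fun hc => ht (Ioo_subset_Ioc_self hc)
      rw [hψ.eq_zero ht', hψ.deriv_eq_zero ht', zero_mul]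
      exact ⟨rfl, rfl⟩
    · rw [hχ0 q hq, mul_zero, mul_zero]
      exact ⟨rfl, rfl⟩
  have e1 := hX.integral_eq ho (F := fun t p => -(h t p * transport (flowTest ψ χ) (t, p)) +
      ν t p * h t p * flowTest ψ χ (t, p)) (by
    intro t q htq
    obtain ⟨z1, z2⟩ := hzero t q htq
    beta_reduce
    rw [transport_flowTest hψ.contDiff hχ, hft, z1, z2]
    ring)
  have e2 := hX.integral_eq ho (F := fun t p => H t p * flowTest ψ χ (t, p)) (by
    intro t q htq
    beta_reduce
    rw [hft, (hzero t q htq).1, mul_zero])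
  have e3 : ∫ p in phase Ω, h₀ p * flowTest ψ χ (0, p) = ∫ q in K, χ q * (ψ 0 * h₀ q) := by
    by_cases h0 : ψ 0 = 0
    · simp [flowTest, h0]
    · rw [setIntegral_eq_of_subset_of_forall_sdiff_eq_zero (measurableSet_phase ho) (hKphase h0)]
      · refine integral_congr_ae (Eventually.of_forall fun q => ?_)
        simp only [flowTest, zero_smul, sub_zero]
        ring
      · intro q hq
        simp [flowTest, hχ0 q hq.2]
  have f1 : ∀ z : ℝ × (E3 × E3), along (fun t p => -(h t p * transport (flowTest ψ χ) (t, p)) +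
      ν t p * h t p * flowTest ψ χ (t, p)) z.2 z.1 = χ z.2 * (-(along h z.2 z.1 * deriv ψ z.1) +
        along (fun t p => ν t p * h t p) z.2 z.1 * ψ z.1) := by
    intro z
    simp only [along]
    split_ifs
    · ring
    · rw [transport_flowTest hψ.contDiff hχ, hft]
      ring
  have f2 : ∀ z : ℝ × (E3 × E3), along (fun t p => H t p * flowTest ψ χ (t, p)) z.2 z.1 =
      χ z.2 * (along H z.2 z.1 * ψ z.1) := by
    intro z
    simp only [along]
    split_ifs
    · ring
    · rw [hft]
      ring
  simp_rw [f1] at e1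
  simp_rw [f2] at e2
  rw [e1, e2, e3] at hweak
  obtain ⟨C, hC⟩ := hχ.continuous.bounded_above_of_compact_support hχc
  have j : ∀ f : ℝ × (E3 × E3) → ℝ, IntegrableOn f (Ioc a b ×ˢ K) →
      IntegrableOn (fun z => χ z.2 * f z) (Ioc a b ×ˢ K) := fun f hf =>
    hf.bdd_mul (hχ.continuous.comp continuous_snd).aestronglyMeasurable
      (Eventually.of_forall fun z => hC z.2)
  have jK : ∀ f : E3 × E3 → ℝ, IntegrableOn f K → IntegrableOn (fun q => χ q * f q) K :=
    fun f hf => hf.bdd_mul hχ.continuous.aestronglyMeasurable (Eventually.of_forall hC)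
  have hfub : ∀ f : ℝ × (E3 × E3) → ℝ, IntegrableOn f (Ioc a b ×ˢ K) →
      ∫ z in Ioc a b ×ˢ K, χ z.2 * f z = ∫ q in K, χ q * ∫ t in Ioc a b, f (t, q) := by
    intro f hf
    have := integral_prod_symm _ (hprod _ (j f hf))
    rw [Measure.prod_restrict] at this
    refine this.trans (integral_congr_ae (Eventually.of_forall fun q => ?_))
    exact integral_const_mul (χ q) (fun t => f (t, q))
  have e4 : ∫ q, χ q • residual ν H h h₀ a b ψ q = ∫ q in K, χ q * residual ν H h h₀ a b ψ q := by
    refine (setIntegral_eq_integral_of_forall_compl_eq_zero fun q hq => ?_).symm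
    rw [hχ0 q hq, zero_smul]
  have e5 : ∫ q in K, χ q * residual ν H h h₀ a b ψ q =
      (∫ z in Ioc a b ×ˢ K, χ z.2 * ((-(along h z.2 z.1 * deriv ψ z.1) +
        along (fun t p => ν t p * h t p) z.2 z.1 * ψ z.1) - along H z.2 z.1 * ψ z.1)) -
      ∫ q in K, χ q * (ψ 0 * h₀ q) := by
    rw [hfub _ i12, ← integral_sub]
    · refine integral_congr_ae (Eventually.of_forall fun q => ?_)
      simp only [residual]
      ring
    · exact jK _ (hprod _ i12).integral_prod_right
    · exact jK _ i0
  have e6 : ∫ z in Ioc a b ×ˢ K, χ z.2 * ((-(along h z.2 z.1 * deriv ψ z.1) +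
        along (fun t p => ν t p * h t p) z.2 z.1 * ψ z.1) - along H z.2 z.1 * ψ z.1) =
      (∫ z in Ioc a b ×ˢ K, χ z.2 * (-(along h z.2 z.1 * deriv ψ z.1) +
        along (fun t p => ν t p * h t p) z.2 z.1 * ψ z.1)) -
      ∫ z in Ioc a b ×ˢ K, χ z.2 * (along H z.2 z.1 * ψ z.1) := by
    rw [← integral_sub (j _ i1) (j _ i2)]
    refine integral_congr_ae (Eventually.of_forall fun z => ?_)
    ring
  rw [e4, e5, e6, hweak]
  ring

/-- The residual at a fixed q depends continuously on ψ in the C¹ norm. This lets one null set of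
base points serve all test functions. -/
theorem residual_sub_le {ψ ψ' : ℝ → ℝ} (hψ : IsTestFun a b ψ) (hψ' : IsTestFun a b ψ')
    {q : E3 × E3} (ih : IntegrableOn (along h q) (Ioc a b)) (iH : IntegrableOn (along H q) (Ioc a b))
    (iN : IntegrableOn (along (fun t p => ν t p * h t p) q) (Ioc a b)) {ε : ℝ} (hε : 0 ≤ ε)
    (hd : ∀ t ∈ Icc a b, |ψ t - ψ' t| ≤ ε ∧ |deriv ψ t - deriv ψ' t| ≤ ε) :
    |residual ν H h h₀ a b ψ q - residual ν H h h₀ a b ψ' q| ≤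
      ε * ((∫ t in Ioc a b, (|along h q t| + |along (fun t p => ν t p * h t p) q t| +
        |along H q t|)) + |h₀ q|) := by
  have m : ∀ {f φ : ℝ → ℝ}, IntegrableOn f (Ioc a b) → Continuous φ → HasCompactSupport φ →
      IntegrableOn (fun t => f t * φ t) (Ioc a b) := by
    intro f φ hf hφ hφc
    obtain ⟨C, hC⟩ := hφ.bounded_above_of_compact_support hφc
    exact hf.mul_bdd hφ.aestronglyMeasurable (Eventually.of_forall hC)
  have hI : ∀ {φ : ℝ → ℝ}, IsTestFun a b φ → IntegrableOn (fun t => -(along h q t * deriv φ t) +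
      along (fun t p => ν t p * h t p) q t * φ t - along H q t * φ t) (Ioc a b) := fun hφ =>
    ((m ih hφ.continuous_deriv hφ.hasCompactSupport.deriv).neg.add
      (m iN hφ.continuous hφ.hasCompactSupport)).sub (m iH hφ.continuous hφ.hasCompactSupport)
  have h0 : |ψ 0 - ψ' 0| ≤ ε := by
    by_cases hm : (0 : ℝ) ∈ Ioo a b
    · exact (hd 0 (Ioo_subset_Icc_self hm)).1
    · rw [hψ.eq_zero hm, hψ'.eq_zero hm, sub_self, abs_zero]
      exact hε
  have e : residual ν H h h₀ a b ψ q - residual ν H h h₀ a b ψ' q =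
      (∫ t in Ioc a b, (-(along h q t * (deriv ψ t - deriv ψ' t)) +
        along (fun t p => ν t p * h t p) q t * (ψ t - ψ' t) - along H q t * (ψ t - ψ' t))) -
        (ψ 0 - ψ' 0) * h₀ q := by
    rw [residual, residual, sub_sub_sub_comm, ← integral_sub (hI hψ) (hI hψ'), ← sub_mul]
    congr 1
    refine integral_congr_ae (Eventually.of_forall fun t => ?_)
    ring
  rw [e]
  have hg : IntegrableOn (fun t => |along h q t| + |along (fun t p => ν t p * h t p) q t| +
        |along H q t|) (Ioc a b) := (ih.abs.add iN.abs).add iH.abs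
  have h1 : |∫ t in Ioc a b, (-(along h q t * (deriv ψ t - deriv ψ' t)) +
        along (fun t p => ν t p * h t p) q t * (ψ t - ψ' t) - along H q t * (ψ t - ψ' t))| ≤
      ε * ∫ t in Ioc a b, (|along h q t| + |along (fun t p => ν t p * h t p) q t| +
        |along H q t|) := by
    rw [← integral_const_mul, ← Real.norm_eq_abs]
    refine norm_integral_le_of_norm_le (hg.const_mul ε) ?_
    filter_upwards [ae_restrict_mem measurableSet_Ioc] with t ht
    obtain ⟨d1, d2⟩ := hd t (Ioc_subset_Icc_self ht)
    rw [Real.norm_eq_abs]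
    refine (abs_sub _ _).trans ((add_le_add_left (abs_add_le _ _) _).trans ?_)
    rw [abs_neg, abs_mul, abs_mul, abs_mul, mul_add, mul_add]
    have p1 := mul_le_mul_of_nonneg_left d2 (abs_nonneg (along h q t))
    have p2 := mul_le_mul_of_nonneg_left d1 (abs_nonneg (along (fun t p => ν t p * h t p) q t))
    have p3 := mul_le_mul_of_nonneg_left d1 (abs_nonneg (along H q t))
    linarith
  refine (abs_sub _ _).trans ?_
  rw [mul_add, abs_mul]
  have := mul_le_mul_of_nonneg_right h0 (abs_nonneg (h₀ q))
  linarith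

/-- On a box, almost every trajectory carries a continuous representative of the solution whose
absolute value grows at most by the integral of the source. -/
theorem IsFlowBox.ae_exists_representative (hX : IsFlowBox Ω T a b K B) (ho : IsOpen Ω)
    (hν : ∀ t ∈ Icc 0 T, ∀ p ∈ phase Ω, 0 ≤ ν t p)
    (hh : Integrable (Function.uncurry h) (bulkTimeMeasure Ω T))
    (hH : Integrable (Function.uncurry H) (bulkTimeMeasure Ω T))
    (hh₀ : IntegrableOn h₀ (phase Ω)) (hw : IsWeakSolution Ω T ν H h₀ h) :
    ∀ᵐ q, q ∈ B → ∃ V : ℝ → ℝ, (∀ᵐ t : ℝ, t ∈ Ioo a b → solAlong h h₀ q t = V t) ∧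
      ∀ s₁ s₂, a < s₁ → s₁ ≤ s₂ → s₂ < b →
        ‖V s₂‖ₑ ≤ ‖V s₁‖ₑ + ∫⁻ t in Ioo s₁ s₂, ‖along H q t‖ₑ := by
  obtain ⟨S, hSc, hST, hSd⟩ := exists_countable_testFun a b
  have hprod : ∀ {f : ℝ × (E3 × E3) → ℝ}, IntegrableOn f (Ioc a b ×ˢ K) →
      ∀ᵐ q, q ∈ B → IntegrableOn (fun t => f (t, q)) (Ioc a b) := by
    intro f hf
    have hf' : Integrable f ((volume.restrict (Ioc a b)).prod (volume.restrict K)) := by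
      rw [Measure.prod_restrict]
      exact hf
    have h1 := ae_restrict_of_ae_restrict_of_subset hX.subset hf'.prod_left_ae
    exact (ae_restrict_iff' hX.isOpen.measurableSet).1 h1
  -- The exceptional set depends on ψ, so only countably many ψ are used here; density in the C¹
  -- norm recovers the others for each fixed q.
  have hres : ∀ᵐ q, ∀ ψ ∈ S, q ∈ B → residual ν H h h₀ a b ψ q = 0 :=
    (ae_ball_iff hSc).2 fun ψ hψ => hX.residual_ae_eq_zero ho hh hH hh₀ hw (hST ψ hψ)
  filter_upwards [hres, hprod (hX.integrableOn_along hh), hprod (hX.integrableOn_along hH),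
    hprod (hX.integrableOn_along_mul hw)] with q hq ih iH iN hqB
  replace ih : IntegrableOn (along h q) (Ioc a b) := ih hqB
  replace iH : IntegrableOn (along H q) (Ioc a b) := iH hqB
  replace iN : IntegrableOn (along (fun t p => ν t p * h t p) q) (Ioc a b) := iN hqB
  have hab := hX.lt
  have jh := (intervalIntegrable_iff_integrableOn_Ioc_of_le hab.le).2 ih
  have jH := (intervalIntegrable_iff_integrableOn_Ioc_of_le hab.le).2 iH
  have jN := (intervalIntegrable_iff_integrableOn_Ioc_of_le hab.le).2 iN
  have hall : ∀ ψ, IsTestFun a b ψ → residual ν H h h₀ a b ψ q = 0 := by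
    intro ψ hψ
    set M := (∫ t in Ioc a b, (|along h q t| + |along (fun t p => ν t p * h t p) q t| +
        |along H q t|)) + |h₀ q| with hM
    have hM0 : 0 ≤ M := add_nonneg (integral_nonneg fun t => by positivity) (abs_nonneg _)
    refine abs_eq_zero.1 (le_antisymm (le_of_forall_pos_le_add fun ε hε => ?_) (abs_nonneg _))
    obtain ⟨ψ', hψ'S, hd⟩ := hSd ψ hψ (ε / (M + 1)) (by positivity)
    have := residual_sub_le (h₀ := h₀) hψ (hST ψ' hψ'S) ih iH iN (by positivity) hd
    rw [hq ψ' hψ'S hqB, sub_zero, ← hM] at this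
    refine this.trans ?_
    rw [zero_add, div_mul_eq_mul_div, div_le_iff₀ (by positivity)]
    nlinarith
  have hind : IntervalIntegrable (fun t : ℝ => if t < 0 then h₀ q else 0) volume a b := by
    have : Measurable (fun t : ℝ => if t < 0 then h₀ q else 0) :=
      Measurable.ite measurableSet_Iio measurable_const measurable_const
    refine (intervalIntegrable_const (c := |h₀ q|)).mono_fun this.aestronglyMeasurable
      (Eventually.of_forall fun t => ?_)
    dsimp only
    split_ifs <;> simp
  have hU : IntervalIntegrable (solAlong h h₀ q) volume a b := by
    have : solAlong h h₀ q = fun t => along h q t + if t < 0 then h₀ q else 0 :=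
      funext (solAlong_eq h h₀ q)
    rw [this]
    exact jh.add hind
  obtain ⟨c, hc⟩ := exists_ae_eq_primitive
      (g := fun t => along H q t - along (fun t p => ν t p * h t p) q t) hab hU (jH.sub jN) fun ψ hψ => by
    have h1 := hall ψ hψ
    have m : ∀ {f φ : ℝ → ℝ}, IntervalIntegrable f volume a b → Continuous φ →
        IntervalIntegrable (fun t => f t * φ t) volume a b := fun hf hφ =>
      hf.mul_continuousOn hφ.continuousOn
    have m1 : IntervalIntegrable (fun t => -(along h q t * deriv ψ t)) volume a b :=
      (m jh hψ.continuous_deriv).neg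
    rw [residual, ← intervalIntegral.integral_of_le hab.le, intervalIntegral.integral_sub
      (m1.add (m jN hψ.continuous)) (m jH hψ.continuous),
      intervalIntegral.integral_add m1 (m jN hψ.continuous),
      intervalIntegral.integral_neg] at h1
    have h2 : ∫ t in a..b, solAlong h h₀ q t * deriv ψ t =
        (∫ t in a..b, along h q t * deriv ψ t) + h₀ q * ψ 0 := by
      rw [← integral_neg_time_deriv hab.le hψ, ← intervalIntegral.integral_add
        (m jh hψ.continuous_deriv) (m hind hψ.continuous_deriv)]
      refine intervalIntegral.integral_congr fun t _ => ?_
      simp only [solAlong_eq, add_mul]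
    have h3 : ∫ t in a..b, (along H q t - along (fun t p => ν t p * h t p) q t) * ψ t =
        (∫ t in a..b, along H q t * ψ t) -
          ∫ t in a..b, along (fun t p => ν t p * h t p) q t * ψ t := by
      rw [← intervalIntegral.integral_sub (m jH hψ.continuous) (m jN hψ.continuous)]
      refine intervalIntegral.integral_congr fun t _ => ?_
      ring
    refine Eq.trans h2 ?_
    refine Eq.trans ?_ (congrArg Neg.neg h3.symm)
    linarith
  refine ⟨fun t => c + ∫ s in a..t, (along H q s - along (fun t p => ν t p * h t p) q s), hc,
    fun s₁ s₂ h1 h12 h2 => ?_⟩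
  -- The product of damping term and solution is ν h² ≥ 0 at times t ≥ 0, and it is 0 at negative
  -- times, where `along` vanishes.
  have hle := abs_primitive_le jH jN (V := fun t => c + ∫ s in a..t, (along H q s -
    along (fun t p => ν t p * h t p) q s)) (fun t _ => rfl) (by
      filter_upwards [hc] with t ht htm
      have ht' := ht htm
      rw [← ht']
      by_cases h0 : t < 0
      · simp [along, h0]
      · simp only [along, if_neg h0, solAlong]
        have := hν t ⟨not_lt.1 h0, (htm.2.trans hX.lt_time).le⟩ (q.1 + t • q.2, q.2)
          ⟨hX.mem t (Ioo_subset_Icc_self htm) q (hX.subset hqB), mem_univ _⟩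
        rw [mul_assoc]
        exact mul_nonneg this (mul_self_nonneg _)) h1.le h12 h2.le
  rw [Real.enorm_eq_ofReal_abs, Real.enorm_eq_ofReal_abs]
  refine (ENNReal.ofReal_le_ofReal hle).trans ?_
  rw [ENNReal.ofReal_add (abs_nonneg _)
    (intervalIntegral.integral_nonneg h12 fun s _ => abs_nonneg _)]
  refine add_le_add_right ?_ _
  rw [intervalIntegral.integral_of_le h12, ofReal_integral_eq_lintegral_ofReal,
    setLIntegral_congr Ioo_ae_eq_Ioc]
  · refine lintegral_mono fun t => ?_
    rw [Real.enorm_eq_ofReal_abs]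
  · exact (iH.mono_set (Ioc_subset_Ioc h1.le h2.le)).abs
  · exact Eventually.of_forall fun t => abs_nonneg _

end Box

end

noncomputable section

open scoped NNReal ENNReal

variable {Ω : Set E3} {T : ℝ}

/-! ### Growth of the solution along almost every trajectory -/

section Growth

variable {ν H h : ℝ → E3 × E3 → ℝ} {h₀ : E3 × E3 → ℝ}

/-- A compact piece of a trajectory in the open set Ω stays there under small changes of the base
point. Taking U from a countable basis keeps the number of boxes countable. -/
theorem exists_isFlowBox_of_line (ho : IsOpen Ω) {a b : ℝ} (hab : a < b) (hbT : b < T)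
    {q : E3 × E3} (hq : ∀ t ∈ Icc a b, q.1 + t • q.2 ∈ Ω) :
    ∃ U ∈ TopologicalSpace.countableBasis (E3 × E3), q ∈ U ∧ IsFlowBox Ω T a b (closure U) U := by
  have hopen : ∀ᶠ q' in 𝓝 q, ∀ t ∈ Icc a b, q'.1 + t • q'.2 ∈ Ω := by
    refine isCompact_Icc.eventually_forall_of_forall_eventually fun t ht => ?_
    have : IsOpen {z : (E3 × E3) × ℝ | z.1.1 + z.2 • z.1.2 ∈ Ω} := ho.preimage (by fun_prop)
    exact this.mem_nhds (hq t ht)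
  obtain ⟨U, hU, hqU, hsub⟩ :=
    (TopologicalSpace.isBasis_countableBasis (E3 × E3)).exists_closure_subset
      (inter_mem hopen (Metric.closedBall_mem_nhds q one_pos))
  exact ⟨U, hU, hqU, hab, hbT, (isCompact_closedBall q 1).of_isClosed_subset isClosed_closure
    (hsub.trans inter_subset_right), TopologicalSpace.isOpen_of_mem_countableBasis hU,
    subset_closure, fun t ht q' hq' => (hsub hq').1 t ht⟩

/-- Boxes over basis sets with rational end times are countable, so almost every q is good for all
of them at once, whatever α and β are. The set G consists of the times at which the solution agrees
with the continuous representatives of all these boxes. Negative α is allowed and gives access to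
h₀. -/
theorem ae_exists_growth (ho : IsOpen Ω)
    (hν : ∀ t ∈ Icc 0 T, ∀ p ∈ phase Ω, 0 ≤ ν t p)
    (hh : Integrable (Function.uncurry h) (bulkTimeMeasure Ω T))
    (hH : Integrable (Function.uncurry H) (bulkTimeMeasure Ω T))
    (hh₀ : IntegrableOn h₀ (phase Ω)) (hw : IsWeakSolution Ω T ν H h₀ h) :
    ∀ᵐ q : E3 × E3, ∀ α β : ℝ, β ≤ T → (∀ t ∈ Ioo α β, q.1 + t • q.2 ∈ Ω) →
      ∃ G : Set ℝ, (∀ᵐ s : ℝ, s ∈ G) ∧ ∀ s₁ ∈ G, ∀ s₂ ∈ G, α < s₁ → s₁ ≤ s₂ → s₂ < β →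
        ‖solAlong h h₀ q s₂‖ₑ ≤ ‖solAlong h h₀ q s₁‖ₑ + ∫⁻ t in Ioo s₁ s₂, ‖along H q t‖ₑ := by
  have key : ∀ᵐ q : E3 × E3, ∀ U ∈ TopologicalSpace.countableBasis (E3 × E3), ∀ a b : ℚ,
      IsFlowBox Ω T a b (closure U) U → q ∈ U →
      ∃ V : ℝ → ℝ, (∀ᵐ t : ℝ, t ∈ Ioo (a : ℝ) b → solAlong h h₀ q t = V t) ∧
        ∀ s₁ s₂, (a : ℝ) < s₁ → s₁ ≤ s₂ → s₂ < b →
          ‖V s₂‖ₑ ≤ ‖V s₁‖ₑ + ∫⁻ t in Ioo s₁ s₂, ‖along H q t‖ₑ := by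
    refine (ae_ball_iff (TopologicalSpace.countable_countableBasis _)).2 fun U _ => ?_
    refine ae_all_iff.2 fun a => ae_all_iff.2 fun b => ae_all_iff.2 fun hX => ?_
    exact hX.ae_exists_representative ho hν hh hH hh₀ hw
  filter_upwards [key] with q hq α β hβ hline
  have hV : ∀ a b : ℚ, ∃ V : ℝ → ℝ, α < a → (a : ℝ) < b → b < β →
      ((∀ᵐ t : ℝ, t ∈ Ioo (a : ℝ) b → solAlong h h₀ q t = V t) ∧
        ∀ s₁ s₂, (a : ℝ) < s₁ → s₁ ≤ s₂ → s₂ < b →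
          ‖V s₂‖ₑ ≤ ‖V s₁‖ₑ + ∫⁻ t in Ioo s₁ s₂, ‖along H q t‖ₑ) := by
    intro a b
    by_cases hab : α < a ∧ (a : ℝ) < b ∧ b < β
    · obtain ⟨U, hU, hqU, hX⟩ := exists_isFlowBox_of_line ho hab.2.1 (hab.2.2.trans_le hβ)
        fun t ht => hline t ⟨hab.1.trans_le ht.1, ht.2.trans_lt hab.2.2⟩
      obtain ⟨V, hV⟩ := hq U hU a b hX hqU
      exact ⟨V, fun _ _ _ => hV⟩
    · exact ⟨0, fun h1 h2 h3 => absurd ⟨h1, h2, h3⟩ hab⟩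
  choose V hV using hV
  refine ⟨{s | ∀ a b : ℚ, α < a → (b : ℝ) < β → s ∈ Ioo (a : ℝ) b → solAlong h h₀ q s = V a b s},
    ?_, fun s₁ hs₁ s₂ hs₂ h1 h12 h2 => ?_⟩
  · refine ae_all_iff.2 fun a => ae_all_iff.2 fun b => ?_
    by_cases hab : α < a ∧ (a : ℝ) < b ∧ b < β
    · filter_upwards [(hV a b hab.1 hab.2.1 hab.2.2).1] with s hs _ _ using hs
    · refine Eventually.of_forall fun s h1 h2 h3 => ?_
      exact absurd ⟨h1, h3.1.trans h3.2, h2⟩ hab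
  -- Rational end times with α < a < s₁ and s₂ < b < β put both times into one box, with one
  -- representative.
  · obtain ⟨a, ha1, ha2⟩ := exists_rat_btwn h1
    obtain ⟨b, hb1, hb2⟩ := exists_rat_btwn h2
    rw [hs₁ a b ha1 hb2 ⟨ha2, h12.trans_lt hb1⟩, hs₂ a b ha1 hb2 ⟨ha2.trans_le h12, hb1⟩]
    exact (hV a b ha1 (ha2.trans_le (h12.trans hb1.le)) hb2).2 s₁ s₂ ha2 h12 hb1

end Growth

/-! ### Null sets on the boundary -/

theorem measurable_trajectory_integrand {F : ℝ × (E3 × E3) → ℝ≥0∞} (hF : Measurable F) :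
    Measurable fun z : (ℝ × (E3 × E3)) × ℝ =>
      if z.2 < z.1.1 then F (z.1.1 - z.2, (z.1.2.1 - z.2 • z.1.2.2, z.1.2.2)) else 0 := by
  refine Measurable.ite (measurableSet_lt measurable_snd (by fun_prop)) ?_ measurable_const
  exact hF.comp (f := fun z : (ℝ × (E3 × E3)) × ℝ =>
      (z.1.1 - z.2, (z.1.2.1 - z.2 • z.1.2.2, z.1.2.2))) (by fun_prop)

theorem measurable_trajectory_lintegral (ho : IsOpen Ω) {F : ℝ × (E3 × E3) → ℝ≥0∞}
    (hF : Measurable F) : Measurable fun z : ℝ × (E3 × E3) =>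
      ∫⁻ s in Ioo 0 (backTime Ω z.2.1 z.2.2),
        if s < z.1 then F (z.1 - s, (z.2.1 - s • z.2.2, z.2.2)) else 0 := by
  have hset : MeasurableSet {z : (ℝ × (E3 × E3)) × ℝ | z.2 ∈ Ioo 0 (backTime Ω z.1.2.1 z.1.2.2)} :=
    (measurableSet_lt measurable_const measurable_snd).inter (measurableSet_lt measurable_snd
      (measurable_backTime_comp ho (by fun_prop) (by fun_prop)))
  simp_rw [← lintegral_indicator measurableSet_Ioo]
  exact ((measurable_trajectory_integrand hF).indicator hset).lintegral_prod_right'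

/-- The trajectory estimate, applied to the indicator of a measurable null set, says that almost
every boundary trajectory spends no time in that set. The entry estimate is used in the same way in
`ae_entry`. -/
theorem HasC2Boundary.ae_trajectory (hΩ : HasC2Boundary Ω) (ho : IsOpen Ω)
    (hb : Bornology.IsBounded Ω) {P : ℝ × (E3 × E3) → Prop}
    (hP : ∀ᵐ w ∂(bulkTimeMeasure Ω T), P w) :
    ∀ᵐ z ∂((timeMeasure T).prod (gammaMeasure Ω)), ∀ᵐ s : ℝ, s ∈ Ioo 0 (backTime Ω z.2.1 z.2.2) →
      s < z.1 → P (z.1 - s, (z.2.1 - s • z.2.2, z.2.2)) := by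
  have := hΩ.sFinite_gammaMeasure hb
  obtain ⟨N, hN, hNm, hN0⟩ := exists_measurable_superset_of_null hP
  obtain ⟨C, hC⟩ := hΩ.exists_lintegral_trajectory_le ho hb
  have h1 := hC T (N.indicator 1) (measurable_one.indicator hNm)
  rw [lintegral_indicator_one hNm, hN0, mul_zero, nonpos_iff_eq_zero] at h1
  have hind : Measurable (N.indicator (1 : ℝ × (E3 × E3) → ℝ≥0∞)) := measurable_one.indicator hNm
  have hm := measurable_trajectory_integrand hind
  have hm2 := measurable_trajectory_lintegral ho hind
  filter_upwards [(lintegral_eq_zero_iff hm2).1 h1] with z hz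
  have h2 := (lintegral_eq_zero_iff (hm.comp measurable_prodMk_left)).1 hz
  filter_upwards [(ae_restrict_iff' measurableSet_Ioo).1 h2] with s hs hs1 hs2
  have h3 := hs hs1
  by_contra hc
  have h4 : (z.1 - s, (z.2.1 - s • z.2.2, z.2.2)) ∈ N := hN hc
  simp [hs2, h4] at h3

theorem HasC2Boundary.ae_entry (hΩ : HasC2Boundary Ω) (ho : IsOpen Ω)
    (hb : Bornology.IsBounded Ω) {P : ℝ × (E3 × E3) → Prop}
    (hP : ∀ᵐ w ∂(gammaMinusTimeMeasure Ω T), P w) :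
    ∀ᵐ z ∂((timeMeasure T).prod (gammaMeasure Ω)), 0 < backTime Ω z.2.1 z.2.2 →
      backTime Ω z.2.1 z.2.2 < z.1 → P (z.1 - backTime Ω z.2.1 z.2.2,
        (z.2.1 - backTime Ω z.2.1 z.2.2 • z.2.2, z.2.2)) := by
  obtain ⟨N, hN, hNm, hN0⟩ := exists_measurable_superset_of_null hP
  obtain ⟨C, hC⟩ := hΩ.exists_lintegral_entry_le ho hb
  have h1 := hC T (N.indicator 1) (measurable_one.indicator hNm)
  rw [lintegral_indicator_one hNm, hN0, mul_zero, nonpos_iff_eq_zero] at h1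
  have ht : Measurable fun z : ℝ × (E3 × E3) => backTime Ω z.2.1 z.2.2 :=
    measurable_backTime_comp ho (by fun_prop) (by fun_prop)
  have hm : Measurable fun z : ℝ × (E3 × E3) =>
      if 0 < backTime Ω z.2.1 z.2.2 ∧ backTime Ω z.2.1 z.2.2 < z.1 then
        N.indicator (1 : ℝ × (E3 × E3) → ℝ≥0∞) (z.1 - backTime Ω z.2.1 z.2.2,
          (z.2.1 - backTime Ω z.2.1 z.2.2 • z.2.2, z.2.2)) else 0 := by
    refine Measurable.ite ((measurableSet_lt measurable_const ht).inter
      (measurableSet_lt ht measurable_fst)) ?_ measurable_const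
    exact (measurable_one.indicator hNm).comp (f := fun z : ℝ × (E3 × E3) => (z.1 - backTime Ω z.2.1 z.2.2,
      (z.2.1 - backTime Ω z.2.1 z.2.2 • z.2.2, z.2.2))) (by fun_prop)
  filter_upwards [(lintegral_eq_zero_iff hm).1 h1] with z hz h2 h3
  by_contra hc
  have h4 : (z.1 - backTime Ω z.2.1 z.2.2,
        (z.2.1 - backTime Ω z.2.1 z.2.2 • z.2.2, z.2.2)) ∈ N := hN hc
  simp [h2, h3, h4] at hz

theorem HasC2Boundary.ae_backTime_ne (hΩ : HasC2Boundary Ω) (ho : IsOpen Ω)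
    (hb : Bornology.IsBounded Ω) :
    ∀ᵐ z ∂((timeMeasure T).prod (gammaMeasure Ω)), z.1 ≠ backTime Ω z.2.1 z.2.2 := by
  have := hΩ.sFinite_gammaMeasure hb
  have ht : Measurable fun z : ℝ × (E3 × E3) => backTime Ω z.2.1 z.2.2 :=
    measurable_backTime_comp ho (by fun_prop) (by fun_prop)
  have hm : MeasurableSet {z : ℝ × (E3 × E3) | z.1 = backTime Ω z.2.1 z.2.2} :=
    measurableSet_eq_fun measurable_fst ht
  rw [ae_iff]
  simp only [not_not]
  rw [Measure.prod_apply_symm hm]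
  refine lintegral_eq_zero_of_ae_eq_zero (Eventually.of_forall fun p => ?_)
  have : (fun t : ℝ => (t, p)) ⁻¹' {z : ℝ × (E3 × E3) | z.1 = backTime Ω z.2.1 z.2.2} =
      {backTime Ω p.1 p.2} := rfl
  beta_reduce
  rw [this, timeMeasure]
  exact le_antisymm ((Measure.restrict_apply_le _ _).trans Real.volume_singleton.le) zero_le

theorem ae_backward_base {Q : E3 × E3 → Prop} (hQ : ∀ᵐ q, Q q) :
    ∀ᵐ w ∂(bulkTimeMeasure Ω T), Q (w.2.1 - w.1 • w.2.2, w.2.2) := by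
  rw [bulkTimeMeasure_eq]
  refine ae_restrict_of_ae ?_
  have h1 : ∀ᵐ z : ℝ × (E3 × E3), Q z.2 := Measure.quasiMeasurePreserving_snd.ae hQ
  have h2 : MeasurePreserving freeFlow.symm volume volume :=
    measurePreserving_freeFlow.symm freeFlow.toMeasurableEquiv
  exact h2.quasiMeasurePreserving.ae h1

/-- The base point x - t v is the same for all points of a trajectory, so it is enough to find one
interior time at which the property, carried along by the free flow, holds. -/
theorem HasC2Boundary.ae_base (hΩ : HasC2Boundary Ω) (ho : IsOpen Ω)
    (hb : Bornology.IsBounded Ω) {Q : E3 × E3 → Prop} (hQ : ∀ᵐ q, Q q) :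
    ∀ᵐ z ∂((timeMeasure T).prod (gammaMeasure Ω)), 0 < backTime Ω z.2.1 z.2.2 → 0 < z.1 →
      Q (z.2.1 - z.1 • z.2.2, z.2.2) := by
  filter_upwards [hΩ.ae_trajectory ho hb (T := T) (ae_backward_base hQ)] with z hz h1 h2
  obtain ⟨s, hs, hsm⟩ : ∃ s, (s ∈ Ioo 0 (backTime Ω z.2.1 z.2.2) →
      s < z.1 → Q (z.2.1 - s • z.2.2 - (z.1 - s) • z.2.2, z.2.2)) ∧
      s ∈ Ioo 0 (min (backTime Ω z.2.1 z.2.2) z.1) := by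
    have : (volume.restrict (Ioo 0 (min (backTime Ω z.2.1 z.2.2) z.1))) ≠ 0 := by
      rw [Ne, Measure.restrict_eq_zero, Real.volume_Ioo, sub_zero, ENNReal.ofReal_eq_zero, not_le]
      exact lt_min h1 h2
    have : NeBot (ae (volume.restrict (Ioo 0 (min (backTime Ω z.2.1 z.2.2) z.1)))) := ae_neBot.2 this
    exact ((ae_restrict_of_ae hz).and (ae_restrict_mem measurableSet_Ioo)).exists
  have := hs ⟨hsm.1, hsm.2.trans_le (min_le_left _ _)⟩ (hsm.2.trans_le (min_le_right _ _))
  rwa [sub_sub, ← add_smul, add_sub_cancel] at this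

/-- Right neighbourhoods have positive measure, so inequalities that hold almost everywhere pass to
essential limits. -/
instance neBot_nhdsGT_inf_ae (a : ℝ) : NeBot (𝓝[>] a ⊓ ae (volume : Measure ℝ)) := by
  refine inf_neBot_iff.2 fun {s} hs {t} ht => ?_
  obtain ⟨b, hb, hsub⟩ := mem_nhdsGT_iff_exists_Ioo_subset.1 hs
  have : (volume.restrict (Ioo a b)) ≠ 0 := by
    rw [Ne, Measure.restrict_eq_zero, Real.volume_Ioo, ENNReal.ofReal_eq_zero, not_le, sub_pos]
    exact hb
  have : NeBot (ae (volume.restrict (Ioo a b))) := ae_neBot.2 this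
  obtain ⟨x, hx, hx'⟩ := ((ae_restrict_of_ae (s := Ioo a b) (mem_ae_iff.1 ht)).and
    (ae_restrict_mem measurableSet_Ioo)).exists
  exact ⟨x, hsub hx', hx⟩

/-! ### The outgoing trace is controlled along the backward trajectory -/

/-- The integral of the source along the backward trajectory that ends at `z`. -/
def sourceAlong (Ω : Set E3) (H : ℝ → E3 × E3 → ℝ) (z : ℝ × (E3 × E3)) : ℝ≥0∞ :=
  ∫⁻ s in Ioo 0 (backTime Ω z.2.1 z.2.2),
    if s < z.1 then ‖H (z.1 - s) (z.2.1 - s • z.2.2, z.2.2)‖ₑ else 0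

theorem lintegral_along_le_sourceAlong (H : ℝ → E3 × E3 → ℝ) (z : ℝ × (E3 × E3)) {s₁ : ℝ}
    (hs₁ : z.1 - backTime Ω z.2.1 z.2.2 < s₁) :
    ∫⁻ t in Ioo s₁ z.1, ‖along H (z.2.1 - z.1 • z.2.2, z.2.2) t‖ₑ ≤ sourceAlong Ω H z := by
  rw [sourceAlong, ← lintegral_indicator measurableSet_Ioo, ← lintegral_indicator measurableSet_Ioo,
    ← lintegral_sub_left_eq_self _ z.1]
  refine lintegral_mono_ae ?_
  -- The excluded s corresponds to time 0, which `along` includes and `sourceAlong` does not.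
  filter_upwards [compl_mem_ae_iff.2 (Real.volume_singleton (a := z.1))] with s hs
  rw [indicator_apply]
  split_ifs with h1
  · rw [indicator_of_mem (show s ∈ Ioo 0 (backTime Ω z.2.1 z.2.2) from
      ⟨by linarith [h1.2], by linarith [h1.1]⟩), along]
    split_ifs with h2 h3 h3
    · simp
    · simp
    · refine le_of_eq ?_
      congr 3
      module
    · exact absurd (le_antisymm (not_lt.1 h2) (by linarith)) fun hc => hs (by
        rw [mem_singleton_iff]; linarith)
  · exact zero_le

section Trace

variable {ν H h g : ℝ → E3 × E3 → ℝ} {h₀ : E3 × E3 → ℝ}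

/-- The growth bound between the time s₁ and the time t - s, in the essential limit s ↓ 0 that
defines the outgoing trace. The three bounds that follow are three choices of s₁. -/
theorem HasC2Boundary.ae_trace_le (hΩ : HasC2Boundary Ω) (ho : IsOpen Ω)
    (hb : Bornology.IsBounded Ω)
    (hν : ∀ t ∈ Icc 0 T, ∀ p ∈ phase Ω, 0 ≤ ν t p)
    (hh : Integrable (Function.uncurry h) (bulkTimeMeasure Ω T))
    (hH : Integrable (Function.uncurry H) (bulkTimeMeasure Ω T))
    (hh₀ : IntegrableOn h₀ (phase Ω)) (hw : IsWeakSolution Ω T ν H h₀ h)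
    (hg : IsOutgoingTrace Ω T h g) :
    ∀ᵐ z ∂(gammaPlusTimeMeasure Ω T), ∀ᵐ s₁ : ℝ, z.1 - backTime Ω z.2.1 z.2.2 < s₁ → s₁ < z.1 →
      ‖g z.1 z.2‖ₑ ≤ ‖solAlong h h₀ (z.2.1 - z.1 • z.2.2, z.2.2) s₁‖ₑ + sourceAlong Ω H z := by
  have := hΩ.sFinite_gammaMeasure hb
  have h1 := ae_mono (hΩ.gammaPlusTimeMeasure_le hb T)
    (hΩ.ae_base ho hb (T := T) (ae_exists_growth ho hν hh hH hh₀ hw))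
  have h2 : ∀ᵐ z ∂(gammaPlusTimeMeasure Ω T), z.2 ∈ gammaPlus Ω :=
    Measure.quasiMeasurePreserving_snd.ae (ae_restrict_mem (hΩ.measurableSet_gammaPlus hb))
  have h3 : ∀ᵐ z ∂(gammaPlusTimeMeasure Ω T), z.1 ∈ Ioc 0 T := by
    have : ∀ᵐ t ∂(timeMeasure T), t ∈ Ioc 0 T := by
      rw [timeMeasure, ← restrict_Ioc_eq_restrict_Icc]
      exact ae_restrict_mem measurableSet_Ioc
    exact Measure.quasiMeasurePreserving_fst.ae this
  filter_upwards [h1, h2, h3, hg.tendsto] with z hz hz2 hz3 htr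
  have htb := hΩ.backTime_pos hb hz2
  obtain ⟨G, hG, hgrow⟩ := hz htb hz3.1 (z.1 - backTime Ω z.2.1 z.2.2) z.1 hz3.2 (by
    intro t ht
    have := sub_smul_mem_of_lt_backTime (Ω := Ω) (x := z.2.1) (v := z.2.2) (s := z.1 - t)
      (by linarith [ht.2]) (by linarith [ht.1])
    convert! this using 1
    module)
  filter_upwards [hG] with s₁ hs₁ ha hb'
  have hlim : Tendsto (fun s : ℝ => ‖h (z.1 - s) (z.2.1 - s • z.2.2, z.2.2)‖ₑ)
      (𝓝[>] 0 ⊓ ae volume) (𝓝 ‖g z.1 z.2‖ₑ) := (continuous_enorm.tendsto _).comp htr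
  refine le_of_tendsto hlim ?_
  have e1 : ∀ᶠ s : ℝ in 𝓝[>] 0 ⊓ ae volume, s ∈ Ioo 0 (min (z.1 - s₁) z.1) :=
    mem_inf_of_left (Ioo_mem_nhdsGT (lt_min (by linarith) hz3.1))
  have e2 : ∀ᶠ s : ℝ in 𝓝[>] 0 ⊓ ae volume, z.1 - s ∈ G :=
    mem_inf_of_right ((Measure.measurePreserving_sub_left volume z.1).quasiMeasurePreserving.ae hG)
  filter_upwards [e1, e2] with s hs hsG
  have hs' := lt_min_iff.1 hs.2
  have := hgrow s₁ hs₁ (z.1 - s) hsG ha (by linarith [hs'.1]) (by linarith [hs.1])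
  rw [solAlong, if_neg (by linarith [hs'.2])] at this
  have e : z.2.1 - z.1 • z.2.2 + (z.1 - s) • z.2.2 = z.2.1 - s • z.2.2 := by module
  simp only [e] at this
  refine this.trans (add_le_add_right ?_ _)
  refine le_trans (lintegral_mono_set (Ioo_subset_Ioo_right (by linarith [hs.1])))
    (lintegral_along_le_sourceAlong H z ha)

/-- Here s₁ = t - s is a positive time during the flight. -/
theorem HasC2Boundary.ae_trace_le_bulk (hΩ : HasC2Boundary Ω) (ho : IsOpen Ω)
    (hb : Bornology.IsBounded Ω)
    (hν : ∀ t ∈ Icc 0 T, ∀ p ∈ phase Ω, 0 ≤ ν t p)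
    (hh : Integrable (Function.uncurry h) (bulkTimeMeasure Ω T))
    (hH : Integrable (Function.uncurry H) (bulkTimeMeasure Ω T))
    (hh₀ : IntegrableOn h₀ (phase Ω)) (hw : IsWeakSolution Ω T ν H h₀ h)
    (hg : IsOutgoingTrace Ω T h g) :
    ∀ᵐ z ∂(gammaPlusTimeMeasure Ω T), ∀ᵐ s : ℝ, s ∈ Ioo 0 (backTime Ω z.2.1 z.2.2) → s < z.1 →
      ‖g z.1 z.2‖ₑ ≤ ‖h (z.1 - s) (z.2.1 - s • z.2.2, z.2.2)‖ₑ + sourceAlong Ω H z := by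
  filter_upwards [hΩ.ae_trace_le ho hb hν hh hH hh₀ hw hg] with z hz
  filter_upwards [(Measure.measurePreserving_sub_left volume z.1).quasiMeasurePreserving.ae hz]
    with s hs hs1 hs2
  have := hs (by linarith [hs1.2]) (by linarith [hs1.1])
  rw [solAlong, if_neg (by linarith)] at this
  have e : z.2.1 - z.1 • z.2.2 + (z.1 - s) • z.2.2 = z.2.1 - s • z.2.2 := by module
  simpa only [e] using this

/-- If time 0 is reached before the boundary, the interval of admissible negative s₁ is nonempty,
and there the extended solution is h₀ at the base point. -/
theorem HasC2Boundary.ae_trace_le_initial (hΩ : HasC2Boundary Ω) (ho : IsOpen Ω)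
    (hb : Bornology.IsBounded Ω)
    (hν : ∀ t ∈ Icc 0 T, ∀ p ∈ phase Ω, 0 ≤ ν t p)
    (hh : Integrable (Function.uncurry h) (bulkTimeMeasure Ω T))
    (hH : Integrable (Function.uncurry H) (bulkTimeMeasure Ω T))
    (hh₀ : IntegrableOn h₀ (phase Ω)) (hw : IsWeakSolution Ω T ν H h₀ h)
    (hg : IsOutgoingTrace Ω T h g) :
    ∀ᵐ z ∂(gammaPlusTimeMeasure Ω T), z.1 < backTime Ω z.2.1 z.2.2 →
      ‖g z.1 z.2‖ₑ ≤ ‖h₀ (z.2.1 - z.1 • z.2.2, z.2.2)‖ₑ + sourceAlong Ω H z := by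
  have h3 : ∀ᵐ z ∂(gammaPlusTimeMeasure Ω T), z.1 ∈ Icc 0 T :=
    have := hΩ.sFinite_gammaMeasure hb
    Measure.quasiMeasurePreserving_fst.ae (ae_restrict_mem measurableSet_Icc)
  filter_upwards [hΩ.ae_trace_le ho hb hν hh hH hh₀ hw hg, h3] with z hz hz3 hlt
  have : (volume.restrict (Ioo (z.1 - backTime Ω z.2.1 z.2.2) 0)) ≠ 0 := by
    rw [Ne, Measure.restrict_eq_zero, Real.volume_Ioo, ENNReal.ofReal_eq_zero, not_le]
    linarith
  have : NeBot (ae (volume.restrict (Ioo (z.1 - backTime Ω z.2.1 z.2.2) 0))) := ae_neBot.2 this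
  obtain ⟨s, hs, hs'⟩ := ((ae_restrict_of_ae
    (s := Ioo (z.1 - backTime Ω z.2.1 z.2.2) 0) hz).and (ae_restrict_mem measurableSet_Ioo)).exists
  have := hs hs'.1 (hs'.2.trans_le hz3.1)
  rwa [solAlong, if_pos hs'.2] at this

/-- Here s₁ decreases to the entry time, and the essential limit of h along the trajectory is the
incoming trace at the entry point. -/
theorem HasC2Boundary.ae_trace_le_entry (hΩ : HasC2Boundary Ω) (ho : IsOpen Ω)
    (hb : Bornology.IsBounded Ω)
    (hν : ∀ t ∈ Icc 0 T, ∀ p ∈ phase Ω, 0 ≤ ν t p)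
    (hh : Integrable (Function.uncurry h) (bulkTimeMeasure Ω T))
    (hH : Integrable (Function.uncurry H) (bulkTimeMeasure Ω T))
    (hh₀ : IntegrableOn h₀ (phase Ω)) (hw : IsWeakSolution Ω T ν H h₀ h)
    (hg : IsOutgoingTrace Ω T h g) {g' : ℝ → E3 × E3 → ℝ} (hg' : IsIncomingTrace Ω T h g') :
    ∀ᵐ z ∂(gammaPlusTimeMeasure Ω T), backTime Ω z.2.1 z.2.2 < z.1 →
      ‖g z.1 z.2‖ₑ ≤ ‖g' (z.1 - backTime Ω z.2.1 z.2.2)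
        (z.2.1 - backTime Ω z.2.1 z.2.2 • z.2.2, z.2.2)‖ₑ + sourceAlong Ω H z := by
  have := hΩ.sFinite_gammaMeasure hb
  have h1 := ae_mono (hΩ.gammaPlusTimeMeasure_le hb T) (hΩ.ae_entry ho hb hg'.tendsto)
  have h2 : ∀ᵐ z ∂(gammaPlusTimeMeasure Ω T), z.2 ∈ gammaPlus Ω :=
    Measure.quasiMeasurePreserving_snd.ae (ae_restrict_mem (hΩ.measurableSet_gammaPlus hb))
  filter_upwards [hΩ.ae_trace_le ho hb hν hh hH hh₀ hw hg, h1, h2] with z hz htr hz2 hlt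
  have htb := hΩ.backTime_pos hb hz2
  have hlim := ((continuous_enorm.tendsto _).comp (htr htb hlt)).add_const (sourceAlong Ω H z)
  refine ge_of_tendsto hlim ?_
  set τ := backTime Ω z.2.1 z.2.2 with hτ
  have e1 : ∀ᶠ s : ℝ in 𝓝[>] 0 ⊓ ae volume, s ∈ Ioo 0 τ :=
    mem_inf_of_left (Ioo_mem_nhdsGT htb)
  have e2 := mem_inf_of_right (f := 𝓝[>] (0 : ℝ))
    ((measurePreserving_add_left volume (z.1 - τ)).quasiMeasurePreserving.ae hz)
  filter_upwards [e1, e2] with s hs hs2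
  have := hs2 (by linarith [hs.1]) (by linarith [hs.2])
  rw [solAlong, if_neg (by linarith [hs.1])] at this
  have e : z.2.1 - z.1 • z.2.2 + (z.1 - τ + s) • z.2.2 = z.2.1 - τ • z.2.2 + s • z.2.2 := by module
  simp only [e] at this
  exact this

end Trace

end

/-! ### Measurable majorants and estimates of the traces -/

noncomputable section

open scoped NNReal ENNReal

variable {Ω : Set E3} {T : ℝ}

/-- The majorant is infinite on a null set that contains all bad points. It dominates everywhere, so
it can be evaluated along trajectories without following null sets, and its integral is unchanged.
-/
theorem exists_measurable_majorant {α : Type*} [MeasurableSpace α] {μ : Measure α} {f : α → ℝ≥0∞}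
    (hf : AEMeasurable f μ) : ∃ F : α → ℝ≥0∞, Measurable F ∧ (∀ a, f a ≤ F a) ∧
      ∫⁻ a, F a ∂μ = ∫⁻ a, f a ∂μ ∧ F =ᵐ[μ] f := by
  classical
  have h0 : ∀ᵐ a ∂μ, f a = hf.mk f a := hf.ae_eq_mk
  obtain ⟨N, hN, hNm, hN0⟩ := exists_measurable_superset_of_null h0
  have hle : ∀ a, f a ≤ N.piecewise (fun _ => ⊤) (hf.mk f) a := by
    intro a
    by_cases ha : a ∈ N
    · simp [ha]
    · rw [piecewise_eq_of_notMem _ _ _ ha]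
      by_contra hc
      exact ha (hN fun he => hc he.le)
  have he : N.piecewise (fun _ => ⊤) (hf.mk f) =ᵐ[μ] f := by
    filter_upwards [h0, compl_mem_ae_iff.2 hN0] with a ha haN
    rw [piecewise_eq_of_notMem _ _ _ haN, ha]
  exact ⟨_, measurable_const.piecewise hNm hf.measurable_mk, hle, lintegral_congr_ae he, he⟩

/-! ### The weights -/

theorem maxwellian_pos (v : E3) : 0 < maxwellian v := Real.exp_pos _

theorem maxwellian_rpow_le_one (v : E3) : maxwellian v ^ (1 / 4 : ℝ) ≤ 1 := by
  refine Real.rpow_le_one (maxwellian_pos v).le ?_ (by norm_num)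
  rw [maxwellian, Real.exp_le_one_iff]
  have := sq_nonneg ‖v‖
  linarith

theorem measurable_maxwellian : Measurable maxwellian := by
  unfold maxwellian
  fun_prop

theorem one_le_bracket (v : E3) : 1 ≤ bracket v := by
  rw [bracket, Real.one_le_sqrt]
  linarith [sq_nonneg ‖v‖]

theorem norm_le_bracket (v : E3) : ‖v‖ ≤ bracket v := by
  rw [bracket]
  exact Real.le_sqrt_of_sq_le (by linarith)

/-- The weight `μ(v)^{1/4}` with values in `[0, ∞]`. -/
def traceWeight (v : E3) : ℝ≥0∞ := ENNReal.ofReal (maxwellian v ^ (1 / 4 : ℝ))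

theorem measurable_traceWeight : Measurable traceWeight :=
  ENNReal.measurable_ofReal.comp (measurable_maxwellian.pow_const _)

theorem traceWeight_le_one (v : E3) : traceWeight v ≤ 1 :=
  ENNReal.ofReal_le_one.2 (maxwellian_rpow_le_one v)

/-- The radial profile of `2 C √μ(v) ⟨v⟩`. -/
def diffuseWeight (C r : ℝ) : ℝ≥0∞ :=
  ENNReal.ofReal (2 * C * (Real.sqrt (Real.exp (-r ^ 2 / 2)) * Real.sqrt (1 + r ^ 2)))

theorem measurable_diffuseWeight (C : ℝ) : Measurable (diffuseWeight C) := by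
  unfold diffuseWeight
  fun_prop

theorem diffuseWeight_norm (C : ℝ) (v : E3) : diffuseWeight C ‖v‖ =
    ENNReal.ofReal (2 * C * (Real.sqrt (maxwellian v) * bracket v)) := rfl

theorem lintegral_diffuseWeight_ne_top {C : ℝ} (hC : 0 ≤ C) :
    ∫⁻ v : E3, diffuseWeight C ‖v‖ ≠ ⊤ := by
  have hint : Integrable fun v : E3 => 8 * C * Real.exp (-(1 / 8) * ‖v‖ ^ 2) := by
    have h1 := GaussianFourier.integrable_cexp_neg_mul_sq_norm_add (V := E3) (b := 1 / 8)
      (by norm_num) 0 0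
    refine Integrable.const_mul ?_ _
    refine h1.norm.congr (Eventually.of_forall fun v => ?_)
    simp only [Complex.norm_exp]
    congr 1
    simp [← Complex.ofReal_pow]
  refine ne_top_of_le_ne_top hint.2.ne (lintegral_mono fun v => ?_)
  rw [Real.enorm_of_nonneg (by positivity), diffuseWeight]
  refine ENNReal.ofReal_le_ofReal ?_
  set r := ‖v‖
  -- The factor e^{-r²/4} is split into two halves: one absorbs √(1 + r²) with the constant 4, the
  -- other is the integrable Gaussian.
  have e1 : Real.sqrt (Real.exp (-r ^ 2 / 2)) = Real.exp (-(1 / 8) * r ^ 2) *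
      Real.exp (-(1 / 8) * r ^ 2) := by
    rw [← Real.exp_add, ← Real.exp_half]
    congr 1
    ring
  have e2 : Real.sqrt (1 + r ^ 2) * Real.exp (-(1 / 8) * r ^ 2) ≤ 4 := by
    have h1 : Real.sqrt (1 + r ^ 2) ≤ 4 * Real.exp (1 / 8 * r ^ 2) := by
      have h2 := Real.add_one_le_exp (1 / 8 * r ^ 2)
      refine (Real.sqrt_le_iff.2 ⟨by positivity, ?_⟩ : _ ≤ 4 + r ^ 2 / 2).trans (by linarith)
      nlinarith [sq_nonneg r, sq_nonneg (r ^ 2)]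
    calc _ ≤ 4 * Real.exp (1 / 8 * r ^ 2) * Real.exp (-(1 / 8) * r ^ 2) := by gcongr
      _ = 4 := by rw [mul_assoc, ← Real.exp_add]; simp
  rw [e1]
  have e3 := Real.exp_pos (-(1 / 8) * r ^ 2)
  have : 2 * C * Real.exp (-(1 / 8) * r ^ 2) * (Real.sqrt (1 + r ^ 2) *
      Real.exp (-(1 / 8) * r ^ 2)) ≤ 2 * C * Real.exp (-(1 / 8) * r ^ 2) * 4 := by gcongr
  linarith

/-! ### Integrals over the boundary -/

theorem HasC2Boundary.lintegral_bdryTimeMeasure (hΩ : HasC2Boundary Ω)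
    (hb : Bornology.IsBounded Ω) (T : ℝ) {F : ℝ × (E3 × E3) → ℝ≥0∞} (hF : Measurable F) :
    ∫⁻ z, F z ∂(bdryTimeMeasure Ω T) =
      ∫⁻ t, (∫⁻ x, (∫⁻ v, F (t, (x, v))) ∂(surfaceMeasure Ω)) ∂(timeMeasure T) := by
  have := hΩ.isFiniteMeasure_surfaceMeasure hb
  have := hΩ.sFinite_boundaryMeasure hb
  rw [bdryTimeMeasure, lintegral_prod _ hF.aemeasurable]
  refine lintegral_congr fun t => ?_
  exact lintegral_prod _ (hF.comp measurable_prodMk_left).aemeasurable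

theorem HasC2Boundary.time_gamma_eq (hΩ : HasC2Boundary Ω) (hb : Bornology.IsBounded Ω) (T : ℝ) :
    (timeMeasure T).prod (gammaMeasure Ω) =
      (bdryTimeMeasure Ω T).withDensity fun z => ENNReal.ofReal |normalVel Ω z.2| := by
  have := hΩ.sFinite_boundaryMeasure hb
  rw [gammaMeasure, bdryTimeMeasure]
  exact prod_withDensity_right (ENNReal.measurable_ofReal.comp
      (continuous_abs.measurable.comp (hΩ.measurable_normalVel hb)))

theorem HasC2Boundary.lintegral_time_gamma_restrict (hΩ : HasC2Boundary Ω)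
    (hb : Bornology.IsBounded Ω) (T : ℝ) {S : Set (E3 × E3)} (hS : MeasurableSet S)
    {F : ℝ × (E3 × E3) → ℝ≥0∞} (hF : Measurable F) :
    ∫⁻ z, F z ∂((timeMeasure T).prod (gammaMeasure Ω)).restrict (univ ×ˢ S) =
      ∫⁻ z, S.indicator (fun _ => 1) z.2 * (ENNReal.ofReal |normalVel Ω z.2| * F z)
        ∂(bdryTimeMeasure Ω T) := by
  have hm : Measurable fun z : ℝ × (E3 × E3) => ENNReal.ofReal |normalVel Ω z.2| :=
    ENNReal.measurable_ofReal.comp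
      (continuous_abs.measurable.comp ((hΩ.measurable_normalVel hb).comp measurable_snd))
  have hSm : MeasurableSet ((univ : Set ℝ) ×ˢ S) := MeasurableSet.univ.prod hS
  rw [← lintegral_indicator hSm, hΩ.time_gamma_eq hb,
    lintegral_withDensity_eq_lintegral_mul _ hm (hF.indicator hSm)]
  refine lintegral_congr fun z => ?_
  by_cases hz : z.2 ∈ S
  · simp [hz]
  · simp [hz]

theorem HasC2Boundary.lintegral_gammaPlusTimeMeasure (hΩ : HasC2Boundary Ω)
    (hb : Bornology.IsBounded Ω) (T : ℝ) {F : ℝ × (E3 × E3) → ℝ≥0∞} (hF : Measurable F) :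
    ∫⁻ z, F z ∂(gammaPlusTimeMeasure Ω T) =
      ∫⁻ t, (∫⁻ x, (∫⁻ u, (gammaPlus Ω).indicator (fun _ => 1) (x, u) *
        (ENNReal.ofReal |normalVel Ω (x, u)| * F (t, (x, u)))) ∂(surfaceMeasure Ω))
          ∂(timeMeasure T) := by
  have hm : Measurable fun z : ℝ × (E3 × E3) => ENNReal.ofReal |normalVel Ω z.2| :=
    ENNReal.measurable_ofReal.comp
      (continuous_abs.measurable.comp ((hΩ.measurable_normalVel hb).comp measurable_snd))
  have hS := hΩ.measurableSet_gammaPlus hb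
  rw [hΩ.gammaPlusTimeMeasure_eq hb, hΩ.lintegral_time_gamma_restrict hb T hS hF,
    hΩ.lintegral_bdryTimeMeasure hb]
  exact ((measurable_const.indicator hS).comp measurable_snd).mul (hm.mul hF)

/-! ### The incoming trace under a diffuse bound -/

/-- The outgoing flux at `(t, x)`. -/
def outFlux (Ω : Set E3) (G : ℝ × (E3 × E3) → ℝ≥0∞) (t : ℝ) (x : E3) : ℝ≥0∞ :=
  ∫⁻ u, (gammaPlus Ω).indicator (fun _ => 1) (x, u) *
    (ENNReal.ofReal |normalVel Ω (x, u)| * (G (t, (x, u)) * traceWeight u))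

theorem HasC2Boundary.measurable_outFlux (hΩ : HasC2Boundary Ω) (hb : Bornology.IsBounded Ω)
    {G : ℝ × (E3 × E3) → ℝ≥0∞} (hG : Measurable G) :
    Measurable fun p : ℝ × E3 => outFlux Ω G p.1 p.2 := by
  have hm : Measurable fun z : E3 × E3 => ENNReal.ofReal |normalVel Ω z| :=
    ENNReal.measurable_ofReal.comp (continuous_abs.measurable.comp (hΩ.measurable_normalVel hb))
  have h1 : Measurable fun z : (ℝ × E3) × E3 => (gammaPlus Ω).indicator (fun _ => (1 : ℝ≥0∞))
      (z.1.2, z.2) * (ENNReal.ofReal |normalVel Ω (z.1.2, z.2)| *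
        (G (z.1.1, (z.1.2, z.2)) * traceWeight z.2)) := by
    have hi : Measurable fun z : (ℝ × E3) × E3 => (z.1.2, z.2) := by fun_prop
    refine ((measurable_const.indicator (hΩ.measurableSet_gammaPlus hb)).comp hi).mul
      ((hm.comp hi).mul ((hG.comp (f := fun z : (ℝ × E3) × E3 => (z.1.1, (z.1.2, z.2)))
        (by fun_prop)).mul (measurable_traceWeight.comp measurable_snd)))
  exact h1.lintegral_prod_right'

theorem ofReal_abs_integral_le_outFlux {g : ℝ → E3 × E3 → ℝ} {G : ℝ × (E3 × E3) → ℝ≥0∞}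
    (hgG : ∀ z, ‖g z.1 z.2‖ₑ ≤ G z) (hm : ∀ x, MeasurableSet {u | 0 < normalVel Ω (x, u)})
    (t : ℝ) {x : E3} (hx : x ∈ frontier Ω) :
    ‖∫ u in {u : E3 | 0 < normalVel Ω (x, u)},
      |g t (x, u)| * maxwellian u ^ (1 / 4 : ℝ) * normalVel Ω (x, u)‖ₑ ≤ outFlux Ω G t x := by
  refine (enorm_integral_le_lintegral_enorm _).trans ?_
  rw [← lintegral_indicator (hm x), outFlux]
  refine lintegral_mono fun u => ?_
  by_cases hu : 0 < normalVel Ω (x, u)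
  · rw [indicator_of_mem (show u ∈ {u | 0 < normalVel Ω (x, u)} from hu),
      indicator_of_mem (show (x, u) ∈ gammaPlus Ω from ⟨hx, hu⟩), one_mul, enorm_mul, enorm_mul,
      traceWeight, Real.enorm_abs, Real.enorm_of_nonneg (Real.rpow_nonneg (maxwellian_pos u).le _),
      Real.enorm_eq_ofReal_abs (normalVel Ω (x, u)), mul_comm]
    gcongr
    exact hgG (t, (x, u))
  · rw [indicator_of_notMem (show u ∉ {u | 0 < normalVel Ω (x, u)} from hu)]
    exact zero_le

/-- The factor n = |n·v| cancels both denominators, and n + b ≤ 2b for b = ⟨v⟩, while n + e^{-C₂r²}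
≤ 2b since also 1 ≤ b. -/
theorem diffuse_pointwise {C₁ C₂ n b s J R r c : ℝ} (hC₁ : 0 ≤ C₁) (hC₂ : 0 ≤ C₂) (hn : 0 < n)
    (hnb : n ≤ b) (hb : 1 ≤ b) (hs : 0 ≤ s)
    (h : |c| ≤ C₁ * s * (1 + b / n) * J + (1 + Real.exp (-C₂ * r ^ 2) / n) * R) :
    n * |c| ≤ 2 * C₁ * (s * b) * |J| + 2 * |b * R| := by
  have h1 := mul_le_mul_of_nonneg_left h hn.le
  have e1 : n * (C₁ * s * (1 + b / n) * J + (1 + Real.exp (-C₂ * r ^ 2) / n) * R) =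
      C₁ * s * (n + b) * J + (n + Real.exp (-C₂ * r ^ 2)) * R := by
    field_simp
  rw [e1] at h1
  have he : Real.exp (-C₂ * r ^ 2) ≤ 1 := by
    rw [Real.exp_le_one_iff]
    nlinarith [mul_nonneg hC₂ (sq_nonneg r)]
  have he0 := Real.exp_pos (-C₂ * r ^ 2)
  have b1 : C₁ * s * (n + b) * J ≤ C₁ * s * (b + b) * |J| := by
    refine (mul_le_mul_of_nonneg_left (le_abs_self J) (by positivity)).trans ?_
    gcongr
  have b2 : (n + Real.exp (-C₂ * r ^ 2)) * R ≤ (b + b) * |R| := by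
    refine (mul_le_mul_of_nonneg_left (le_abs_self R) (by positivity)).trans ?_
    gcongr
    exact he.trans hb
  rw [abs_mul, abs_of_pos (by linarith : 0 < b)]
  linarith

/-- Against dS dv the bound splits into a function of v times the flux at (t, x). The velocity
integral over the slice of S is at most κ, and the flux integrates to the weighted outgoing norm.
The set S is later the whole space, with κ of order one, and the short trajectories, with κ small.
-/
theorem HasC2Boundary.lintegral_incoming_le (hΩ : HasC2Boundary Ω) (hb : Bornology.IsBounded Ω)
    {C₁ C₂ : ℝ} (hC₁ : 0 ≤ C₁) (hC₂ : 0 ≤ C₂) {g' g R : ℝ → E3 × E3 → ℝ}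
    (hD : DiffuseBound Ω T C₁ C₂ g' g R)
    (hg : AEStronglyMeasurable (Function.uncurry g) (gammaPlusTimeMeasure Ω T))
    (hR : AEStronglyMeasurable (fun z : ℝ × (E3 × E3) => bracket z.2.2 * R z.1 z.2)
      (bdryTimeMeasure Ω T)) {S : Set (E3 × E3)} (hS : MeasurableSet S) {κ : ℝ≥0∞}
    (hκ : ∀ x ∈ frontier Ω, ∫⁻ v in {v | (x, v) ∈ S}, diffuseWeight C₁ ‖v‖ ≤ κ) :
    ∫⁻ z, S.indicator (fun _ => 1) z.2 * ‖g' z.1 z.2‖ₑ ∂(gammaMinusTimeMeasure Ω T) ≤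
      κ * (∫⁻ z, ‖g z.1 z.2‖ₑ * traceWeight z.2.2 ∂(gammaPlusTimeMeasure Ω T)) +
      2 * ∫⁻ z, ‖bracket z.2.2 * R z.1 z.2‖ₑ ∂(bdryTimeMeasure Ω T) := by
  obtain ⟨G, hGm, hgG, hGint, hGae⟩ := exists_measurable_majorant hg.enorm
  obtain ⟨Q, hQm, hRQ, hQint, -⟩ := exists_measurable_majorant hR.enorm
  have hGw : ∫⁻ z, ‖g z.1 z.2‖ₑ * traceWeight z.2.2 ∂(gammaPlusTimeMeasure Ω T) =
      ∫⁻ z, G z * traceWeight z.2.2 ∂(gammaPlusTimeMeasure Ω T) := by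
    refine lintegral_congr_ae ?_
    filter_upwards [hGae] with z hz
    rw [hz]
    rfl
  set J : ℝ × (E3 × E3) → ℝ≥0∞ := fun z => outFlux Ω G z.1 z.2.1 with hJ
  have hJm : Measurable J := (hΩ.measurable_outFlux hb hGm).comp
    (f := fun z : ℝ × (E3 × E3) => (z.1, z.2.1)) (by fun_prop)
  have hWm : Measurable fun z : ℝ × (E3 × E3) => diffuseWeight C₁ ‖z.2.2‖ :=
    (measurable_diffuseWeight C₁).comp (by fun_prop)
  have hnm : Measurable fun z : ℝ × (E3 × E3) => ENNReal.ofReal |normalVel Ω z.2| :=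
    ENNReal.measurable_ofReal.comp
      (continuous_abs.measurable.comp ((hΩ.measurable_normalVel hb).comp measurable_snd))
  have hSm : Measurable fun z : ℝ × (E3 × E3) => S.indicator (fun _ => (1 : ℝ≥0∞)) z.2 :=
    (measurable_const.indicator hS).comp measurable_snd
  -- The inverse of |n·v| in F is cancelled by the density of dγ with respect to dS dv.
  set F : ℝ × (E3 × E3) → ℝ≥0∞ := fun z => S.indicator (fun _ => 1) z.2 *
    ((ENNReal.ofReal |normalVel Ω z.2|)⁻¹ * (diffuseWeight C₁ ‖z.2.2‖ * J z + 2 * Q z)) with hF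
  have hFm : Measurable F := hSm.mul (hnm.inv.mul ((hWm.mul hJm).add (hQm.const_mul 2)))
  have hSWJ : Measurable fun z : ℝ × (E3 × E3) =>
      S.indicator (fun _ => (1 : ℝ≥0∞)) z.2 * (diffuseWeight C₁ ‖z.2.2‖ * J z) :=
    hSm.mul (hWm.mul hJm)
  have hGt : Measurable fun z : ℝ × (E3 × E3) => G z * traceWeight z.2.2 :=
    hGm.mul (measurable_traceWeight.comp (measurable_snd.comp measurable_snd))
  have hmem : ∀ᵐ z ∂(gammaMinusTimeMeasure Ω T), z.2 ∈ gammaMinus Ω := by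
    have := hΩ.sFinite_gammaMeasure hb
    exact Measure.quasiMeasurePreserving_snd.ae (ae_restrict_mem (hΩ.measurableSet_gammaMinus hb))
  have hnx : ∀ x, MeasurableSet {u | 0 < normalVel Ω (x, u)} := fun x =>
    measurableSet_lt measurable_const ((hΩ.measurable_normalVel hb).comp measurable_prodMk_left)
  have step1 : ∫⁻ z, S.indicator (fun _ => 1) z.2 * ‖g' z.1 z.2‖ₑ ∂(gammaMinusTimeMeasure Ω T) ≤
      ∫⁻ z, F z ∂(gammaMinusTimeMeasure Ω T) := by
    refine lintegral_mono_ae ?_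
    filter_upwards [hD, hmem] with z hz hz2
    refine mul_le_mul_right ?_ _
    have hn : 0 < |normalVel Ω z.2| := abs_pos.2 hz2.2.ne
    have h1 := diffuse_pointwise hC₁ hC₂ hn ((hΩ.abs_normalVel_le z.2).trans (norm_le_bracket z.2.2))
      (one_le_bracket z.2.2) (Real.sqrt_nonneg _) hz
    rw [mul_comm (ENNReal.ofReal |normalVel Ω z.2|)⁻¹, ← div_eq_mul_inv, ENNReal.le_div_iff_mul_le
      (Or.inl (ENNReal.ofReal_pos.2 hn).ne') (Or.inl ENNReal.ofReal_ne_top), mul_comm,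
      Real.enorm_eq_ofReal_abs, ← ENNReal.ofReal_mul hn.le]
    refine (ENNReal.ofReal_le_ofReal h1).trans (ENNReal.ofReal_add_le.trans ?_)
    rw [ENNReal.ofReal_mul' (abs_nonneg _), ← Real.enorm_eq_ofReal_abs,
      ENNReal.ofReal_mul' (abs_nonneg _), ← Real.enorm_eq_ofReal_abs, diffuseWeight_norm,
      ENNReal.ofReal_ofNat]
    gcongr
    · exact ofReal_abs_integral_le_outFlux hgG hnx z.1 hz2.1
    · exact hRQ z
  have step2 : ∫⁻ z, F z ∂(gammaMinusTimeMeasure Ω T) ≤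
      ∫⁻ z, (S.indicator (fun _ => 1) z.2 * (diffuseWeight C₁ ‖z.2.2‖ * J z) + 2 * Q z)
        ∂(bdryTimeMeasure Ω T) := by
    rw [hΩ.gammaMinusTimeMeasure_eq hb, hΩ.lintegral_time_gamma_restrict hb T
      (hΩ.measurableSet_gammaMinus hb) hFm]
    refine lintegral_mono fun z => ?_
    have i1 : ∀ A : Set (E3 × E3), A.indicator (fun _ => (1 : ℝ≥0∞)) z.2 ≤ 1 := fun A =>
      indicator_apply_le' (fun _ => le_rfl) fun _ => zero_le_one
    calc (gammaMinus Ω).indicator (fun _ => 1) z.2 * (ENNReal.ofReal |normalVel Ω z.2| * F z)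
        ≤ 1 * (ENNReal.ofReal |normalVel Ω z.2| * F z) := by gcongr; exact i1 _
      _ = (ENNReal.ofReal |normalVel Ω z.2| * (ENNReal.ofReal |normalVel Ω z.2|)⁻¹) *
          (S.indicator (fun _ => 1) z.2 * (diffuseWeight C₁ ‖z.2.2‖ * J z + 2 * Q z)) := by
        rw [hF]; ring
      _ ≤ 1 * (S.indicator (fun _ => 1) z.2 * (diffuseWeight C₁ ‖z.2.2‖ * J z + 2 * Q z)) := by
        gcongr; exact ENNReal.mul_inv_le_one _
      _ = S.indicator (fun _ => 1) z.2 * (diffuseWeight C₁ ‖z.2.2‖ * J z) +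
          S.indicator (fun _ => 1) z.2 * (2 * Q z) := by ring
      _ ≤ S.indicator (fun _ => 1) z.2 * (diffuseWeight C₁ ‖z.2.2‖ * J z) + 1 * (2 * Q z) := by
        gcongr; exact i1 _
      _ = _ := by rw [one_mul]
  have step3 : ∫⁻ z, S.indicator (fun _ => 1) z.2 * (diffuseWeight C₁ ‖z.2.2‖ * J z)
        ∂(bdryTimeMeasure Ω T) ≤ κ * ∫⁻ z, G z * traceWeight z.2.2 ∂(gammaPlusTimeMeasure Ω T) := by
    rw [hΩ.lintegral_bdryTimeMeasure hb T hSWJ,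
      hΩ.lintegral_gammaPlusTimeMeasure hb T hGt]
    have hJ2 := hΩ.measurable_outFlux hb hGm
    have := hΩ.isFiniteMeasure_surfaceMeasure hb
    have hJt : ∀ t, Measurable fun x => outFlux Ω G t x := fun t => hJ2.comp measurable_prodMk_left
    have hJi : Measurable fun t => ∫⁻ x, outFlux Ω G t x ∂(surfaceMeasure Ω) :=
      hJ2.lintegral_prod_right'
    change _ ≤ κ * ∫⁻ t, (∫⁻ x, outFlux Ω G t x ∂(surfaceMeasure Ω)) ∂(timeMeasure T)
    rw [← lintegral_const_mul _ hJi]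
    refine lintegral_mono fun t => ?_
    beta_reduce
    rw [← lintegral_const_mul _ (hJt t)]
    refine lintegral_mono_ae ?_
    filter_upwards [surfaceMeasure_ae_mem Ω] with x hx
    have hSx : MeasurableSet {v | (x, v) ∈ S} := measurable_prodMk_left hS
    calc ∫⁻ v, S.indicator (fun _ => 1) (x, v) * (diffuseWeight C₁ ‖v‖ * outFlux Ω G t x)
        = (∫⁻ v in {v | (x, v) ∈ S}, diffuseWeight C₁ ‖v‖) * outFlux Ω G t x := by
          have hWn : Measurable fun v : E3 => diffuseWeight C₁ ‖v‖ :=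
            (measurable_diffuseWeight C₁).comp measurable_norm
          rw [← lintegral_mul_const _ hWn, ← lintegral_indicator hSx]
          refine lintegral_congr fun v => ?_
          by_cases hv : (x, v) ∈ S
          · simp [hv]
          · simp [hv]
      _ ≤ κ * outFlux Ω G t x := mul_le_mul_left (hκ x hx) _
  calc _ ≤ _ := step1.trans step2
    _ = (∫⁻ z, S.indicator (fun _ => 1) z.2 * (diffuseWeight C₁ ‖z.2.2‖ * J z)
          ∂(bdryTimeMeasure Ω T)) + 2 * ∫⁻ z, Q z ∂(bdryTimeMeasure Ω T) := by
        rw [lintegral_add_left hSWJ, lintegral_const_mul _ hQm]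
    _ ≤ _ := by
        rw [hGw, hQint]
        exact add_le_add_left step3 _

/-! ### The outgoing trace -/

theorem backTime_entry (ho : IsOpen Ω) {x v : E3} (hx : x ∈ frontier Ω)
    (h : 0 < backTime Ω x v) :
    backTime Ω (x - backTime Ω x v • v) (-v) = backTime Ω x v := by
  refine backTime_eq h (fun r hr hr' => ?_) ?_
  · have : x - backTime Ω x v • v - r • -v = x - (backTime Ω x v - r) • v := by module
    rw [this]
    exact sub_smul_mem_of_lt_backTime (by linarith) (by linarith)
  · have : x - backTime Ω x v • v - backTime Ω x v • -v = x := by module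
    rw [this]
    exact notMem_of_mem_frontier ho hx

/-- The phase points of the boundary whose forward trajectory stays in `Ω` for a time at most
`ε`. -/
def shortSet (Ω : Set E3) (ε : ℝ) : Set (E3 × E3) :=
  {p | 0 < backTime Ω p.1 (-p.2) ∧ backTime Ω p.1 (-p.2) < ε}

theorem measurableSet_shortSet (ho : IsOpen Ω) (ε : ℝ) : MeasurableSet (shortSet Ω ε) := by
  have : Measurable fun p : E3 × E3 => backTime Ω p.1 (-p.2) :=
    measurable_backTime_comp ho measurable_fst measurable_snd.neg
  exact (measurableSet_lt measurable_const this).inter (measurableSet_lt this measurable_const)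

/-- Each outgoing point is charged to the initial datum, to an average over a flight of length at
least ε, or to the entry point of a short flight. The constant does not depend on ε, which is what
later allows ε to be chosen after it. -/
theorem HasC2Boundary.exists_lintegral_outgoing_le (hΩ : HasC2Boundary Ω) (ho : IsOpen Ω)
    (hb : Bornology.IsBounded Ω) : ∃ C : ℝ≥0, ∀ (ε : ℝ), 0 < ε → ∀ (T : ℝ)
      (h H g : ℝ → E3 × E3 → ℝ) (h₀ : E3 × E3 → ℝ),
      AEStronglyMeasurable (Function.uncurry h) (bulkTimeMeasure Ω T) →
      AEStronglyMeasurable (Function.uncurry H) (bulkTimeMeasure Ω T) →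
      AEStronglyMeasurable h₀ (volume.restrict (phase Ω)) →
      AEStronglyMeasurable (Function.uncurry g) (gammaMinusTimeMeasure Ω T) →
      (∀ᵐ z ∂(gammaPlusTimeMeasure Ω T), ∀ᵐ s : ℝ, s ∈ Ioo 0 (backTime Ω z.2.1 z.2.2) → s < z.1 →
        ‖g z.1 z.2‖ₑ ≤ ‖h (z.1 - s) (z.2.1 - s • z.2.2, z.2.2)‖ₑ + sourceAlong Ω H z) →
      (∀ᵐ z ∂(gammaPlusTimeMeasure Ω T), z.1 < backTime Ω z.2.1 z.2.2 →
        ‖g z.1 z.2‖ₑ ≤ ‖h₀ (z.2.1 - z.1 • z.2.2, z.2.2)‖ₑ + sourceAlong Ω H z) →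
      (∀ᵐ z ∂(gammaPlusTimeMeasure Ω T), backTime Ω z.2.1 z.2.2 < z.1 →
        ‖g z.1 z.2‖ₑ ≤ ‖g (z.1 - backTime Ω z.2.1 z.2.2)
          (z.2.1 - backTime Ω z.2.1 z.2.2 • z.2.2, z.2.2)‖ₑ + sourceAlong Ω H z) →
      ∫⁻ z, ‖g z.1 z.2‖ₑ * traceWeight z.2.2 ∂(gammaPlusTimeMeasure Ω T) ≤
        C * ((∫⁻ z, ‖H z.1 z.2‖ₑ ∂(bulkTimeMeasure Ω T)) + (∫⁻ p in phase Ω, ‖h₀ p‖ₑ) +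
          (ENNReal.ofReal ε)⁻¹ * (∫⁻ z, ‖h z.1 z.2‖ₑ ∂(bulkTimeMeasure Ω T)) +
          ∫⁻ z, (shortSet Ω ε).indicator (fun _ => 1) z.2 * ‖g z.1 z.2‖ₑ
            ∂(gammaMinusTimeMeasure Ω T)) := by
  obtain ⟨Ct, hCt⟩ := hΩ.exists_lintegral_trajectory_le ho hb
  obtain ⟨Ci, hCi⟩ := hΩ.exists_lintegral_initial_le ho hb
  obtain ⟨Ce, hCe⟩ := hΩ.exists_lintegral_entry_le ho hb
  refine ⟨Ct + Ci + Ce, fun ε hε T h H g h₀ hh hH hh₀ hg hbulk hinit hentry => ?_⟩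
  have := hΩ.sFinite_gammaMeasure hb
  obtain ⟨h', hm', hle', hint', -⟩ := exists_measurable_majorant hh.enorm
  obtain ⟨H', Hm', Hle', Hint', -⟩ := exists_measurable_majorant hH.enorm
  obtain ⟨k', km', kle', kint', -⟩ := exists_measurable_majorant hh₀.enorm
  obtain ⟨g', gm', gle', -, gae'⟩ := exists_measurable_majorant hg.enorm
  have hset := measurableSet_shortSet ho ε
  set Φ : ℝ × (E3 × E3) → ℝ≥0∞ := fun z => (shortSet Ω ε).indicator (fun _ => 1) z.2 * g' z with hΦ
  have hΦm : Measurable Φ := ((measurable_const.indicator hset).comp measurable_snd).mul gm'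
  have hΦint : ∫⁻ z, Φ z ∂(gammaMinusTimeMeasure Ω T) =
      ∫⁻ z, (shortSet Ω ε).indicator (fun _ => 1) z.2 * ‖g z.1 z.2‖ₑ
        ∂(gammaMinusTimeMeasure Ω T) := by
    refine lintegral_congr_ae ?_
    filter_upwards [gae'] with z hz
    rw [hΦ]
    beta_reduce
    rw [hz]
    rfl
  have htm : Measurable fun z : ℝ × (E3 × E3) => backTime Ω z.2.1 z.2.2 :=
    measurable_backTime_comp ho (by fun_prop) (by fun_prop)
  set A₁ : ℝ × (E3 × E3) → ℝ≥0∞ := fun z => ∫⁻ s in Ioo 0 (backTime Ω z.2.1 z.2.2),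
        if s < z.1 then H' (z.1 - s, (z.2.1 - s • z.2.2, z.2.2)) else 0 with hA₁
  set A₂ : ℝ × (E3 × E3) → ℝ≥0∞ := fun z => if z.1 < backTime Ω z.2.1 z.2.2 then
    k' (z.2.1 - z.1 • z.2.2, z.2.2) else 0 with hA₂
  set A₃ : ℝ × (E3 × E3) → ℝ≥0∞ := fun z => ∫⁻ s in Ioo 0 (backTime Ω z.2.1 z.2.2),
        if s < z.1 then h' (z.1 - s, (z.2.1 - s • z.2.2, z.2.2)) else 0 with hA₃
  set A₄ : ℝ × (E3 × E3) → ℝ≥0∞ := fun z =>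
    if 0 < backTime Ω z.2.1 z.2.2 ∧ backTime Ω z.2.1 z.2.2 < z.1 then
        Φ (z.1 - backTime Ω z.2.1 z.2.2, (z.2.1 - backTime Ω z.2.1 z.2.2 • z.2.2, z.2.2)) else 0
    with hA₄
  have m₁ : Measurable A₁ := measurable_trajectory_lintegral ho Hm'
  have m₂ : Measurable A₂ := Measurable.ite (measurableSet_lt measurable_fst htm)
    (km'.comp (f := fun z : ℝ × (E3 × E3) => (z.2.1 - z.1 • z.2.2, z.2.2)) (by fun_prop))
    measurable_const
  have m₃ : Measurable A₃ := measurable_trajectory_lintegral ho hm'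
  have hsrc : ∀ z, sourceAlong Ω H z ≤ A₁ z := by
    intro z
    refine lintegral_mono fun s => ?_
    beta_reduce
    split_ifs
    · exact Hle' _
    · exact le_rfl
  have hmem : ∀ᵐ z ∂(gammaPlusTimeMeasure Ω T), z.2 ∈ gammaPlus Ω :=
    Measure.quasiMeasurePreserving_snd.ae (ae_restrict_mem (hΩ.measurableSet_gammaPlus hb))
  have hpt : ∀ᵐ z ∂(gammaPlusTimeMeasure Ω T), ‖g z.1 z.2‖ₑ * traceWeight z.2.2 ≤
      A₁ z + (A₂ z + ((ENNReal.ofReal ε)⁻¹ * A₃ z + A₄ z)) := by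
    filter_upwards [hbulk, hinit, hentry, hmem,
      ae_mono (hΩ.gammaPlusTimeMeasure_le hb T) (hΩ.ae_backTime_ne ho hb)]
      with z hz1 hz2 hz3 hz4 hz5
    have htb := hΩ.backTime_pos hb hz4
    refine (mul_le_of_le_one_right' (traceWeight_le_one _)).trans ?_
    rcases lt_or_gt_of_ne hz5 with hlt | hgt
    · refine (hz2 hlt).trans ?_
      rw [add_comm]
      refine add_le_add (hsrc z) (le_add_right ?_)
      rw [hA₂]
      beta_reduce
      rw [if_pos hlt]
      exact kle' _
    rcases le_or_gt ε (backTime Ω z.2.1 z.2.2) with hle | hshort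
    -- On a long flight the trace bound holds for almost all s in (0, ε); integrating it over s and
    -- dividing by ε gives the average.
    · have h1 : ‖g z.1 z.2‖ₑ * ENNReal.ofReal ε ≤ A₃ z + sourceAlong Ω H z * ENNReal.ofReal ε := by
        have e1 : ∀ c : ℝ≥0∞, ∫⁻ _ in Ioo 0 ε, c = c * ENNReal.ofReal ε := fun c => by
          rw [setLIntegral_const, Real.volume_Ioo, sub_zero]
        rw [← e1, ← e1, hA₃]
        beta_reduce
        rw [← lintegral_indicator measurableSet_Ioo, ← lintegral_indicator measurableSet_Ioo,
          ← lintegral_indicator measurableSet_Ioo, ← lintegral_add_right _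
            (measurable_const.indicator measurableSet_Ioo)]
        refine lintegral_mono_ae ?_
        filter_upwards [hz1] with s hs
        by_cases hsε : s ∈ Ioo 0 ε
        · have hsb : s ∈ Ioo 0 (backTime Ω z.2.1 z.2.2) := ⟨hsε.1, hsε.2.trans_le hle⟩
          have hst := hsb.2.trans hgt
          rw [indicator_of_mem hsε, indicator_of_mem hsε, indicator_of_mem hsb]
          rw [if_pos hst]
          exact (hs hsb hst).trans (add_le_add_left (hle' _) _)
        · rw [indicator_of_notMem hsε]
          exact zero_le
      have hε0 : ENNReal.ofReal ε ≠ 0 := (ENNReal.ofReal_pos.2 hε).ne'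
      calc ‖g z.1 z.2‖ₑ = ‖g z.1 z.2‖ₑ * ENNReal.ofReal ε * (ENNReal.ofReal ε)⁻¹ := by
            rw [mul_assoc, ENNReal.mul_inv_cancel hε0 ENNReal.ofReal_ne_top, mul_one]
        _ ≤ (A₃ z + sourceAlong Ω H z * ENNReal.ofReal ε) * (ENNReal.ofReal ε)⁻¹ := by gcongr
        _ = sourceAlong Ω H z + (ENNReal.ofReal ε)⁻¹ * A₃ z := by
            rw [add_mul, mul_assoc, ENNReal.mul_inv_cancel hε0 ENNReal.ofReal_ne_top, mul_one,
              add_comm, mul_comm (A₃ z)]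
        _ ≤ _ := add_le_add (hsrc z) (le_add_left (le_add_right le_rfl))
    · refine (hz3 hgt).trans ?_
      rw [add_comm]
      refine add_le_add (hsrc z) (le_add_left (le_add_left ?_))
      -- Seen from the entry point the forward flight time equals the backward one, so the entry
      -- point is itself a short phase point.
      have hs : (z.2.1 - backTime Ω z.2.1 z.2.2 • z.2.2, z.2.2) ∈ shortSet Ω ε := by
        rw [shortSet, mem_ofPred_eq, backTime_entry ho hz4.1 htb]
        exact ⟨htb, hshort⟩
      rw [hA₄]
      beta_reduce
      rw [if_pos ⟨htb, hgt⟩, hΦ]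
      beta_reduce
      rw [indicator_of_mem hs, one_mul]
      exact gle' _
  refine (lintegral_mono_ae hpt).trans ((lintegral_mono' (hΩ.gammaPlusTimeMeasure_le hb T)
    le_rfl).trans ?_)
  rw [lintegral_add_left m₁, lintegral_add_left m₂, lintegral_add_left (m₃.const_mul _),
    lintegral_const_mul _ m₃]
  have b₁ := hCt T H' Hm'
  have b₂ := hCi T k' km'
  have b₃ := hCt T h' hm'
  have b₄ := hCe T Φ hΦm
  rw [Hint'] at b₁
  rw [kint'] at b₂
  rw [hint'] at b₃
  rw [hΦint] at b₄
  have c₁ : (Ct : ℝ≥0∞) ≤ ((Ct + Ci + Ce : ℝ≥0) : ℝ≥0∞) := by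
    exact_mod_cast (le_self_add.trans le_self_add : Ct ≤ Ct + Ci + Ce)
  have c₂ : (Ci : ℝ≥0∞) ≤ ((Ct + Ci + Ce : ℝ≥0) : ℝ≥0∞) := by
    exact_mod_cast (le_add_self.trans le_self_add : Ci ≤ Ct + Ci + Ce)
  have c₃ : (Ce : ℝ≥0∞) ≤ ((Ct + Ci + Ce : ℝ≥0) : ℝ≥0∞) := by
    exact_mod_cast (le_add_self : Ce ≤ Ct + Ci + Ce)
  rw [mul_add, mul_add, mul_add, add_assoc, add_assoc, mul_left_comm]
  refine add_le_add (b₁.trans (mul_le_mul_left c₁ _)) (add_le_add (b₂.trans (mul_le_mul_left c₂ _))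
    (add_le_add (mul_le_mul_right (b₃.trans (mul_le_mul_left c₁ _)) _)
      (b₄.trans (mul_le_mul_left c₃ _))))

end

/-! ### Two reflections and the conclusion -/

noncomputable section

open scoped NNReal ENNReal

variable {Ω : Set E3} {T : ℝ}

theorem timeMeasure_mono {s t : ℝ} (h : s ≤ t) : timeMeasure s ≤ timeMeasure t :=
  Measure.restrict_mono (Icc_subset_Icc_right h) le_rfl

theorem HasC2Boundary.gammaPlusTimeMeasure_mono (hΩ : HasC2Boundary Ω)
    (hb : Bornology.IsBounded Ω) {s t : ℝ} (h : s ≤ t) :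
    gammaPlusTimeMeasure Ω s ≤ gammaPlusTimeMeasure Ω t := by
  have := hΩ.sFinite_gammaMeasure hb
  exact Measure.prod_mono (timeMeasure_mono h) le_rfl

theorem HasC2Boundary.gammaMinusTimeMeasure_mono (hΩ : HasC2Boundary Ω)
    (hb : Bornology.IsBounded Ω) {s t : ℝ} (h : s ≤ t) :
    gammaMinusTimeMeasure Ω s ≤ gammaMinusTimeMeasure Ω t := by
  have := hΩ.sFinite_gammaMeasure hb
  exact Measure.prod_mono (timeMeasure_mono h) le_rfl

theorem HasC2Boundary.bdryTimeMeasure_mono (hΩ : HasC2Boundary Ω)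
    (hb : Bornology.IsBounded Ω) {s t : ℝ} (h : s ≤ t) :
    bdryTimeMeasure Ω s ≤ bdryTimeMeasure Ω t := by
  have := hΩ.sFinite_boundaryMeasure hb
  exact Measure.prod_mono (timeMeasure_mono h) le_rfl

theorem bulkTimeMeasure_mono {s t : ℝ} (h : s ≤ t) : bulkTimeMeasure Ω s ≤ bulkTimeMeasure Ω t :=
  Measure.prod_mono (timeMeasure_mono h) le_rfl

/-- Two consecutive diffuse reflections control the incoming trace by a small multiple of the
outgoing trace and by the data. -/
theorem HasC2Boundary.exists_incoming_le (hΩ : HasC2Boundary Ω) (ho : IsOpen Ω)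
    (hb : Bornology.IsBounded Ω) {C₁ C₂ : ℝ} (hC₁ : 0 ≤ C₁) (hC₂ : 0 ≤ C₂) {δ : ℝ≥0} (hδ : 0 < δ) :
    ∃ C : ℝ≥0, 0 < C ∧ ∀ (T : ℝ) (ν h H g₀ g₁ g₂ R₀ R₁ : ℝ → E3 × E3 → ℝ) (h₀ : E3 × E3 → ℝ),
      (∀ t ∈ Icc 0 T, ∀ p ∈ phase Ω, 0 ≤ ν t p) →
      Integrable (Function.uncurry h) (bulkTimeMeasure Ω T) →
      Integrable (Function.uncurry H) (bulkTimeMeasure Ω T) →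
      IntegrableOn h₀ (phase Ω) →
      IsWeakSolution Ω T ν H h₀ h →
      IsOutgoingTrace Ω T h g₁ → IsIncomingTrace Ω T h g₁ →
      AEStronglyMeasurable (Function.uncurry g₀) (gammaPlusTimeMeasure Ω T) →
      AEStronglyMeasurable (fun z : ℝ × (E3 × E3) => bracket z.2.2 * R₀ z.1 z.2)
        (bdryTimeMeasure Ω T) →
      AEStronglyMeasurable (fun z : ℝ × (E3 × E3) => bracket z.2.2 * R₁ z.1 z.2)
        (bdryTimeMeasure Ω T) →
      DiffuseBound Ω T C₁ C₂ g₁ g₀ R₀ → DiffuseBound Ω T C₁ C₂ g₂ g₁ R₁ →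
      ∀ t ≤ T, ∫⁻ z, ‖g₂ z.1 z.2‖ₑ ∂(gammaMinusTimeMeasure Ω t) ≤
        δ * (∫⁻ z, ‖g₀ z.1 z.2‖ₑ ∂(gammaPlusTimeMeasure Ω t)) +
        C * ((∫⁻ p in phase Ω, ‖h₀ p‖ₑ) +
          (((∫⁻ z, ‖h z.1 z.2‖ₑ ∂(bulkTimeMeasure Ω t)) +
            ∫⁻ z, ‖bracket z.2.2 * R₁ z.1 z.2‖ₑ ∂(bdryTimeMeasure Ω t)) +
          ((∫⁻ z, ‖H z.1 z.2‖ₑ ∂(bulkTimeMeasure Ω t)) +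
            ∫⁻ z, ‖bracket z.2.2 * R₀ z.1 z.2‖ₑ ∂(bdryTimeMeasure Ω t)))) := by
  obtain ⟨C, hC⟩ := hΩ.exists_lintegral_outgoing_le ho hb
  have hfin := lintegral_diffuseWeight_ne_top hC₁
  obtain ⟨A, hA⟩ : ∃ A : ℝ≥0, (A : ℝ≥0∞) = ∫⁻ v : E3, diffuseWeight C₁ ‖v‖ :=
    ⟨_, ENNReal.coe_toNNReal hfin⟩
  -- The two reflections and the flight between them produce the factor A·C·κ, which must not exceed
  -- δ. Adding 1 keeps the denominator positive.
  set κ : ℝ≥0 := δ / (A * C + 1) with hκdef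
  have hκ : 0 < κ := by positivity
  have hκδ : A * C * κ ≤ δ := by
    rw [hκdef, mul_div_assoc', div_le_iff₀ (by positivity), mul_comm]
    gcongr
    exact le_self_add
  obtain ⟨ε, hε, hshort⟩ := hΩ.exists_lintegral_short_le ho hb (measurable_diffuseWeight C₁) hfin
    (κ := κ) (by exact_mod_cast hκ)
  set e : ℝ≥0 := ε.toNNReal⁻¹ with he
  have hee : (ENNReal.ofReal ε)⁻¹ = (e : ℝ≥0∞) := by
    rw [he, ENNReal.coe_inv (Real.toNNReal_pos.2 hε).ne']
    rfl
  -- One constant above all coefficients that arise: A·C for h₀ and H, A·C/ε for h, 2·A·C for R₀ and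
  -- 2 for R₁.
  refine ⟨A * C * (3 + e) + 2, by positivity, ?_⟩
  intro T ν h H g₀ g₁ g₂ R₀ R₁ h₀ hν hh hH hh₀ hw hout hin hg₀ hR₀ hR₁ hD₀ hD₁ t ht
  have hP := hΩ.gammaPlusTimeMeasure_mono hb ht
  have hM := hΩ.gammaMinusTimeMeasure_mono hb ht
  have hB := hΩ.bdryTimeMeasure_mono hb ht
  have hK := bulkTimeMeasure_mono (Ω := Ω) ht
  -- First reflection, over all velocities: the bound on the velocity integral is its total A.
  have s₁ := hΩ.lintegral_incoming_le hb hC₁ hC₂ (ae_mono hM hD₁)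
    (hout.aestronglyMeasurable.mono_measure hP) (hR₁.mono_measure hB) MeasurableSet.univ (κ := A)
    fun x _ => by
      rw [hA]
      exact setLIntegral_le_lintegral _ _
  have s₂ := hC ε hε t h H g₁ h₀ (hh.1.mono_measure hK) (hH.1.mono_measure hK) hh₀.1
    (hin.aestronglyMeasurable.mono_measure hM)
    (ae_mono hP (hΩ.ae_trace_le_bulk ho hb hν hh hH hh₀ hw hout))
    (ae_mono hP (hΩ.ae_trace_le_initial ho hb hν hh hH hh₀ hw hout))
    (ae_mono hP (hΩ.ae_trace_le_entry ho hb hν hh hH hh₀ hw hout hin))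
  -- Second reflection, at the entry points of short flights only: here the velocity integral is at
  -- most κ.
  have s₃ := hΩ.lintegral_incoming_le hb hC₁ hC₂ (ae_mono hM hD₀)
    (hg₀.mono_measure hP) (hR₀.mono_measure hB) (measurableSet_shortSet ho ε) (κ := κ) hshort
  have s₄ : ∫⁻ z, ‖g₀ z.1 z.2‖ₑ * traceWeight z.2.2 ∂(gammaPlusTimeMeasure Ω t) ≤
      ∫⁻ z, ‖g₀ z.1 z.2‖ₑ ∂(gammaPlusTimeMeasure Ω t) :=
    lintegral_mono fun z => mul_le_of_le_one_right' (traceWeight_le_one _)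
  simp only [indicator_univ, one_mul] at s₁
  rw [hee] at s₂
  generalize ∫⁻ z, ‖g₂ z.1 z.2‖ₑ ∂(gammaMinusTimeMeasure Ω t) = L at *
  generalize ∫⁻ z, ‖g₁ z.1 z.2‖ₑ * traceWeight z.2.2 ∂(gammaPlusTimeMeasure Ω t) = P at *
  generalize ∫⁻ z, ‖g₀ z.1 z.2‖ₑ * traceWeight z.2.2 ∂(gammaPlusTimeMeasure Ω t) = P₀ at *
  generalize ∫⁻ z, ‖g₀ z.1 z.2‖ₑ ∂(gammaPlusTimeMeasure Ω t) = G at *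
  generalize ∫⁻ z, ‖bracket z.2.2 * R₁ z.1 z.2‖ₑ ∂(bdryTimeMeasure Ω t) = r₁ at *
  generalize ∫⁻ z, ‖bracket z.2.2 * R₀ z.1 z.2‖ₑ ∂(bdryTimeMeasure Ω t) = r₀ at *
  generalize ∫⁻ z, ‖h z.1 z.2‖ₑ ∂(bulkTimeMeasure Ω t) = k at *
  generalize ∫⁻ z, ‖H z.1 z.2‖ₑ ∂(bulkTimeMeasure Ω t) = l at *
  generalize ∫⁻ p in phase Ω, ‖h₀ p‖ₑ = k₀ at *
  have hκδ' : (A * C * κ : ℝ≥0∞) ≤ δ := by exact_mod_cast hκδ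
  have hexp : (((A * C * (3 + e) + 2 : ℝ≥0)) : ℝ≥0∞) = 3 * (A * C) + A * C * e + 2 := by
    push_cast
    ring
  calc L ≤ A * P + 2 * r₁ := s₁
    _ ≤ A * (C * (l + k₀ + e * k + (κ * G + 2 * r₀))) + 2 * r₁ := by
        gcongr
        refine s₂.trans ?_
        gcongr
        refine s₃.trans ?_
        gcongr
    _ = A * C * κ * G + ((A * C) * k₀ + ((A * C * e * k + 2 * r₁) +
          (A * C * l + 2 * (A * C) * r₀))) := by ring
    _ ≤ δ * G + ((3 * (A * C) + A * C * e + 2) * k₀ + (((3 * (A * C) + A * C * e + 2) * k +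
          (3 * (A * C) + A * C * e + 2) * r₁) + ((3 * (A * C) + A * C * e + 2) * l +
          (3 * (A * C) + A * C * e + 2) * r₀))) := by
        have a1 : (A * C : ℝ≥0∞) ≤ 3 * (A * C) + A * C * e + 2 := by
          refine le_add_right (le_add_right ?_)
          exact le_mul_of_one_le_left' (by norm_num)
        have a2 : (A * C * e : ℝ≥0∞) ≤ 3 * (A * C) + A * C * e + 2 :=
          le_add_right le_add_self
        have a3 : (2 : ℝ≥0∞) ≤ 3 * (A * C) + A * C * e + 2 := le_add_self
        have a4 : (2 * (A * C) : ℝ≥0∞) ≤ 3 * (A * C) + A * C * e + 2 := by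
          refine le_add_right (le_add_right ?_)
          gcongr
          norm_num
        gcongr
    _ = _ := by rw [hexp]; ring

theorem lintegral_enorm_time_prod {μ : Measure (E3 × E3)} [SFinite μ] {f : ℝ → E3 × E3 → ℝ}
    {t : ℝ} (ht : 0 ≤ t) (hf : Integrable (Function.uncurry f) ((timeMeasure t).prod μ)) :
    ∫⁻ z, ‖f z.1 z.2‖ₑ ∂((timeMeasure t).prod μ) =
      ENNReal.ofReal (∫ s in (0 : ℝ)..t, ∫ p, |f s p| ∂μ) := by
  have h1 : ∫⁻ z, ‖f z.1 z.2‖ₑ ∂((timeMeasure t).prod μ) =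
      ENNReal.ofReal (∫ z, ‖Function.uncurry f z‖ ∂((timeMeasure t).prod μ)) := by
    rw [integral_norm_eq_lintegral_enorm hf.1, ENNReal.ofReal_toReal hf.2.ne]
    rfl
  rw [h1, integral_prod _ hf.norm, intervalIntegral.integral_of_le ht, timeMeasure,
    integral_Icc_eq_integral_Ioc]
  rfl

theorem intervalIntegral_abs_nonneg {μ : Measure (E3 × E3)} {f : ℝ → E3 × E3 → ℝ}
    {t : ℝ} (ht : 0 ≤ t) : 0 ≤ ∫ s in (0 : ℝ)..t, ∫ p, |f s p| ∂μ :=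
  intervalIntegral.integral_nonneg ht fun _ _ => integral_nonneg fun _ => abs_nonneg _

end

end KineticTrace

theorem proposition1 (Ω : Set E3) (hΩo : IsOpen Ω) (hΩb : Bornology.IsBounded Ω)
    (hΩ : HasC2Boundary Ω) (C₁ C₂ : ℝ) (hC₁ : 0 < C₁) (hC₂ : 0 < C₂) :
    ∃ K : ℝ, 0 < K ∧ ∃ δ₀ : ℝ, 0 < δ₀ ∧ ∀ δ : ℝ, 0 < δ → δ < δ₀ → ∃ Cδ : ℝ, 0 < Cδ ∧
      ∀ (T : ℝ) (_ : 0 < T)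
        (ν : ℝ → E3 × E3 → ℝ) (_ : Measurable (Function.uncurry ν))
        (_ : ∀ t ∈ Icc 0 T, ∀ p ∈ phase Ω, 0 ≤ ν t p)
        (h₀ : E3 × E3 → ℝ) (_ : IntegrableOn h₀ (phase Ω))
        -- the sequences `h^m`, their traces `hγ^m` on the boundary, and `H^m`, `R^m`
        (h hγ H R : ℕ → ℝ → E3 × E3 → ℝ)
        (_ : ∀ m, MemLinftyL1 Ω T (h m))
        (_ : ∀ m, IsOutgoingTrace Ω T (h m) (hγ m))
        (_ : ∀ m, Integrable (Function.uncurry (hγ m)) (gammaPlusTimeMeasure Ω T))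
        (_ : ∀ m, Integrable (Function.uncurry (H m)) (bulkTimeMeasure Ω T))
        (_ : ∀ m, Integrable (fun z : ℝ × (E3 × E3) => bracket z.2.2 * R m z.1 z.2)
          (bdryTimeMeasure Ω T))
        (_ : ∀ m, IsWeakSolution Ω T ν (H m) h₀ (h (m + 1)))
        (_ : ∀ m, IsIncomingTrace Ω T (h (m + 1)) (hγ (m + 1)))
        (_ : ∀ m, DiffuseBound Ω T C₁ C₂ (hγ (m + 1)) (hγ m) (R m))
        (m : ℕ) (_ : 1 ≤ m),
        Integrable (Function.uncurry (hγ (m + 1))) (gammaMinusTimeMeasure Ω T) ∧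
        ∀ t ∈ Icc 0 T,
          ∫ s in (0 : ℝ)..t, gammaMinusNorm Ω (hγ (m + 1) s) ≤
            K * δ * (∫ s in (0 : ℝ)..t, gammaPlusNorm Ω (hγ (m - 1) s)) +
            Cδ * bulkNorm Ω h₀ +
            Cδ * max
              ((∫ s in (0 : ℝ)..t, bulkNorm Ω (h m s)) +
                (∫ s in (0 : ℝ)..t, bdryNorm Ω (fun p => bracket p.2 * R m s p)) +
                ∫ s in (0 : ℝ)..t, bulkNorm Ω (H m s))
              ((∫ s in (0 : ℝ)..t, bulkNorm Ω (h (m - 1) s)) +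
                (∫ s in (0 : ℝ)..t, bdryNorm Ω (fun p => bracket p.2 * R (m - 1) s p)) +
                ∫ s in (0 : ℝ)..t, bulkNorm Ω (H (m - 1) s)) := by
  -- Since κ can be tuned to any prescribed δ, the values K = 1 and δ₀ = 1 serve.
  refine ⟨1, one_pos, 1, one_pos, fun δ hδ _ => ?_⟩
  obtain ⟨C, hC, hest⟩ := hΩ.exists_incoming_le hΩo hΩb hC₁.le hC₂.le (δ := δ.toNNReal)
    (Real.toNNReal_pos.2 hδ)
  -- The terms with h^m and R^m belong to the brace with index m, those with H^{m-1} and R^{m-1} to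
  -- the brace with index m - 1; each group is at most the maximum, hence the factor 2.
  refine ⟨2 * C, by positivity, ?_⟩
  intro T hT ν _ hν h₀ hh₀ h hγ H R hh hout hplus hH hR hw hin hD m hm
  obtain ⟨j, rfl⟩ := Nat.exists_eq_add_of_le' hm
  rw [Nat.add_sub_cancel]
  have := hΩ.sFinite_gammaMeasure hΩb
  have := hΩ.sFinite_boundaryMeasure hΩb
  have hE := hest T ν (h (j + 1)) (H j) (hγ j) (hγ (j + 1)) (hγ (j + 2)) (R j) (R (j + 1)) h₀ hν
    (hh (j + 1)).integrable (hH j) hh₀ (hw j) (hout (j + 1)) (hin j) (hplus j).1 (hR j).1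
    (hR (j + 1)).1 (hD j) (hD (j + 1))
  have hfin : ∀ t ∈ Icc 0 T, ∫⁻ z, ‖hγ (j + 2) z.1 z.2‖ₑ ∂(gammaMinusTimeMeasure Ω t) ≤
      ENNReal.ofReal (δ * (∫ s in (0 : ℝ)..t, gammaPlusNorm Ω (hγ j s)) +
        C * (bulkNorm Ω h₀ + (((∫ s in (0 : ℝ)..t, bulkNorm Ω (h (j + 1) s)) +
          ∫ s in (0 : ℝ)..t, bdryNorm Ω (fun p => bracket p.2 * R (j + 1) s p)) +
          ((∫ s in (0 : ℝ)..t, bulkNorm Ω (H j s)) +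
            ∫ s in (0 : ℝ)..t, bdryNorm Ω (fun p => bracket p.2 * R j s p))))) := by
    intro t ht
    have hb1 := bulkTimeMeasure_mono (Ω := Ω) ht.2
    have hb2 := hΩ.bdryTimeMeasure_mono hΩb ht.2
    have e₀ : ∫⁻ p in phase Ω, ‖h₀ p‖ₑ = ENNReal.ofReal (bulkNorm Ω h₀) := by
      rw [bulkNorm, ← ENNReal.ofReal_toReal hh₀.2.ne, ← integral_norm_eq_lintegral_enorm hh₀.1]
      rfl
    have e₁ := lintegral_enorm_time_prod ht.1
      ((hplus j).mono_measure (hΩ.gammaPlusTimeMeasure_mono hΩb ht.2))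
    have e₂ := lintegral_enorm_time_prod ht.1 ((hh (j + 1)).integrable.mono_measure hb1)
    have e₃ := lintegral_enorm_time_prod ht.1 ((hH j).mono_measure hb1)
    have e₄ := lintegral_enorm_time_prod (f := fun s p => bracket p.2 * R j s p) ht.1
      ((hR j).mono_measure hb2)
    have e₅ := lintegral_enorm_time_prod (f := fun s p => bracket p.2 * R (j + 1) s p) ht.1
      ((hR (j + 1)).mono_measure hb2)
    have hE' := hE t ht.2
    unfold gammaPlusTimeMeasure bulkTimeMeasure bdryTimeMeasure at hE'
    rw [e₀, e₁, e₂, e₃, e₄, e₅] at hE'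
    refine hE'.trans (le_of_eq ?_)
    have n₀ : 0 ≤ bulkNorm Ω h₀ := integral_nonneg fun _ => abs_nonneg _
    have n₁ : 0 ≤ ∫ s in (0 : ℝ)..t, gammaPlusNorm Ω (hγ j s) := intervalIntegral_abs_nonneg ht.1
    have n₂ : 0 ≤ ∫ s in (0 : ℝ)..t, bulkNorm Ω (h (j + 1) s) := intervalIntegral_abs_nonneg ht.1
    have n₃ : 0 ≤ ∫ s in (0 : ℝ)..t, bulkNorm Ω (H j s) := intervalIntegral_abs_nonneg ht.1
    have n₄ : 0 ≤ ∫ s in (0 : ℝ)..t, bdryNorm Ω (fun p => bracket p.2 * R j s p) :=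
      intervalIntegral_abs_nonneg ht.1
    have n₅ : 0 ≤ ∫ s in (0 : ℝ)..t, bdryNorm Ω (fun p => bracket p.2 * R (j + 1) s p) :=
      intervalIntegral_abs_nonneg ht.1
    rw [ENNReal.ofReal_add (by positivity) (by positivity), ENNReal.ofReal_mul hδ.le,
      ENNReal.ofReal_mul C.coe_nonneg, ENNReal.ofReal_coe_nnreal,
      ENNReal.ofReal_add n₀ (by positivity), ENNReal.ofReal_add (by positivity) (by positivity),
      ENNReal.ofReal_add n₂ n₅, ENNReal.ofReal_add n₃ n₄]
    rfl
  -- The estimate in [0, ∞] assumes nothing about the size of the incoming trace; its right side is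
  -- finite at t = T, which gives integrability and permits the return to real integrals.
  have hint : Integrable (Function.uncurry (hγ (j + 2))) (gammaMinusTimeMeasure Ω T) :=
    ⟨(hin (j + 1)).aestronglyMeasurable,
      (hfin T ⟨hT.le, le_rfl⟩).trans_lt ENNReal.ofReal_lt_top⟩
  refine ⟨hint, fun t ht => ?_⟩
  have hle := hfin t ht
  have e₆ := lintegral_enorm_time_prod ht.1
    (hint.mono_measure (hΩ.gammaMinusTimeMeasure_mono hΩb ht.2))
  unfold gammaMinusTimeMeasure at hle
  rw [e₆] at hle
  have n₀ : 0 ≤ bulkNorm Ω h₀ := integral_nonneg fun _ => abs_nonneg _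
  have n₁ : 0 ≤ ∫ s in (0 : ℝ)..t, gammaPlusNorm Ω (hγ j s) := intervalIntegral_abs_nonneg ht.1
  have n₂ : 0 ≤ ∫ s in (0 : ℝ)..t, bulkNorm Ω (h (j + 1) s) := intervalIntegral_abs_nonneg ht.1
  have n₃ : 0 ≤ ∫ s in (0 : ℝ)..t, bulkNorm Ω (H j s) := intervalIntegral_abs_nonneg ht.1
  have n₄ : 0 ≤ ∫ s in (0 : ℝ)..t, bdryNorm Ω (fun p => bracket p.2 * R j s p) :=
    intervalIntegral_abs_nonneg ht.1
  have n₅ : 0 ≤ ∫ s in (0 : ℝ)..t, bdryNorm Ω (fun p => bracket p.2 * R (j + 1) s p) :=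
    intervalIntegral_abs_nonneg ht.1
  have n₆ : 0 ≤ ∫ s in (0 : ℝ)..t, bulkNorm Ω (h j s) := intervalIntegral_abs_nonneg ht.1
  have n₇ : 0 ≤ ∫ s in (0 : ℝ)..t, bulkNorm Ω (H (j + 1) s) := intervalIntegral_abs_nonneg ht.1
  refine ((ENNReal.ofReal_le_ofReal_iff (by positivity)).1 hle).trans ?_
  have hmax₁ := le_max_left
    ((∫ s in (0 : ℝ)..t, bulkNorm Ω (h (j + 1) s)) +
      (∫ s in (0 : ℝ)..t, bdryNorm Ω (fun p => bracket p.2 * R (j + 1) s p)) +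
      ∫ s in (0 : ℝ)..t, bulkNorm Ω (H (j + 1) s))
    ((∫ s in (0 : ℝ)..t, bulkNorm Ω (h j s)) +
      (∫ s in (0 : ℝ)..t, bdryNorm Ω (fun p => bracket p.2 * R j s p)) +
      ∫ s in (0 : ℝ)..t, bulkNorm Ω (H j s))
  have hmax₂ := le_max_right
    ((∫ s in (0 : ℝ)..t, bulkNorm Ω (h (j + 1) s)) +
      (∫ s in (0 : ℝ)..t, bdryNorm Ω (fun p => bracket p.2 * R (j + 1) s p)) +
      ∫ s in (0 : ℝ)..t, bulkNorm Ω (H (j + 1) s))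
    ((∫ s in (0 : ℝ)..t, bulkNorm Ω (h j s)) +
      (∫ s in (0 : ℝ)..t, bdryNorm Ω (fun p => bracket p.2 * R j s p)) +
      ∫ s in (0 : ℝ)..t, bulkNorm Ω (H j s))
  have hsum := mul_le_mul_of_nonneg_left (a := (C : ℝ)) (add_le_add
    (le_add_of_nonneg_left n₀ : bulkNorm Ω h₀ ≤ bulkNorm Ω h₀ + bulkNorm Ω h₀)
    (add_le_add ((le_add_of_nonneg_right n₇).trans hmax₁)
      (((add_comm _ _).trans_le (le_add_of_nonneg_left n₆)).trans
        ((add_assoc _ _ _).symm.trans_le hmax₂)))) C.coe_nonneg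
  linarith
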